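/- Cardinality constrained scheduling on two machines: given a positive integer $k$ and jobs of positive rational sizes $p_1,\dots,p_n$, a feasible schedule assigns every job to one of two machines so that each machine gets at most $k$ jobs; its cost (makespan) is the maximum, over the two machines, of the total size of the jobs assigned to it. Jobs are released one by one, and an algorithm has to hold, after each release, a feasible schedule of the jobs released so far (as long as one exists, i.e. $n\le 2k$), which depends only on these jobs, on $k$ and on $\varepsilon$. Its migration factor is at most $\beta$ if, whenever a job of size $p$ is released, the previously released jobs whose machine is changed have total size at most $\beta p$. Theorem. There is a robust FPTAS with migration factor $O(1/\varepsilon^5)$ for two machines and $k>1/\varepsilon^2$. That is, there are a constant $C$, polynomials $P,Q$ and a single algorithm, which gets $\lceil 1/\varepsilon\rceil$, $k$ and the jobs released so far, such that for every real $\varepsilon>0$ and every integer $k>1/\varepsilon^2$: after each release the schedule of the algorithm is feasible and its makespan is at most $(1+\varepsilon)$ times the optimal makespan for the jobs released so far; the migration factor is at most $C/\varepsilon^5$; and each schedule is computed in time at most $P(1/\varepsilon)\cdot Q(L)$, where $L$ is the binary encoding length of $k$ and of the sizes of the jobs released so far (time is the logarithmic cost on a random access machine). -/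

import Mathlib

/-! ### Cardinality constrained scheduling -/

namespace CCS

/-- `σ` assigns `n` jobs to `m` machines; it is feasible if every machine gets at most `k` jobs. -/
def Feasible {n m : ℕ} (k : ℕ) (σ : Fin n → Fin m) : Prop :=
  ∀ i : Fin m, (Finset.univ.filter fun j => σ j = i).card ≤ k

/-- Total size of the jobs that the schedule `σ` assigns to machine `i`. -/
noncomputable def load {n m : ℕ} (p : Fin n → ℚ) (σ : Fin n → Fin m) (i : Fin m) : ℝ :=
  ∑ j ∈ Finset.univ.filter (fun j => σ j = i), (p j : ℝ)

/-- Maximum load of a machine. -/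
noncomputable def makespan {n m : ℕ} (p : Fin n → ℚ) (σ : Fin n → Fin m) : ℝ :=
  ⨆ i : Fin m, load p σ i

/-- Optimal (offline) makespan of a feasible schedule on `m` machines with cardinality bound `k`.
The set is finite, and it is nonempty whenever `n ≤ m * k`. -/
noncomputable def optCost {n : ℕ} (m k : ℕ) (p : Fin n → ℚ) : ℝ :=
  sInf {c : ℝ | ∃ σ : Fin n → Fin m, Feasible k σ ∧ c = makespan p σ}

/-- A deterministic algorithm that gets the jobs one by one: to every finite sequence of job sizes
(the jobs released so far) it assigns the schedule that it holds after the last job of that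
sequence. -/
abbrev OnlineAlg (m : ℕ) := ∀ n : ℕ, (Fin n → ℚ) → Fin n → Fin m

/-- A sequence of jobs of positive size that admits a feasible schedule on `m` machines with
cardinality bound `k`. -/
def ValidInput {n : ℕ} (m k : ℕ) (p : Fin n → ℚ) : Prop :=
  (∀ j, 0 < p j) ∧ n ≤ m * k

/-- When the last job of `p` is released, the total size of the earlier jobs that are moved to
another machine. -/
noncomputable def migration {m n : ℕ} (A : OnlineAlg m) (p : Fin (n + 1) → ℚ) : ℝ :=
  ∑ j ∈ Finset.univ.filter
      (fun j : Fin n => A n (fun l => p l.castSucc) j ≠ A (n + 1) p j.castSucc),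
    (p j.castSucc : ℝ)

/-- At every time the schedule of `A` is feasible and has cost at most `α` times the optimal cost
for the jobs released so far, and the migration factor of `A` is at most `β`. -/
structure IsRobustApprox (m k : ℕ) (α β : ℝ) (A : OnlineAlg m) : Prop where
  feasible : ∀ (n : ℕ) (p : Fin n → ℚ), ValidInput m k p → Feasible k (A n p)
  approx : ∀ (n : ℕ) (p : Fin n → ℚ), ValidInput m k p →
    makespan p (A n p) ≤ α * optCost m k p
  migrate : ∀ (n : ℕ) (p : Fin (n + 1) → ℚ), ValidInput m k p →
    migration A p ≤ β * (p (Fin.last n) : ℝ)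

/-- Binary encoding length of an instance: the number of bits of `k` and of the numerators and
denominators of all job sizes. -/
def encLength {n : ℕ} (k : ℕ) (p : Fin n → ℚ) : ℕ :=
  Nat.size k + ∑ j, (Nat.size (p j).num.natAbs + Nat.size (p j).den)

/-! ### Random access machine with logarithmic cost -/

/-- Memory: registers and arrays, all of whose cells hold natural numbers. -/
structure Mem where
  reg : ℕ → ℕ
  arr : ℕ → ℕ → ℕ

/-- Arithmetic expressions; `get a e` reads the cell of array `a` with index `e`. -/
inductive Expr where
  | const (c : ℕ)
  | reg (x : ℕ)
  | get (a : ℕ) (e : Expr)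
  | add (e f : Expr)
  | sub (e f : Expr)
  | mul (e f : Expr)
  | div (e f : Expr)

/-- Value of an expression (`sub` is truncated at zero, `div` rounds down). -/
def Expr.val (M : Mem) : Expr → ℕ
  | .const c => c
  | .reg x => M.reg x
  | .get a e => M.arr a (e.val M)
  | .add e f => e.val M + f.val M
  | .sub e f => e.val M - f.val M
  | .mul e f => e.val M * f.val M
  | .div e f => e.val M / f.val M

/-- Logarithmic cost of evaluating an expression: every node is charged one unit plus the number of
bits of its value, so that the bits of all operands, indices and results are paid for. -/
def Expr.cost (M : Mem) : Expr → ℕ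
  | .const c => Nat.size c + 1
  | .reg x => Nat.size (M.reg x) + 1
  | .get a e => e.cost M + (Nat.size (M.arr a (e.val M)) + 1)
  | .add e f => e.cost M + f.cost M + (Nat.size (e.val M + f.val M) + 1)
  | .sub e f => e.cost M + f.cost M + (Nat.size (e.val M - f.val M) + 1)
  | .mul e f => e.cost M + f.cost M + (Nat.size (e.val M * f.val M) + 1)
  | .div e f => e.cost M + f.cost M + (Nat.size (e.val M / f.val M) + 1)

/-- Programs; a test succeeds if the value of its expression is nonzero. -/
inductive Prog where
  | skip
  | set (x : ℕ) (e : Expr)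
  | put (a : ℕ) (i e : Expr)
  | seq (P Q : Prog)
  | cond (e : Expr) (P Q : Prog)
  | loop (e : Expr) (P : Prog)

/-- Write `v` to register `x`. -/
def Mem.setReg (M : Mem) (x v : ℕ) : Mem :=
  { M with reg := Function.update M.reg x v }

/-- Write `v` to the cell of array `a` with index `i`. -/
def Mem.setArr (M : Mem) (a i v : ℕ) : Mem :=
  { M with arr := Function.update M.arr a (Function.update (M.arr a) i v) }

/-- `Exec P M t M'`: started in memory `M`, the program `P` halts in memory `M'` at total
cost `t`. The rules are deterministic; `loop e P` is the loop "while `e ≠ 0` do `P`". -/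
inductive Exec : Prog → Mem → ℕ → Mem → Prop where
  | skip (M : Mem) : Exec .skip M 1 M
  | set (x : ℕ) (e : Expr) (M : Mem) :
      Exec (.set x e) M (e.cost M + 1) (M.setReg x (e.val M))
  | put (a : ℕ) (i e : Expr) (M : Mem) :
      Exec (.put a i e) M (i.cost M + e.cost M + 1) (M.setArr a (i.val M) (e.val M))
  | seq {P Q : Prog} {M M' M'' : Mem} {s t : ℕ} :
      Exec P M s M' → Exec Q M' t M'' → Exec (.seq P Q) M (s + t) M''
  | condTrue {e : Expr} {P Q : Prog} {M M' : Mem} {t : ℕ} :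
      e.val M ≠ 0 → Exec P M t M' → Exec (.cond e P Q) M (e.cost M + 1 + t) M'
  | condFalse {e : Expr} {P Q : Prog} {M M' : Mem} {t : ℕ} :
      e.val M = 0 → Exec Q M t M' → Exec (.cond e P Q) M (e.cost M + 1 + t) M'
  | loopTrue {e : Expr} {P : Prog} {M M' M'' : Mem} {s t : ℕ} :
      e.val M ≠ 0 → Exec P M s M' → Exec (.loop e P) M' t M'' →
      Exec (.loop e P) M (e.cost M + 1 + s + t) M''
  | loopFalse {e : Expr} {P : Prog} {M : Mem} :
      e.val M = 0 → Exec (.loop e P) M (e.cost M + 1) M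

/-- Initial memory: register `0` holds the accuracy parameter `N`, register `1` the cardinality
bound `k`, register `2` the number `n` of jobs released so far; arrays `0` and `1` hold the
numerators and denominators of their sizes (in lowest terms). Everything else is zero. -/
def inputMem {n : ℕ} (N k : ℕ) (p : Fin n → ℚ) : Mem where
  reg x := if x = 0 then N else if x = 1 then k else if x = 2 then n else 0
  arr a i :=
    if h : i < n then
      if a = 0 then (p ⟨i, h⟩).num.natAbs else if a = 1 then (p ⟨i, h⟩).den else 0
    else 0

/-- The program, started on accuracy `N`, bound `k` and job sequence `p`, halts with cost at most
`T`, and cells `0, …, n-1` of array `2` then hold the machines of the schedule `σ`. -/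
def OutputsInTime {n m : ℕ} (prog : Prog) (N k : ℕ) (p : Fin n → ℚ) (σ : Fin n → Fin m)
    (T : ℝ) : Prop :=
  ∃ (t : ℕ) (M : Mem), Exec prog (inputMem N k p) t M ∧ (t : ℝ) ≤ T ∧
    ∀ j : Fin n, M.arr 2 j = (σ j : ℕ)

end CCS

/-!
Let `N = ⌈1/ε⌉`. If `N ≤ 1`, every feasible schedule is good enough, since its makespan is at most
twice the optimum; the first `k` jobs then stay on the first machine. So let `N > 1`.

Sizes are rounded down to `O(log N)` significant binary digits, so that two different sizes differ
by at least the fraction `1 / (16 N + 1)` of the larger one. The algorithm starts afresh whenever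
the new job has at least the fraction `1 / Δ` of the total size, where `Δ = O(N³)`: the new job then
pays for the migration of all others. The jobs that are this big at a fresh start are partitioned
almost optimally by a dynamic program and keep their machines until the next one.

The small jobs are ranked by size. Fill up with jobs of size `0` to `2κ` ranks, where `κ` is the
number of small jobs that fit on either machine. The `T` largest ones go to the machine with less
load, the `T` smallest ones to the other machine, and those in between alternate, which keeps the
loads of the latter within one job of each other. The `i`-th pair exchanged in this way shifts
`s i - s (2κ - 1 - i)` of load, and `T` is chosen so that the big jobs are balanced, or is `κ` if
they cannot be; in that case no schedule is much better.

If the arrival of a small job changes `T`, then the sizes in the affected ranks are paid for by the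
load that has to be shifted, which changes by at most a multiple of the size of the new job. Which
of the jobs of one size move is irrelevant, so that the migration is measured by the number of jobs
of each size on each machine. Below the size of the new job, the ranks of all jobs shift by one, and
this changes each of these numbers by at most one; by the gaps between sizes, the sizes that occur
add up to at most `16 N + 1` times the size of the new job.

All of this is expressed by arithmetic operations within loops of polynomially bounded length. Such
functions are closed under composition, and the machine computes each of them in polynomial time.
-/

namespace CCS

open Polynomial Finset

/-! ### Programs with cost bounds -/

/-- Total correctness with a cost bound: started in `M`, the program `P` halts at cost at most `T`
in a memory with property `post`. -/
def HaltsWithin (P : Prog) (M : Mem) (T : ℕ) (post : Mem → Prop) : Prop :=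
  ∃ (t : ℕ) (M' : Mem), Exec P M t M' ∧ t ≤ T ∧ post M'

namespace HaltsWithin

variable {P Q : Prog} {M : Mem} {s t T : ℕ} {φ ψ : Mem → Prop}

theorem mono (h : HaltsWithin P M t φ) (ht : t ≤ T) (hφ : ∀ M', φ M' → ψ M') :
    HaltsWithin P M T ψ :=
  let ⟨u, M', exec, hu, hM'⟩ := h
  ⟨u, M', exec, hu.trans ht, hφ M' hM'⟩

theorem le (h : HaltsWithin P M t φ) (ht : t ≤ T) : HaltsWithin P M T φ :=
  h.mono ht fun _ => id

theorem seq (hP : HaltsWithin P M s φ) (hQ : ∀ M', φ M' → HaltsWithin Q M' t ψ) :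
    HaltsWithin (.seq P Q) M (s + t) ψ := by
  obtain ⟨s', M', execP, hs', hM'⟩ := hP
  obtain ⟨t', M'', execQ, ht', hM''⟩ := hQ M' hM'
  exact ⟨_, M'', .seq execP execQ, add_le_add hs' ht', hM''⟩

theorem set {x : ℕ} {e : Expr} (hcost : e.cost M + 1 ≤ T) (hφ : φ (M.setReg x (e.val M))) :
    HaltsWithin (.set x e) M T φ :=
  ⟨_, _, .set x e M, hcost, hφ⟩

theorem put {a : ℕ} {i e : Expr} (hcost : i.cost M + e.cost M + 1 ≤ T)
    (hφ : φ (M.setArr a (i.val M) (e.val M))) : HaltsWithin (.put a i e) M T φ :=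
  ⟨_, _, .put a i e M, hcost, hφ⟩

theorem loop {e : Expr} {body : Prog} {m c τ : ℕ} {inv : ℕ → Mem → Prop}
    (htest : ∀ i ≤ m, ∀ M, inv i M → (e.val M ≠ 0 ↔ i < m) ∧ e.cost M ≤ c)
    (hbody : ∀ i < m, ∀ M, inv i M → HaltsWithin body M τ (inv (i + 1))) (hM : inv 0 M) :
    HaltsWithin (.loop e body) M ((m + 1) * (c + 1 + τ)) (inv m) := by
  suffices H : ∀ d i M, i + d = m → inv i M →
      HaltsWithin (.loop e body) M ((d + 1) * (c + 1 + τ)) (inv m) from H m 0 M (zero_add m) hM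
  intro d
  induction d with
  | zero =>
    intro i M hi hM
    obtain rfl : i = m := hi
    obtain ⟨test, cost⟩ := htest i le_rfl M hM
    have exit : e.val M = 0 := of_not_not fun h => lt_irrefl i (test.1 h)
    exact ⟨_, M, .loopFalse exit, by omega, hM⟩
  | succ d ih =>
    intro i M hi hM
    obtain ⟨test, cost⟩ := htest i (by omega) M hM
    obtain ⟨t, M₁, exec, ht, hM₁⟩ := hbody i (by omega) M hM
    obtain ⟨u, M₂, exec', hu, hM₂⟩ := ih (i + 1) M₁ (by omega) hM₁
    refine ⟨_, M₂, .loopTrue (test.2 (by omega)) exec exec', ?_, hM₂⟩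
    rw [add_mul (d + 1), one_mul]
    omega

end HaltsWithin

@[simp] theorem Mem.setReg_reg_self (M : Mem) (x v : ℕ) : (M.setReg x v).reg x = v :=
  Function.update_self _ _ _

theorem Mem.setReg_reg_of_ne (M : Mem) {x y : ℕ} (v : ℕ) (h : y ≠ x) :
    (M.setReg x v).reg y = M.reg y :=
  Function.update_of_ne h _ _

theorem sum_range_le_mul {f : ℕ → ℕ} {m B : ℕ} (hf : ∀ i < m, f i ≤ B) :
    ∑ i ∈ range m, f i ≤ m * B := by
  simpa using sum_le_card_nsmul (range m) f B fun i hi => hf i (mem_range.1 hi)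

/-! ### Bit lengths -/

theorem size_le_self (x : ℕ) : Nat.size x ≤ x :=
  Nat.size_le.2 Nat.lt_two_pow_self

theorem size_mul_le (x y : ℕ) : Nat.size (x * y) ≤ Nat.size x + Nat.size y := by
  rw [Nat.size_le, pow_add]
  exact Nat.mul_lt_mul'' (Nat.lt_size_self x) (Nat.lt_size_self y)

theorem size_add_le (x y : ℕ) : Nat.size (x + y) ≤ Nat.size x + Nat.size y + 1 := by
  have lt (z w : ℕ) : z < 2 ^ (Nat.size z + w) :=
    (Nat.lt_size_self z).trans_le (Nat.pow_le_pow_right two_pos (Nat.le_add_right _ _))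
  rw [Nat.size_le, pow_succ, mul_two]
  exact add_lt_add (lt x _) (add_comm (Nat.size x) _ ▸ lt y _)

theorem size_sum_le (s : Finset ℕ) (f : ℕ → ℕ) :
    Nat.size (∑ i ∈ s, f i) ≤ ∑ i ∈ s, (Nat.size (f i) + 1) := by
  classical
  induction s using Finset.induction_on with
  | empty => simp
  | insert a s ha ih =>
    rw [sum_insert ha, sum_insert ha]
    have := size_add_le (f a) (∑ i ∈ s, f i)
    omega

theorem size_prod_le (s : Finset ℕ) (f : ℕ → ℕ) :
    Nat.size (∏ i ∈ s, f i) ≤ 1 + ∑ i ∈ s, Nat.size (f i) := by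
  classical
  induction s using Finset.induction_on with
  | empty => simp
  | insert a s ha ih =>
    rw [prod_insert ha, sum_insert ha]
    have := size_mul_le (f a) (∏ i ∈ s, f i)
    omega

theorem size_div_two {v : ℕ} (hv : v ≠ 0) : Nat.size (v / 2) + 1 = Nat.size v := by
  have h := Nat.size_bit (b := v.bodd) (n := v.div2) (by rwa [Nat.bit_bodd_div2])
  rw [Nat.bit_bodd_div2, Nat.div2_val] at h
  exact h.symm

theorem Expr.size_val_lt_cost (M : Mem) (e : Expr) : Nat.size (e.val M) < e.cost M := by
  cases e <;> simp only [Expr.cost, Expr.val] <;> omega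

/-! ### Functions that are computable in polynomial time -/

/-- The numerical data of an instance: accuracy `N`, cardinality bound `k`, number `n` of jobs, and
numerators and denominators of their sizes. -/
structure Input where
  N : ℕ
  k : ℕ
  n : ℕ
  num : ℕ → ℕ
  den : ℕ → ℕ

/-- A function of the input and of the current values of the loop variables, innermost first. -/
abbrev InputFun := Input → List ℕ → ℕ

/-- Whether the value of a function or only its bit length is polynomially bounded. -/
inductive Growth where
  | value
  | bits

def Growth.gauge : Growth → ℕ → ℕ
  | .value, x => x
  | .bits, x => Nat.size x

theorem Growth.size_le_gauge (γ : Growth) (x : ℕ) : Nat.size x ≤ γ.gauge x := by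
  cases γ with
  | value => exact size_le_self x
  | bits => exact le_rfl

theorem Growth.gauge_le_self (γ : Growth) (x : ℕ) : γ.gauge x ≤ x := by
  cases γ with
  | value => exact le_rfl
  | bits => exact size_le_self x

theorem Growth.gauge_mono (γ : Growth) : Monotone γ.gauge := by
  cases γ with
  | value => exact monotone_id
  | bits => exact fun _ _ => Nat.size_le_size

/-- Functions that are built from the operations of the machine and from loops of polynomially
bounded length, with polynomially bounded values or bit lengths throughout. -/
inductive PolyTime : Growth → InputFun → Prop
  | const {γ : Growth} (c : ℕ) : PolyTime γ fun _ _ => c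
  | N : PolyTime .value fun I _ => I.N
  | k : PolyTime .bits fun I _ => I.k
  | n : PolyTime .value fun I _ => I.n
  | head : PolyTime .value fun _ e => e.headI
  | tail {γ : Growth} {f : InputFun} : PolyTime γ f → PolyTime γ fun I e => f I e.tail
  | num {f : InputFun} : PolyTime .value f → PolyTime .bits fun I e => I.num (f I e)
  | den {f : InputFun} : PolyTime .value f → PolyTime .bits fun I e => I.den (f I e)
  | add {γ : Growth} {f g : InputFun} :
      PolyTime γ f → PolyTime γ g → PolyTime γ fun I e => f I e + g I e
  | mul {γ : Growth} {f g : InputFun} :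
      PolyTime γ f → PolyTime γ g → PolyTime γ fun I e => f I e * g I e
  | sub {γ : Growth} {f g : InputFun} :
      PolyTime γ f → PolyTime .bits g → PolyTime γ fun I e => f I e - g I e
  | div {γ : Growth} {f g : InputFun} :
      PolyTime γ f → PolyTime .bits g → PolyTime γ fun I e => f I e / g I e
  | size {f : InputFun} : PolyTime .bits f → PolyTime .value fun I e => Nat.size (f I e)
  | ofValue {f : InputFun} : PolyTime .value f → PolyTime .bits f
  | sum_cons {γ : Growth} {f g : InputFun} : PolyTime .value g → PolyTime γ f →
      PolyTime γ fun I e => ∑ i ∈ range (g I e), f I (i :: e)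
  | prod_cons {f g : InputFun} : PolyTime .value g → PolyTime .bits f →
      PolyTime .bits fun I e => ∏ i ∈ range (g I e), f I (i :: e)
  | sup_cons {f g : InputFun} : PolyTime .value g → PolyTime .bits f →
      PolyTime .bits fun I e => (range (g I e)).sup fun i => f I (i :: e)
  | iterSub {f g c : InputFun} : PolyTime .value g → PolyTime .value c → PolyTime .value f →
      PolyTime .value fun I e => Nat.rec (c I e) (fun i acc => acc - f I (i :: acc :: e)) (g I e)

/-- All parameters of the input and all loop variables are bounded by `ℓ`, the cardinality bound
and the sizes of the jobs in bit length. -/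
structure Input.Bounded (I : Input) (e : List ℕ) (ℓ : ℕ) : Prop where
  N_le : I.N ≤ ℓ
  n_le : I.n ≤ ℓ
  size_k_le : Nat.size I.k ≤ ℓ
  size_num_le : ∀ i, Nat.size (I.num i) ≤ ℓ
  size_den_le : ∀ i, Nat.size (I.den i) ≤ ℓ
  env_le : ∀ x ∈ e, x ≤ ℓ

namespace Input.Bounded

variable {I : Input} {e : List ℕ} {ℓ ℓ' x : ℕ}

theorem mono (h : I.Bounded e ℓ) (hℓ : ℓ ≤ ℓ') : I.Bounded e ℓ' :=
  ⟨h.N_le.trans hℓ, h.n_le.trans hℓ, h.size_k_le.trans hℓ, fun i => (h.size_num_le i).trans hℓ,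
    fun i => (h.size_den_le i).trans hℓ, fun y hy => (h.env_le y hy).trans hℓ⟩

theorem cons (h : I.Bounded e ℓ) (hx : x ≤ ℓ) : I.Bounded (x :: e) ℓ :=
  { h with env_le := List.forall_mem_cons.2 ⟨hx, h.env_le⟩ }

theorem tail (h : I.Bounded e ℓ) : I.Bounded e.tail ℓ :=
  { h with env_le := fun y hy => h.env_le y (List.mem_of_mem_tail hy) }

theorem headI_le (h : I.Bounded e ℓ) : e.headI ≤ ℓ := by
  cases e with
  | nil => exact Nat.zero_le ℓ
  | cons y e => exact h.env_le y List.mem_cons_self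

end Input.Bounded

/-- The values of `f`, or their bit lengths, are polynomially bounded. -/
def PolyBounded (γ : Growth) (f : InputFun) : Prop :=
  ∃ P : ℕ[X], ∀ I e ℓ, I.Bounded e ℓ → γ.gauge (f I e) ≤ P.eval ℓ

/-- The bit lengths of `F I e 0, …, F I e (g I e)` are polynomially bounded. -/
def BitsBoundedUpTo (g : InputFun) (F : Input → List ℕ → ℕ → ℕ) : Prop :=
  ∃ P : ℕ[X], ∀ I e ℓ, I.Bounded e ℓ → ∀ i ≤ g I e, Nat.size (F I e i) ≤ P.eval ℓ

theorem BitsBoundedUpTo.polyBounded {g : InputFun} {F : Input → List ℕ → ℕ → ℕ}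
    (h : BitsBoundedUpTo g F) : PolyBounded .bits fun I e => F I e (g I e) := by
  obtain ⟨P, hP⟩ := h
  exact ⟨P, fun I e ℓ hB => hP I e ℓ hB _ le_rfl⟩

namespace PolyBounded

variable {γ : Growth} {f g : InputFun}

theorem bits (h : PolyBounded γ f) : PolyBounded .bits f := by
  obtain ⟨P, hP⟩ := h
  exact ⟨P, fun I e ℓ hB => (γ.size_le_gauge _).trans (hP I e ℓ hB)⟩

theorem of_le (hg : PolyBounded γ g) (h : ∀ I e, f I e ≤ g I e) : PolyBounded γ f := by
  obtain ⟨P, hP⟩ := hg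
  exact ⟨P, fun I e ℓ hB => (γ.gauge_mono (h I e)).trans (hP I e ℓ hB)⟩

theorem add (hf : PolyBounded γ f) (hg : PolyBounded γ g) :
    PolyBounded γ fun I e => f I e + g I e := by
  obtain ⟨P, hP⟩ := hf
  obtain ⟨Q, hQ⟩ := hg
  refine ⟨P + Q + 1, fun I e ℓ hB => ?_⟩
  have hfP := hP I e ℓ hB
  have hgQ := hQ I e ℓ hB
  rw [eval_add, eval_add, eval_one]
  cases γ with
  | value => exact (add_le_add hfP hgQ).trans (Nat.le_succ _)
  | bits => exact (size_add_le _ _).trans (Nat.succ_le_succ (add_le_add hfP hgQ))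

theorem mul (hf : PolyBounded γ f) (hg : PolyBounded γ g) :
    PolyBounded γ fun I e => f I e * g I e := by
  obtain ⟨P, hP⟩ := hf
  obtain ⟨Q, hQ⟩ := hg
  refine ⟨P * Q + (P + Q), fun I e ℓ hB => ?_⟩
  have hfP := hP I e ℓ hB
  have hgQ := hQ I e ℓ hB
  rw [eval_add, eval_mul, eval_add]
  cases γ with
  | value => exact (Nat.mul_le_mul hfP hgQ).trans (Nat.le_add_right _ _)
  | bits => exact ((size_mul_le _ _).trans (add_le_add hfP hgQ)).trans (Nat.le_add_left _ _)

theorem under_loop (hg : PolyBounded .value g) (hf : PolyBounded γ f) :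
    ∃ P : ℕ[X], ∀ I e ℓ, I.Bounded e ℓ → ∀ i ≤ g I e, γ.gauge (f I (i :: e)) ≤ P.eval ℓ := by
  obtain ⟨P, hP⟩ := hf
  obtain ⟨G, hG⟩ := hg
  refine ⟨P.comp (X + G), fun I e ℓ hB i hi => ?_⟩
  rw [eval_comp, eval_add, eval_X]
  have hgG : g I e ≤ G.eval ℓ := hG I e ℓ hB
  exact hP I _ _ ((hB.mono (Nat.le_add_right _ _)).cons (by omega))

theorem bitsBoundedUpTo_cons (hg : PolyBounded .value g) (hf : PolyBounded .bits f) :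
    BitsBoundedUpTo g fun I e i => f I (i :: e) :=
  hg.under_loop hf

theorem bitsBoundedUpTo_sum (hg : PolyBounded .value g) (hf : PolyBounded .bits f) :
    BitsBoundedUpTo g fun I e m => ∑ i ∈ range m, f I (i :: e) := by
  obtain ⟨P, hP⟩ := hg.under_loop hf
  obtain ⟨G, hG⟩ := hg
  refine ⟨G * (P + 1), fun I e ℓ hB m hm => (size_sum_le _ _).trans ?_⟩
  rw [eval_mul, eval_add, eval_one]
  calc ∑ i ∈ range m, (Nat.size (f I (i :: e)) + 1) ≤ m * (P.eval ℓ + 1) :=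
        sum_range_le_mul fun i hi => Nat.succ_le_succ (hP I e ℓ hB i (hi.le.trans hm))
    _ ≤ G.eval ℓ * (P.eval ℓ + 1) := Nat.mul_le_mul_right _ (hm.trans (hG I e ℓ hB))

theorem bitsBoundedUpTo_prod (hg : PolyBounded .value g) (hf : PolyBounded .bits f) :
    BitsBoundedUpTo g fun I e m => ∏ i ∈ range m, f I (i :: e) := by
  obtain ⟨P, hP⟩ := hg.under_loop hf
  obtain ⟨G, hG⟩ := hg
  refine ⟨1 + G * P, fun I e ℓ hB m hm => (size_prod_le _ _).trans ?_⟩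
  rw [eval_add, eval_one, eval_mul]
  refine Nat.add_le_add_left ?_ 1
  calc ∑ i ∈ range m, Nat.size (f I (i :: e)) ≤ m * P.eval ℓ :=
        sum_range_le_mul fun i hi => hP I e ℓ hB i (hi.le.trans hm)
    _ ≤ G.eval ℓ * P.eval ℓ := Nat.mul_le_mul_right _ (hm.trans (hG I e ℓ hB))

theorem bitsBoundedUpTo_sup (hg : PolyBounded .value g) (hf : PolyBounded .bits f) :
    BitsBoundedUpTo g fun I e m => (range m).sup fun i => f I (i :: e) := by
  obtain ⟨P, hP⟩ := hg.under_loop hf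
  refine ⟨P, fun I e ℓ hB m hm =>
    Finset.sup_induction (p := fun x => Nat.size x ≤ P.eval ℓ) (by simp) ?_ fun i hi =>
      hP I e ℓ hB i ((mem_range.1 hi).le.trans hm)⟩
  intro x hx y hy
  rcases max_choice x y with h | h <;> rwa [h]

theorem sum (hg : PolyBounded .value g) (hf : PolyBounded γ f) :
    PolyBounded γ fun I e => ∑ i ∈ range (g I e), f I (i :: e) := by
  cases γ with
  | bits => exact (hg.bitsBoundedUpTo_sum hf).polyBounded
  | value =>
    obtain ⟨P, hP⟩ := hg.under_loop hf
    obtain ⟨G, hG⟩ := hg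
    refine ⟨G * P, fun I e ℓ hB => ?_⟩
    calc ∑ i ∈ range (g I e), f I (i :: e) ≤ g I e * P.eval ℓ :=
          sum_range_le_mul fun i hi => hP I e ℓ hB i hi.le
      _ ≤ (G * P).eval ℓ := eval_mul (p := G) ▸ Nat.mul_le_mul_right _ (hG I e ℓ hB)

end PolyBounded

theorem iterSub_le (c : ℕ) (f : ℕ → ℕ → ℕ) (m : ℕ) :
    (Nat.rec c (fun i acc => acc - f i acc) m : ℕ) ≤ c := by
  induction m with
  | zero => exact le_rfl
  | succ m ih => exact (Nat.sub_le _ _).trans ih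

theorem PolyTime.polyBounded {γ : Growth} {f : InputFun} (h : PolyTime γ f) :
    PolyBounded γ f := by
  induction h with
  | @const γ c => exact ⟨C c, fun I e ℓ _ => (γ.gauge_le_self c).trans (eval_C).ge⟩
  | N => exact ⟨X, fun I e ℓ hB => hB.N_le.trans eval_X.ge⟩
  | k => exact ⟨X, fun I e ℓ hB => hB.size_k_le.trans eval_X.ge⟩
  | n => exact ⟨X, fun I e ℓ hB => hB.n_le.trans eval_X.ge⟩
  | head => exact ⟨X, fun I e ℓ hB => hB.headI_le.trans eval_X.ge⟩
  | tail _ ih => exact ih.imp fun P hP I e ℓ hB => hP I _ ℓ hB.tail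
  | num => exact ⟨X, fun I e ℓ hB => (hB.size_num_le _).trans eval_X.ge⟩
  | den => exact ⟨X, fun I e ℓ hB => (hB.size_den_le _).trans eval_X.ge⟩
  | add _ _ ihf ihg => exact ihf.add ihg
  | mul _ _ ihf ihg => exact ihf.mul ihg
  | sub _ _ ihf _ => exact ihf.of_le fun I e => Nat.sub_le _ _
  | div _ _ ihf _ => exact ihf.of_le fun I e => Nat.div_le_self _ _
  | size _ ih => exact ih
  | ofValue _ ih => exact ih.bits
  | sum_cons _ _ ihg ihf => exact ihg.sum ihf
  | prod_cons _ _ ihg ihf => exact (ihg.bitsBoundedUpTo_prod ihf).polyBounded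
  | sup_cons _ _ ihg ihf => exact (ihg.bitsBoundedUpTo_sup ihf).polyBounded
  | iterSub _ _ _ _ ihc _ => exact ihc.of_le fun I e => iterSub_le _ _ _

/-- The memory holds the input in registers `0, 1, 2` and arrays `0, 1`, see `inputMem`. -/
structure Input.StoredIn (I : Input) (M : Mem) : Prop where
  N : M.reg 0 = I.N
  k : M.reg 1 = I.k
  n : M.reg 2 = I.n
  num : ∀ i, M.arr 0 i = I.num i
  den : ∀ i, M.arr 1 i = I.den i

/-- All arrays and the registers below `b` agree. -/
structure AgreeBelow (b : ℕ) (M M' : Mem) : Prop where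
  arr : M'.arr = M.arr
  reg : ∀ x < b, M'.reg x = M.reg x

namespace AgreeBelow

variable {b c : ℕ} {M M' M'' : Mem}

theorem refl (b : ℕ) (M : Mem) : AgreeBelow b M M :=
  ⟨rfl, fun _ _ => rfl⟩

theorem trans (h : AgreeBelow b M M') (h' : AgreeBelow b M' M'') : AgreeBelow b M M'' :=
  ⟨h'.arr.trans h.arr, fun x hx => (h'.reg x hx).trans (h.reg x hx)⟩

theorem mono (h : AgreeBelow c M M') (hbc : b ≤ c) : AgreeBelow b M M' :=
  ⟨h.arr, fun x hx => h.reg x (hx.trans_le hbc)⟩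

theorem setReg (h : AgreeBelow b M M') {x : ℕ} (v : ℕ) (hx : b ≤ x) :
    AgreeBelow b M (M'.setReg x v) :=
  h.trans ⟨rfl, fun _ hy => Mem.setReg_reg_of_ne _ _ (hy.trans_le hx).ne⟩

theorem map_reg (h : AgreeBelow b M M') {rs : List ℕ} (hrs : ∀ r ∈ rs, r < b) :
    rs.map M'.reg = rs.map M.reg :=
  List.map_congr_left fun r hr => h.reg r (hrs r hr)

theorem storedIn (h : AgreeBelow b M M') (hb : 3 ≤ b) {I : Input} (hI : I.StoredIn M) :
    I.StoredIn M' :=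
  ⟨(h.reg 0 (by omega)).trans hI.N, (h.reg 1 (by omega)).trans hI.k,
    (h.reg 2 (by omega)).trans hI.n, fun i => h.arr ▸ hI.num i, fun i => h.arr ▸ hI.den i⟩

end AgreeBelow

/-- Under the precondition `pre`, some program writes the value of `f` to register `b`, in
polynomial time and without changing registers below `b`. -/
def ComputesAt (b : ℕ) (pre : Input → Mem → ℕ → Prop) (f : Input → Mem → ℕ) : Prop :=
  ∃ (prog : Prog) (T : ℕ[X]), ∀ (I : Input) (M : Mem) (ℓ : ℕ), I.StoredIn M → pre I M ℓ →
    HaltsWithin prog M (T.eval ℓ) fun M' => AgreeBelow b M M' ∧ M'.reg b = f I M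

/-- `f` can be computed in polynomial time to any register `b`, where the loop variables are read
from any registers `rs` below `b`. -/
def Computes (f : InputFun) : Prop :=
  ∀ (rs : List ℕ) (b : ℕ), 3 ≤ b → (∀ r ∈ rs, r < b) →
    ComputesAt b (fun I M ℓ => I.Bounded (rs.map M.reg) ℓ) fun I M => f I (rs.map M.reg)

/-- The expression scheme `E` evaluates the binary operation `op` at linear overhead. -/
def Implements (E : Expr → Expr → Expr) (op : ℕ → ℕ → ℕ) : Prop :=
  ∀ M x y, (E x y).val M = op (x.val M) (y.val M) ∧
    (E x y).cost M ≤ 2 * (x.cost M + y.cost M) + Nat.size (op (x.val M) (y.val M)) + 2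

namespace Implements

theorem add : Implements .add (· + ·) :=
  fun M x y => ⟨rfl, by simp only [Expr.cost]; omega⟩

theorem mul : Implements .mul (· * ·) :=
  fun M x y => ⟨rfl, by simp only [Expr.cost]; omega⟩

theorem sub : Implements .sub (· - ·) :=
  fun M x y => ⟨rfl, by simp only [Expr.cost]; omega⟩

theorem div : Implements .div (· / ·) :=
  fun M x y => ⟨rfl, by simp only [Expr.cost]; omega⟩

theorem max : Implements (fun x y => .add x (.sub y x)) Max.max := by
  intro M x y
  have val : x.val M + (y.val M - x.val M) = Max.max (x.val M) (y.val M) := by omega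
  refine ⟨val, ?_⟩
  have size_sub := Nat.size_le_size (Nat.sub_le (y.val M) (x.val M))
  have size_y := y.size_val_lt_cost M
  simp only [Expr.cost, val, Expr.val]
  omega

end Implements

theorem HaltsWithin.size_loop {b v B : ℕ} {M₀ M : Mem} (agree : AgreeBelow b M₀ M)
    (val : M.reg b = v) (idx : M.reg (b + 1) = 0) (hB : Nat.size v ≤ B) :
    HaltsWithin (.loop (.reg b) (.seq (.set b (.div (.reg b) (.const 2)))
      (.set (b + 1) (.add (.reg (b + 1)) (.const 1))))) M ((B + 1) * (5 * B + 14))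
      fun M' => AgreeBelow b M₀ M' ∧ M'.reg (b + 1) = Nat.size v := by
  let inv (i : ℕ) (M' : Mem) : Prop :=
    AgreeBelow b M₀ M' ∧ Nat.size (M'.reg b) + i = Nat.size v ∧ M'.reg (b + 1) = i
  have size_one : Nat.size 1 = 1 := Nat.size_one
  have size_two : Nat.size 2 = 2 := rfl
  have h0 : inv 0 M := ⟨agree, by rw [val, add_zero], idx⟩
  refine (HaltsWithin.loop (m := Nat.size v) (c := B + 1) (τ := 2 * B + 6 + (2 * B + 6))
    ?_ ?_ h0).mono ?_ fun M' h => ⟨h.1, h.2.2⟩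
  · rintro i hi M' ⟨-, size_eq, -⟩
    refine ⟨?_, by simp only [Expr.cost]; omega⟩
    rw [Expr.val, ← Nat.pos_iff_ne_zero, ← Nat.size_pos]
    omega
  · rintro i hi M' ⟨agree, size_eq, idx⟩
    have hv : M'.reg b ≠ 0 := fun h => by simp only [h, Nat.size_zero] at size_eq; omega
    refine .seq (φ := fun M'' => AgreeBelow b M₀ M'' ∧
        Nat.size (M''.reg b) + (i + 1) = Nat.size v ∧ M''.reg (b + 1) = i)
      (.set ?_ ⟨agree.setReg _ le_rfl, ?_, ?_⟩) fun M'' ⟨agree', size_eq', idx'⟩ =>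
        .set ?_ ⟨agree'.setReg _ (Nat.le_succ b), ?_, ?_⟩
    · have := Nat.size_le_size (Nat.div_le_self (M'.reg b) 2)
      simp only [Expr.cost, Expr.val, size_two]
      omega
    · have := size_div_two hv
      simp only [Mem.setReg_reg_self, Expr.val]
      omega
    · rw [Mem.setReg_reg_of_ne _ _ (Nat.succ_ne_self b), idx]
    · have := size_le_self i
      have := size_le_self (i + 1)
      simp only [Expr.cost, Expr.val, idx', size_one]
      omega
    · rwa [Mem.setReg_reg_of_ne _ _ (Nat.lt_succ_self b).ne]
    · simp only [Mem.setReg_reg_self, Expr.val, idx']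
  · exact Nat.mul_le_mul (by omega) (by omega)

namespace Computes

variable {f g : InputFun}

theorem computesAt (hf : Computes f) {rs : List ℕ} {b : ℕ} (hb : 3 ≤ b) (hrs : ∀ r ∈ rs, r < b)
    {pre : Input → Mem → ℕ → Prop} {L : ℕ[X]}
    (hpre : ∀ I M ℓ, pre I M ℓ → I.Bounded (rs.map M.reg) (L.eval ℓ)) :
    ComputesAt b pre fun I M => f I (rs.map M.reg) := by
  obtain ⟨prog, T, hprog⟩ := hf rs b hb hrs
  exact ⟨prog, T.comp L, fun I M ℓ hI hM => eval_comp (p := T) ▸ hprog I M _ hI (hpre I M ℓ hM)⟩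

theorem of_expr (bits : PolyBounded .bits f)
    (h : ∀ rs : List ℕ, ∃ x : Expr, ∀ (I : Input) (M : Mem), I.StoredIn M →
      x.val M = f I (rs.map M.reg) ∧ x.cost M = Nat.size (x.val M) + 1) : Computes f := by
  intro rs b _ _
  obtain ⟨x, hx⟩ := h rs
  obtain ⟨P, hP⟩ := bits
  refine ⟨.set b x, P + 2, fun I M ℓ hI hB => .set ?_ ?_⟩
  · have hfP : Nat.size (f I (rs.map M.reg)) ≤ P.eval ℓ := hP I _ ℓ hB
    rw [(hx I M hI).2, (hx I M hI).1, eval_add, eval_ofNat]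
    omega
  · exact ⟨(AgreeBelow.refl b M).setReg _ le_rfl, by rw [Mem.setReg_reg_self, (hx I M hI).1]⟩

theorem const (c : ℕ) : Computes fun _ _ => c :=
  of_expr (PolyTime.const c).polyBounded fun _ => ⟨.const c, fun _ _ _ => ⟨rfl, rfl⟩⟩

theorem tail (hf : Computes f) : Computes fun I e => f I e.tail := by
  intro rs b hb hrs
  simpa only [List.map_tail] using
    hf.computesAt (rs := rs.tail) hb (fun r hr => hrs r (List.mem_of_mem_tail hr)) (L := X)
      fun I M ℓ hB => by simpa only [List.map_tail, eval_X] using hB.tail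

theorem bin {op : ℕ → ℕ → ℕ} {E : Expr → Expr → Expr} (hE : Implements E op) (hf : Computes f)
    (hg : Computes g) (fbits : PolyBounded .bits f) (gbits : PolyBounded .bits g)
    (bits : PolyBounded .bits fun I e => op (f I e) (g I e)) :
    Computes fun I e => op (f I e) (g I e) := by
  intro rs b hb hrs
  obtain ⟨p, T, hp⟩ := hf rs b hb hrs
  obtain ⟨q, U, hq⟩ := hg rs (b + 1) (by omega) fun r hr => (hrs r hr).trans (Nat.lt_succ_self b)
  obtain ⟨P, hP⟩ := fbits
  obtain ⟨Q, hQ⟩ := gbits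
  obtain ⟨S, hS⟩ := bits
  refine ⟨.seq p (.seq q (.set b (E (.reg b) (.reg (b + 1))))),
    T + (U + (2 * (P + Q) + S + 7)), fun I M ℓ hI hB => ?_⟩
  simp only [eval_add, eval_mul, eval_ofNat]
  refine (hp I M ℓ hI hB).seq fun M₁ ⟨agree₁, val₁⟩ => ?_
  have env := agree₁.map_reg hrs
  refine (hq I M₁ ℓ (agree₁.storedIn hb hI) (by simpa only [env] using hB)).seq
    fun M₂ ⟨agree₂, val₂⟩ => ?_
  simp only [env] at val₂
  have val₁' : M₂.reg b = f I (rs.map M.reg) := (agree₂.reg b (Nat.lt_succ_self b)).trans val₁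
  obtain ⟨val, cost⟩ := hE M₂ (.reg b) (.reg (b + 1))
  simp only [Expr.cost, Expr.val, val₁', val₂] at val cost
  refine .set ?_ ⟨(agree₁.trans (agree₂.mono (Nat.le_succ b))).setReg _ le_rfl, ?_⟩
  · have hfP : Nat.size (f I (rs.map M.reg)) ≤ P.eval ℓ := hP I _ ℓ hB
    have hgQ : Nat.size (g I (rs.map M.reg)) ≤ Q.eval ℓ := hQ I _ ℓ hB
    have hS : Nat.size (op (f I (rs.map M.reg)) (g I (rs.map M.reg))) ≤ S.eval ℓ := hS I _ ℓ hB
    omega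
  · rw [Mem.setReg_reg_self, val]

theorem arr {a : ℕ} (hf : Computes f) (fbits : PolyBounded .bits f) (bits : PolyBounded .bits g)
    (h : ∀ (I : Input) (M : Mem) (e : List ℕ), I.StoredIn M → M.arr a (f I e) = g I e) :
    Computes g := by
  intro rs b hb hrs
  obtain ⟨p, T, hp⟩ := hf rs b hb hrs
  obtain ⟨P, hP⟩ := fbits
  obtain ⟨Q, hQ⟩ := bits
  refine ⟨.seq p (.set b (.get a (.reg b))), T + (P + Q + 3), fun I M ℓ hI hB => ?_⟩
  simp only [eval_add, eval_ofNat]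
  refine (hp I M ℓ hI hB).seq fun M₁ ⟨agree₁, val₁⟩ => ?_
  have cell := h I M₁ (rs.map M.reg) (agree₁.storedIn hb hI)
  refine .set ?_ ⟨agree₁.setReg _ le_rfl, ?_⟩
  · have hfP : Nat.size (f I (rs.map M.reg)) ≤ P.eval ℓ := hP I _ ℓ hB
    have hgQ : Nat.size (g I (rs.map M.reg)) ≤ Q.eval ℓ := hQ I _ ℓ hB
    simp only [Expr.cost, Expr.val, val₁, cell]
    omega
  · rw [Mem.setReg_reg_self]
    simp only [Expr.val, val₁, cell]

theorem size (hf : Computes f) (bits : PolyBounded .bits f) :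
    Computes fun I e => Nat.size (f I e) := by
  intro rs b hb hrs
  obtain ⟨p, T, hp⟩ := hf rs b hb hrs
  obtain ⟨P, hP⟩ := bits
  refine ⟨.seq p (.seq (.set (b + 1) (.const 0)) (.seq (.loop (.reg b)
    (.seq (.set b (.div (.reg b) (.const 2)))
      (.set (b + 1) (.add (.reg (b + 1)) (.const 1))))) (.set b (.reg (b + 1))))),
    T + (2 + ((P + 1) * (5 * P + 14) + (P + 2))), fun I M ℓ hI hB => ?_⟩
  simp only [eval_add, eval_mul, eval_one, eval_ofNat]
  have hfP : Nat.size (f I (rs.map M.reg)) ≤ P.eval ℓ := hP I _ ℓ hB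
  refine (hp I M ℓ hI hB).seq fun M₁ ⟨agree₁, val₁⟩ => ?_
  refine .seq (φ := fun M₂ => AgreeBelow b M M₂ ∧ M₂.reg b = f I (rs.map M.reg) ∧
      M₂.reg (b + 1) = 0)
    (.set (by simp [Expr.cost]) ⟨agree₁.setReg _ (Nat.le_succ b), ?_, Mem.setReg_reg_self _ _ _⟩)
    fun M₂ ⟨agree₂, val₂, idx₂⟩ => (HaltsWithin.size_loop agree₂ val₂ idx₂ hfP).seq
      fun M₃ ⟨agree₃, val₃⟩ => .set ?_ ⟨agree₃.setReg _ le_rfl, ?_⟩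
  · rw [Mem.setReg_reg_of_ne _ _ (Nat.lt_succ_self b).ne, val₁]
  · have := size_le_self (Nat.size (f I (rs.map M.reg)))
    simp only [Expr.cost, val₃]
    omega
  · rw [Mem.setReg_reg_self, Expr.val, val₃]

end Computes

/-- State of a counting loop after `i` of `m` rounds, with the accumulator in register `b + 1`. -/
structure LoopState (b m : ℕ) (acc : ℕ → ℕ) (M₀ : Mem) (i : ℕ) (M : Mem) : Prop where
  agree : AgreeBelow b M₀ M
  bound : M.reg b = m
  acc : M.reg (b + 1) = acc i
  idx : M.reg (b + 2) = i

/-- One round of a counting loop: `arg` writes the next operand to register `b + 3`. -/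
def loopBody (b : ℕ) (E : Expr → Expr → Expr) (arg : Prog) : Prog :=
  .seq arg (.seq (.set (b + 1) (E (.reg (b + 1)) (.reg (b + 3))))
    (.set (b + 2) (.add (.reg (b + 2)) (.const 1))))

/-- The loop that runs `loopBody` for the number of rounds given in register `b`. -/
def countingLoop (b : ℕ) (E : Expr → Expr → Expr) (arg : Prog) : Prog :=
  .loop (.sub (.reg b) (.reg (b + 2))) (loopBody b E arg)

theorem halts_loopBody {b m i S A T G : ℕ} {acc arg : ℕ → ℕ} {M₀ M : Mem} {p : Prog}
    {op : ℕ → ℕ → ℕ} {E : Expr → Expr → Expr} (hE : Implements E op)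
    (hacc : acc (i + 1) = op (acc i) (arg i)) (hM : LoopState b m acc M₀ i M) (hi : i < G)
    (hp : HaltsWithin p M T fun M' => AgreeBelow (b + 3) M M' ∧ M'.reg (b + 3) = arg i)
    (bits : ∀ j ≤ i + 1, Nat.size (acc j) ≤ S) (argBits : Nat.size (arg i) ≤ A) :
    HaltsWithin (loopBody b E p) M (T + ((3 * S + 2 * A + 7) + (2 * G + 5)))
      (LoopState b m acc M₀ (i + 1)) := by
  refine hp.seq fun M₁ ⟨agree₁, val₁⟩ => ?_
  have bound₁ : M₁.reg b = m := (agree₁.reg b (by omega)).trans hM.bound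
  have acc₁ : M₁.reg (b + 1) = acc i := (agree₁.reg _ (by omega)).trans hM.acc
  have idx₁ : M₁.reg (b + 2) = i := (agree₁.reg _ (by omega)).trans hM.idx
  obtain ⟨val, cost⟩ := hE M₁ (.reg (b + 1)) (.reg (b + 3))
  simp only [Expr.cost, Expr.val, acc₁, val₁, ← hacc] at val cost
  have agree : AgreeBelow b M₀ M₁ := hM.agree.trans (agree₁.mono (by omega))
  refine .seq (φ := fun M₂ => AgreeBelow b M₀ M₂ ∧ M₂.reg b = m ∧ M₂.reg (b + 1) = acc (i + 1) ∧
      M₂.reg (b + 2) = i) (.set ?_ ⟨agree.setReg _ (by omega), ?_, ?_, ?_⟩)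
    fun M₂ ⟨agree₂, bound₂, acc₂, idx₂⟩ => .set ?_ ⟨agree₂.setReg _ (by omega), ?_, ?_, ?_⟩
  · have := bits i (Nat.le_succ i)
    have := bits (i + 1) le_rfl
    omega
  · rw [Mem.setReg_reg_of_ne _ _ (by omega), bound₁]
  · rw [Mem.setReg_reg_self, val]
  · rw [Mem.setReg_reg_of_ne _ _ (by omega), idx₁]
  · have size_one : Nat.size 1 = 1 := Nat.size_one
    have := size_le_self i
    have := size_le_self (i + 1)
    simp only [Expr.cost, Expr.val, idx₂, size_one]
    omega
  · rw [Mem.setReg_reg_of_ne _ _ (by omega), bound₂]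
  · rw [Mem.setReg_reg_of_ne _ _ (by omega), acc₂]
  · simp only [Mem.setReg_reg_self, Expr.val, idx₂]

theorem halts_countingLoop {b m S A T G : ℕ} {acc arg : ℕ → ℕ} {M₀ M : Mem} {p : Prog}
    {op : ℕ → ℕ → ℕ} {E : Expr → Expr → Expr} (hE : Implements E op)
    (hacc : ∀ i < m, acc (i + 1) = op (acc i) (arg i)) (hM : LoopState b m acc M₀ 0 M)
    (hm : m ≤ G)
    (hp : ∀ i < m, ∀ M, LoopState b m acc M₀ i M →
      HaltsWithin p M T fun M' => AgreeBelow (b + 3) M M' ∧ M'.reg (b + 3) = arg i)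
    (bits : ∀ i ≤ m, Nat.size (acc i) ≤ S) (argBits : ∀ i < m, Nat.size (arg i) ≤ A) :
    HaltsWithin (countingLoop b E p) M
      ((G + 1) * (3 * G + 4 + (T + ((3 * S + 2 * A + 7) + (2 * G + 5)))))
      (LoopState b m acc M₀ m) := by
  refine (HaltsWithin.loop (c := 3 * G + 3) (fun i hi M hM => ?_)
    (fun i hi M hM => halts_loopBody hE (hacc i hi) hM (hi.trans_le hm) (hp i hi M hM)
      (fun j hj => bits j (hj.trans hi)) (argBits i hi)) hM).le
    (Nat.mul_le_mul_right _ (Nat.succ_le_succ hm))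
  have := size_le_self m
  have := size_le_self i
  have := size_le_self (m - i)
  simp only [Expr.cost, Expr.val, hM.bound, hM.idx]
  omega

namespace Computes

variable {f g : InputFun}

theorem iterate {op : ℕ → ℕ → ℕ} {E : Expr → Expr → Expr} (hE : Implements E op)
    {acc arg : Input → List ℕ → ℕ → ℕ}
    (hacc : ∀ I e, ∀ i < g I e, acc I e (i + 1) = op (acc I e i) (arg I e i))
    (hg : Computes g) (hstart : Computes fun I e => acc I e 0) (gbound : PolyBounded .value g)
    (bits : BitsBoundedUpTo g acc) (argBits : BitsBoundedUpTo g arg)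
    (harg : ∀ (rs : List ℕ) (b : ℕ), 3 ≤ b → (∀ r ∈ rs, r < b) →
      ComputesAt (b + 3) (fun I M ℓ => I.Bounded (rs.map M.reg) ℓ ∧
          M.reg (b + 2) < g I (rs.map M.reg) ∧
          M.reg (b + 1) = acc I (rs.map M.reg) (M.reg (b + 2)))
        fun I M => arg I (rs.map M.reg) (M.reg (b + 2))) :
    Computes fun I e => acc I e (g I e) := by
  intro rs b hb hrs
  have hrs' : ∀ r ∈ rs, r < b + 1 := fun r hr => (hrs r hr).trans (Nat.lt_succ_self b)
  obtain ⟨p, P, hp⟩ := hg rs b hb hrs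
  obtain ⟨q, Q, hq⟩ := hstart rs (b + 1) (by omega) hrs'
  obtain ⟨w, W, hw⟩ := harg rs b hb hrs
  obtain ⟨G, hG⟩ := gbound
  obtain ⟨S, hS⟩ := bits
  obtain ⟨A, hA⟩ := argBits
  refine ⟨.seq p (.seq q (.seq (.set (b + 2) (.const 0)) (.seq (countingLoop b E w)
      (.set b (.reg (b + 1)))))),
    P + (Q + (2 + ((G + 1) * (3 * G + 4 + (W + ((3 * S + 2 * A + 7) + (2 * G + 5)))) + (S + 2)))),
    fun I M ℓ hI hB => ?_⟩
  simp only [eval_add, eval_mul, eval_one, eval_ofNat]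
  set e := rs.map M.reg
  refine (hp I M ℓ hI hB).seq fun M₁ ⟨agree₁, val₁⟩ => ?_
  have env := agree₁.map_reg hrs
  refine (hq I M₁ ℓ (agree₁.storedIn hb hI) (by simpa only [env] using hB)).seq
    fun M₂ ⟨agree₂, val₂⟩ => ?_
  simp only [env] at val₂
  refine .seq (φ := LoopState b (g I e) (acc I e) M 0) (.set (by simp [Expr.cost])
    ⟨(agree₁.trans (agree₂.mono (Nat.le_succ b))).setReg _ (by omega), ?_, ?_,
      Mem.setReg_reg_self _ _ _⟩)
    fun M₃ hM₃ => (halts_countingLoop hE (hacc I e) hM₃ (hG I e ℓ hB) ?_ (hS I e ℓ hB)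
      fun i hi => hA I e ℓ hB i hi.le).seq
      fun M₄ hM₄ => .set ?_ ⟨hM₄.agree.setReg _ le_rfl, ?_⟩
  · rw [Mem.setReg_reg_of_ne _ _ (by omega), agree₂.reg b (Nat.lt_succ_self b), val₁]
  · rw [Mem.setReg_reg_of_ne _ _ (by omega), val₂]
  · intro i hi M' hM'
    have env' := hM'.agree.map_reg hrs
    simpa only [env', hM'.idx] using hw I M' ℓ (hM'.agree.storedIn hb hI)
      ⟨by simpa only [env'] using hB, by rwa [env', hM'.idx], by rw [env', hM'.idx, hM'.acc]⟩
  · have := hS I e ℓ hB _ le_rfl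
    simp only [Expr.cost, hM₄.acc]
    omega
  · rw [Mem.setReg_reg_self, Expr.val, hM₄.acc]

theorem fold {op : ℕ → ℕ → ℕ} {E : Expr → Expr → Expr} (hE : Implements E op)
    {acc : Input → List ℕ → ℕ → ℕ} (c : ℕ) (hstart : ∀ I e, acc I e 0 = c)
    (hacc : ∀ I e i, acc I e (i + 1) = op (acc I e i) (f I (i :: e)))
    (hg : Computes g) (hf : Computes f) (gbound : PolyBounded .value g)
    (fbits : PolyBounded .bits f) (bits : BitsBoundedUpTo g acc) :
    Computes fun I e => acc I e (g I e) := by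
  refine .iterate hE (fun I e i _ => hacc I e i) hg (by simpa only [hstart] using const c) gbound
    bits (gbound.bitsBoundedUpTo_cons fbits) fun rs b hb hrs => ?_
  obtain ⟨G, hG⟩ := gbound
  refine hf.computesAt (rs := (b + 2) :: rs) (L := X + G) (by omega)
    (List.forall_mem_cons.2 ⟨by omega, fun r hr => (hrs r hr).trans (by omega)⟩)
    fun I M ℓ ⟨hB, _, _⟩ => ?_
  have hgG : g I (rs.map M.reg) ≤ G.eval ℓ := hG I _ ℓ hB
  rw [eval_add, eval_X]
  exact (hB.mono (Nat.le_add_right _ _)).cons (by omega)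

theorem iterSub {c : InputFun} (hg : Computes g) (hc : Computes c) (hf : Computes f)
    (gbound : PolyBounded .value g) (cbound : PolyBounded .value c)
    (fbound : PolyBounded .bits f) :
    Computes fun I e => Nat.rec (c I e) (fun i acc => acc - f I (i :: acc :: e)) (g I e) := by
  let acc (I : Input) (e : List ℕ) (m : ℕ) : ℕ :=
    Nat.rec (c I e) (fun i acc => acc - f I (i :: acc :: e)) m
  have acc_le (I e m) : acc I e m ≤ c I e := iterSub_le (c I e) (fun i x => f I (i :: x :: e)) m
  obtain ⟨G, hG⟩ := gbound
  obtain ⟨A, hA⟩ := cbound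
  obtain ⟨F, hF⟩ := fbound
  have bounded {I : Input} {e : List ℕ} {ℓ : ℕ} (hB : I.Bounded e ℓ) {i x : ℕ} (hi : i ≤ g I e)
      (hx : x ≤ c I e) : I.Bounded (i :: x :: e) ((X + G + A).eval ℓ) := by
    have hgG : g I e ≤ G.eval ℓ := hG I e ℓ hB
    have hcA : c I e ≤ A.eval ℓ := hA I e ℓ hB
    rw [eval_add, eval_add, eval_X]
    exact ((hB.mono (by omega)).cons (by omega)).cons (by omega)
  refine .iterate (g := g) (acc := acc) (arg := fun I e i => f I (i :: acc I e i :: e))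
    .sub (fun _ _ _ _ => rfl) hg hc ⟨G, hG⟩ ?_ ?_ fun rs b hb hrs => ?_
  · exact ⟨A, fun I e ℓ hB m _ => (size_le_self _).trans ((acc_le I e m).trans (hA I e ℓ hB))⟩
  · exact ⟨F.comp (X + G + A), fun I e ℓ hB i hi =>
      eval_comp (p := F) ▸ hF I _ _ (bounded hB hi (acc_le I e i))⟩
  · obtain ⟨p, T, hp⟩ := hf.computesAt (rs := (b + 2) :: (b + 1) :: rs) (b := b + 3)
      (pre := fun I M ℓ => I.Bounded (rs.map M.reg) ℓ ∧ M.reg (b + 2) < g I (rs.map M.reg) ∧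
        M.reg (b + 1) = acc I (rs.map M.reg) (M.reg (b + 2)))
      (by omega) (List.forall_mem_cons.2 ⟨by omega, List.forall_mem_cons.2
        ⟨by omega, fun r hr => (hrs r hr).trans (by omega)⟩⟩)
      fun I M ℓ ⟨hB, lt, eq⟩ => bounded hB lt.le (eq ▸ acc_le I _ _)
    exact ⟨p, T, fun I M ℓ hI hM => by simpa only [List.map_cons, hM.2.2] using hp I M ℓ hI hM⟩

end Computes

theorem PolyTime.computes {γ : Growth} {f : InputFun} (h : PolyTime γ f) : Computes f := by
  induction h with
  | const c => exact .const c
  | N => exact .of_expr PolyTime.N.polyBounded.bits fun _ => ⟨.reg 0, fun _ _ hI => ⟨hI.N, rfl⟩⟩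
  | k => exact .of_expr PolyTime.k.polyBounded.bits fun _ => ⟨.reg 1, fun _ _ hI => ⟨hI.k, rfl⟩⟩
  | n => exact .of_expr PolyTime.n.polyBounded.bits fun _ => ⟨.reg 2, fun _ _ hI => ⟨hI.n, rfl⟩⟩
  | head =>
    refine .of_expr PolyTime.head.polyBounded.bits fun rs => ?_
    cases rs with
    | nil => exact ⟨.const 0, fun _ _ _ => ⟨rfl, rfl⟩⟩
    | cons r rs => exact ⟨.reg r, fun _ _ _ => ⟨rfl, rfl⟩⟩
  | tail _ ih => exact ih.tail
  | num hf ih => exact ih.arr hf.polyBounded.bits (num hf).polyBounded fun _ _ _ hI => hI.num _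
  | den hf ih => exact ih.arr hf.polyBounded.bits (den hf).polyBounded fun _ _ _ hI => hI.den _
  | add hf hg ihf ihg =>
    exact .bin .add ihf ihg hf.polyBounded.bits hg.polyBounded.bits (add hf hg).polyBounded.bits
  | mul hf hg ihf ihg =>
    exact .bin .mul ihf ihg hf.polyBounded.bits hg.polyBounded.bits (mul hf hg).polyBounded.bits
  | sub hf hg ihf ihg =>
    exact .bin .sub ihf ihg hf.polyBounded.bits hg.polyBounded.bits (sub hf hg).polyBounded.bits
  | div hf hg ihf ihg =>
    exact .bin .div ihf ihg hf.polyBounded.bits hg.polyBounded.bits (div hf hg).polyBounded.bits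
  | size hf ih => exact ih.size hf.polyBounded
  | ofValue _ ih => exact ih
  | sum_cons hg hf ihg ihf =>
    exact .fold .add 0 (fun _ _ => sum_range_zero _) (fun _ _ _ => sum_range_succ _ _) ihg ihf
      hg.polyBounded hf.polyBounded.bits (hg.polyBounded.bitsBoundedUpTo_sum hf.polyBounded.bits)
  | prod_cons hg hf ihg ihf =>
    exact .fold .mul 1 (fun _ _ => prod_range_zero _) (fun _ _ _ => prod_range_succ _ _) ihg ihf
      hg.polyBounded hf.polyBounded (hg.polyBounded.bitsBoundedUpTo_prod hf.polyBounded)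
  | sup_cons hg hf ihg ihf =>
    exact .fold .max 0 (fun _ _ => sup_empty) (fun _ _ _ => by
        rw [range_add_one, sup_insert, sup_comm]) ihg ihf
      hg.polyBounded hf.polyBounded (hg.polyBounded.bitsBoundedUpTo_sup hf.polyBounded)
  | iterSub hg hc hf ihg ihc ihf =>
    exact ihg.iterSub ihc ihf hg.polyBounded hc.polyBounded hf.polyBounded.bits

namespace PolyTime

variable {γ : Growth} {f g : InputFun}

theorem bits (h : PolyTime γ f) : PolyTime .bits f := by
  cases γ with
  | value => exact h.ofValue
  | bits => exact h

theorem of_value (h : PolyTime .value f) : PolyTime γ f := by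
  cases γ with
  | value => exact h
  | bits => exact h.ofValue

theorem sum {F : Input → ℕ → List ℕ → ℕ} (hg : PolyTime .value g)
    (hF : PolyTime γ fun I e => F I e.headI e.tail) :
    PolyTime γ fun I e => ∑ i ∈ range (g I e), F I i e :=
  .sum_cons hg hF

theorem prod {F : Input → ℕ → List ℕ → ℕ} (hg : PolyTime .value g)
    (hF : PolyTime .bits fun I e => F I e.headI e.tail) :
    PolyTime .bits fun I e => ∏ i ∈ range (g I e), F I i e :=
  .prod_cons hg hF

theorem sup {F : Input → ℕ → List ℕ → ℕ} (hg : PolyTime .value g)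
    (hF : PolyTime .bits fun I e => F I e.headI e.tail) :
    PolyTime .bits fun I e => (range (g I e)).sup fun i => F I i e :=
  .sup_cons hg hF

theorem pow (hf : PolyTime .bits f) (hg : PolyTime .value g) :
    PolyTime .bits fun I e => f I e ^ g I e := by
  simpa using prod hg (F := fun I _ e => f I e) hf.tail

theorem min (hf : PolyTime γ f) (hg : PolyTime .bits g) :
    PolyTime γ fun I e => Min.min (f I e) (g I e) := by
  simpa only [Nat.sub_sub_eq_min] using sub hf (sub hf.bits hg)

theorem max (hf : PolyTime γ f) (hg : PolyTime γ g) :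
    PolyTime γ fun I e => Max.max (f I e) (g I e) := by
  simpa only [add_tsub_eq_max] using add hf (sub hg hf.bits)

theorem mod (hf : PolyTime γ f) (hg : PolyTime .bits g) :
    PolyTime γ fun I e => f I e % g I e := by
  simpa only [Nat.mod_eq_sub_div_mul] using sub hf (mul (div hf.bits hg) hg)

end PolyTime

/-- Predicates whose indicator function is computable in polynomial time. -/
def PolyTimePred (P : Input → List ℕ → Prop) : Prop :=
  ∃ f : InputFun, PolyTime .value f ∧ ∀ I e, (P I e ∧ f I e = 1) ∨ (¬P I e ∧ f I e = 0)

namespace PolyTimePred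

variable {γ : Growth} {f g : InputFun} {P Q : Input → List ℕ → Prop}

theorem ite {d : ∀ I e, Decidable (P I e)} (hP : PolyTimePred P) (hf : PolyTime γ f)
    (hg : PolyTime γ g) : PolyTime γ fun I e => if P I e then f I e else g I e := by
  obtain ⟨p, hp, h⟩ := hP
  convert (hp.of_value.mul hf).add (.mul (.sub (.const 1) hp.bits) hg) using 3 with I e
  rcases h I e with ⟨hP, val⟩ | ⟨hP, val⟩ <;> simp [hP, val]

theorem le (hf : PolyTime .bits f) (hg : PolyTime .bits g) :
    PolyTimePred fun I e => f I e ≤ g I e :=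
  ⟨_, .sub (.const 1) (.sub hf hg), fun I e => by omega⟩

theorem lt (hf : PolyTime .bits f) (hg : PolyTime .bits g) :
    PolyTimePred fun I e => f I e < g I e :=
  .le (hf.add (.const 1)) hg

theorem not (hP : PolyTimePred P) : PolyTimePred fun I e => ¬P I e := by
  obtain ⟨p, hp, h⟩ := hP
  refine ⟨_, .sub (.const 1) hp.bits, fun I e => ?_⟩
  rcases h I e with ⟨hP, val⟩ | ⟨hP, val⟩ <;> simp [hP, val]

theorem and (hP : PolyTimePred P) (hQ : PolyTimePred Q) :
    PolyTimePred fun I e => P I e ∧ Q I e := by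
  obtain ⟨p, hp, h⟩ := hP
  obtain ⟨q, hq, h'⟩ := hQ
  refine ⟨_, hp.mul hq, fun I e => ?_⟩
  rcases h I e with ⟨hP, val⟩ | ⟨hP, val⟩ <;>
    rcases h' I e with ⟨hQ, val'⟩ | ⟨hQ, val'⟩ <;>
    simp [hP, hQ, val, val']

theorem or (hP : PolyTimePred P) (hQ : PolyTimePred Q) :
    PolyTimePred fun I e => P I e ∨ Q I e := by
  simpa only [or_iff_not_and_not] using (hP.not.and hQ.not).not

theorem eq (hf : PolyTime .bits f) (hg : PolyTime .bits g) :
    PolyTimePred fun I e => f I e = g I e := by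
  simpa only [le_antisymm_iff] using (le hf hg).and (le hg hf)

theorem exists_lt {P : Input → ℕ → List ℕ → Prop} (hg : PolyTime .value g)
    (hP : PolyTimePred fun I e => P I e.headI e.tail) :
    PolyTimePred fun I e => ∃ i < g I e, P I i e := by
  obtain ⟨p, hp, h⟩ := hP
  have pos_iff (I i e) : 0 < p I (i :: e) ↔ P I i e := by
    rcases h I (i :: e) with ⟨holds, val⟩ | ⟨fails, val⟩
    · exact iff_of_true (by omega) holds
    · exact iff_of_false (by omega) fails
  simpa only [sum_pos_iff, mem_range, pos_iff] using
    lt (.const 0) (PolyTime.sum_cons hg hp).bits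

end PolyTimePred

/-- The program has written the first `i` cells of the output array. -/
structure OutputState (I : Input) (out : ℕ → ℕ) (i : ℕ) (M : Mem) : Prop where
  stored : I.StoredIn M
  idx : M.reg 3 = i
  written : ∀ j < i, M.arr 2 j = out j

theorem OutputState.halts_body {I : Input} {out : ℕ → ℕ} {i T S ℓ : ℕ} {p : Prog} {M : Mem}
    (h : OutputState I out i M) (hi : i < ℓ) (hS : Nat.size (out i) ≤ S)
    (hp : HaltsWithin p M T fun M' => AgreeBelow 4 M M' ∧ M'.reg 4 = out i) :
    HaltsWithin (.seq p (.seq (.put 2 (.reg 3) (.reg 4)) (.set 3 (.add (.reg 3) (.const 1))))) M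
      (T + (ℓ + S + 3 + (2 * ℓ + 6))) (OutputState I out (i + 1)) := by
  refine hp.seq fun M₁ ⟨agree, val⟩ => ?_
  have stored := agree.storedIn (by omega) h.stored
  have idx : M₁.reg 3 = i := (agree.reg 3 (by omega)).trans h.idx
  have size_i := size_le_self i
  refine .seq (φ := fun M₂ => I.StoredIn M₂ ∧ M₂.reg 3 = i ∧ ∀ j < i + 1, M₂.arr 2 j = out j)
    (.put ?_ ⟨⟨stored.N, stored.k, stored.n, stored.num, stored.den⟩, idx, fun j hj => ?_⟩)
    fun M₂ ⟨stored₂, idx₂, written₂⟩ =>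
      .set ?_ ⟨((AgreeBelow.refl 3 M₂).setReg _ le_rfl).storedIn le_rfl stored₂, ?_, written₂⟩
  · simp only [Expr.cost, idx, val]
    omega
  · simp only [Mem.setArr, Expr.val, idx, val, Function.update_self]
    rcases (Nat.lt_succ_iff.1 hj).eq_or_lt with rfl | hji
    · rw [Function.update_self]
    · rw [Function.update_of_ne hji.ne, agree.arr, h.written j hji]
  · have size_one : Nat.size 1 = 1 := Nat.size_one
    have := size_le_self (i + 1)
    simp only [Expr.cost, Expr.val, idx₂, size_one]
    omega
  · simp only [Mem.setReg_reg_self, Expr.val, idx₂]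

theorem PolyTime.exists_output_program {out : Input → ℕ → ℕ}
    (h : PolyTime .value fun I e => out I e.headI) :
    ∃ (prog : Prog) (T : ℕ[X]), ∀ (I : Input) (M : Mem) (ℓ : ℕ), I.StoredIn M → I.Bounded [] ℓ →
      HaltsWithin prog M (T.eval ℓ) fun M' => ∀ j < I.n, M'.arr 2 j = out I j := by
  obtain ⟨p, P, hp⟩ := h.computes [3] 4 (by omega) (by simp)
  obtain ⟨Q, hQ⟩ := h.polyBounded.bits
  refine ⟨.seq (.set 3 (.const 0)) (.loop (.sub (.reg 2) (.reg 3)) (.seq p (.seq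
    (.put 2 (.reg 3) (.reg 4)) (.set 3 (.add (.reg 3) (.const 1)))))),
    2 + (X + 1) * (3 * X + 3 + 1 + (P + (X + Q + 3 + (2 * X + 6)))), fun I M ℓ hI hB => ?_⟩
  simp only [eval_add, eval_mul, eval_X, eval_one, eval_ofNat]
  have start : OutputState I (out I) 0 (M.setReg 3 0) :=
    ⟨((AgreeBelow.refl 3 M).setReg _ le_rfl).storedIn le_rfl hI, Mem.setReg_reg_self _ _ _,
      fun j hj => absurd hj j.not_lt_zero⟩
  refine HaltsWithin.seq (φ := OutputState I (out I) 0) (.set (by simp [Expr.cost]) start)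
    fun M₁ hM₁ => ((HaltsWithin.loop (m := I.n) (fun i hi M' hM' => ?_) (fun i hi M' hM' => ?_)
      hM₁).mono (Nat.mul_le_mul_right _ (Nat.succ_le_succ hB.n_le)) fun M' hM' => hM'.written)
  · have := size_le_self I.n
    have := size_le_self i
    have := size_le_self (I.n - i)
    have := hB.n_le
    simp only [Expr.cost, Expr.val, hM'.stored.n, hM'.idx]
    omega
  · have env : [3].map M'.reg = [i] := congrArg (fun x => [x]) hM'.idx
    have bounded : I.Bounded [i] ℓ := hB.cons (hi.le.trans hB.n_le)
    exact hM'.halts_body (hi.trans_le hB.n_le) (hQ I [i] ℓ bounded)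
      (by simpa only [env, List.headI] using
        hp I M' ℓ hM'.stored (by simpa only [env] using bounded))

/-! ### Counting and order statistics -/

open scoped Classical in
/-- Number of natural numbers below `n` with property `P`. -/
noncomputable def countBelow (P : ℕ → Prop) (n : ℕ) : ℕ := #{i ∈ range n | P i}

open scoped Classical in
/-- Sum of `f` over the natural numbers below `n` with property `P`. -/
noncomputable def sumBelow (P : ℕ → Prop) (f : ℕ → ℕ) (n : ℕ) : ℕ :=
  ∑ i ∈ range n with P i, f i

/-- Number of jobs below `n` in the class `J` whose size `R j` is at least `v`. -/
noncomputable def countGe (J : ℕ → Prop) (R : ℕ → ℕ) (n v : ℕ) : ℕ :=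
  countBelow (fun j => J j ∧ v ≤ R j) n

open scoped Classical in
/-- The `i`-th largest size (counting from `0`) of a job below `n` in the class `J`, and zero if
there is none. -/
noncomputable def orderStat (J : ℕ → Prop) (R : ℕ → ℕ) (n i : ℕ) : ℕ :=
  (range n).sup fun j => if J j ∧ i < countGe J R n (R j) then R j else 0

theorem countBelow_eq_card (P : ℕ → Prop) [DecidablePred P] (n : ℕ) :
    countBelow P n = #{i ∈ range n | P i} := by
  rw [countBelow]
  congr! 2

theorem sumBelow_eq_sum (P : ℕ → Prop) [DecidablePred P] (f : ℕ → ℕ) (n : ℕ) :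
    sumBelow P f n = ∑ i ∈ range n with P i, f i := by
  rw [sumBelow]
  congr! 2

theorem countBelow_le (P : ℕ → Prop) (n : ℕ) : countBelow P n ≤ n := by
  classical
  rw [countBelow_eq_card]
  exact (card_filter_le _ _).trans (card_range n).le

theorem countBelow_succ (P : ℕ → Prop) [DecidablePred P] (n : ℕ) :
    countBelow P (n + 1) = countBelow P n + if P n then 1 else 0 := by
  rw [countBelow_eq_card, countBelow_eq_card, range_add_one, filter_insert]
  split_ifs with h
  · exact card_insert_of_notMem (by simp)
  · rfl

theorem countBelow_congr {P Q : ℕ → Prop} {n : ℕ} (h : ∀ i < n, (P i ↔ Q i)) :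
    countBelow P n = countBelow Q n := by
  classical
  rw [countBelow_eq_card, countBelow_eq_card]
  congr 1
  exact filter_congr fun i hi => h i (mem_range.1 hi)

theorem sumBelow_congr {P Q : ℕ → Prop} {f g : ℕ → ℕ} {n : ℕ} (h : ∀ i < n, (P i ↔ Q i))
    (hf : ∀ i < n, f i = g i) : sumBelow P f n = sumBelow Q g n := by
  classical
  rw [sumBelow_eq_sum, sumBelow_eq_sum]
  refine sum_congr (filter_congr fun i hi => h i (mem_range.1 hi)) fun i hi => ?_
  exact hf i (mem_range.1 (mem_filter.1 hi).1)

theorem lt_countBelow_iff {P : ℕ → Prop} (hP : ∀ i j, i ≤ j → P j → P i) {n i : ℕ} :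
    i < countBelow P n ↔ i < n ∧ P i := by
  classical
  induction n generalizing i with
  | zero => simp [countBelow_eq_card]
  | succ n ih =>
    rw [countBelow_succ]
    split_ifs with h
    · have all : countBelow P n = n := by
        rw [countBelow_eq_card, filter_true_of_mem fun i hi => hP i n (mem_range.1 hi).le h,
          card_range]
      rw [all]
      exact ⟨fun hi => ⟨hi, hP i n (Nat.lt_succ_iff.1 hi) h⟩, fun hi => hi.1⟩
    · rw [add_zero, ih]
      refine ⟨fun hi => ⟨hi.1.trans n.lt_succ_self, hi.2⟩, fun ⟨hi, hPi⟩ =>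
        ⟨lt_of_le_of_ne (Nat.lt_succ_iff.1 hi) ?_, hPi⟩⟩
      rintro rfl
      exact h hPi

section OrderStat

variable {J : ℕ → Prop} {R : ℕ → ℕ} {n : ℕ}

theorem countGe_anti {v w : ℕ} (h : v ≤ w) : countGe J R n w ≤ countGe J R n v := by
  classical
  rw [countGe, countGe, countBelow_eq_card, countBelow_eq_card]
  exact card_le_card (monotone_filter_right _ fun i _ hi => ⟨hi.1, h.trans hi.2⟩)

theorem le_orderStat_iff {v i : ℕ} (hv : 0 < v) :
    v ≤ orderStat J R n i ↔ i < countGe J R n v := by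
  classical
  rw [orderStat, Finset.le_sup_iff (by simpa using hv)]
  constructor
  · rintro ⟨j, -, hj⟩
    split_ifs at hj with h
    · exact h.2.trans_le (countGe_anti hj)
    · omega
  · intro h
    have hpos : 0 < countGe J R n v := by omega
    rw [countGe, countBelow_eq_card, card_pos] at hpos
    obtain ⟨j, hj, hmin⟩ := exists_min_image _ R hpos
    simp only [mem_filter, mem_range] at hj hmin
    refine ⟨j, mem_range.2 hj.1, ?_⟩
    have : countGe J R n v ≤ countGe J R n (R j) := by
      rw [countGe, countGe, countBelow_eq_card, countBelow_eq_card]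
      refine card_le_card fun i hi => ?_
      simp only [mem_filter, mem_range] at hi ⊢
      exact ⟨hi.1, hi.2.1, hmin i hi⟩
    rw [if_pos ⟨hj.2.1, h.trans_le this⟩]
    exact hj.2.2

theorem orderStat_anti : Antitone (orderStat J R n) := by
  intro i j hij
  rcases Nat.eq_zero_or_pos (orderStat J R n j) with h | h
  · omega
  · rw [le_orderStat_iff h]
    exact hij.trans_lt ((le_orderStat_iff h).1 le_rfl)

theorem orderStat_eq_zero {i : ℕ} (h : n ≤ i) : orderStat J R n i = 0 := by
  by_contra hne
  have := (le_orderStat_iff (Nat.pos_of_ne_zero hne)).1 (le_refl (orderStat J R n i))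
  have := countBelow_le (fun j => J j ∧ orderStat J R n i ≤ R j) n
  rw [countGe] at *
  omega

theorem orderStat_le {i B : ℕ} (h : ∀ j < n, J j → R j ≤ B) : orderStat J R n i ≤ B := by
  classical
  refine Finset.sup_le fun j hj => ?_
  split_ifs with h'
  · exact h j (mem_range.1 hj) h'.1
  · exact Nat.zero_le _

theorem countGe_succ [DecidablePred J] (v : ℕ) : countGe J R (n + 1) v =
    countGe J R n v + if J n ∧ v ≤ R n then 1 else 0 := countBelow_succ _ _

theorem orderStat_insert_zero (hn : J n) :
    orderStat J R (n + 1) 0 = max (orderStat J R n 0) (R n) := by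
  classical
  refine eq_of_forall_le_iff fun v => ?_
  rcases Nat.eq_zero_or_pos v with rfl | hv
  · simp
  rw [le_orderStat_iff hv, countGe_succ, le_max_iff, le_orderStat_iff hv]
  simp only [hn, true_and]
  split_ifs with h <;> simp [h]

theorem orderStat_insert_succ (hn : J n) (i : ℕ) : orderStat J R (n + 1) (i + 1) =
    max (orderStat J R n (i + 1)) (min (R n) (orderStat J R n i)) := by
  classical
  refine eq_of_forall_le_iff fun v => ?_
  rcases Nat.eq_zero_or_pos v with rfl | hv
  · simp
  rw [le_orderStat_iff hv, countGe_succ, le_max_iff, le_min_iff, le_orderStat_iff hv,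
    le_orderStat_iff hv]
  simp only [hn, true_and]
  split_ifs with h
  · simp only [h, true_and]
    omega
  · simp [h]

open scoped Classical in
theorem card_orderStat_ge {v : ℕ} (hv : 0 < v) :
    #{i ∈ range n | v ≤ orderStat J R n i} = #{j ∈ range n | J j ∧ v ≤ R j} := by
  have h : {i ∈ range n | v ≤ orderStat J R n i} = range (countGe J R n v) := by
    ext i
    simp only [mem_filter, mem_range, le_orderStat_iff hv]
    have := countBelow_le (fun j => J j ∧ v ≤ R j) n
    rw [countGe]
    omega
  rw [h, card_range, countGe, countBelow_eq_card]

theorem card_le_eq_card_eq_add_card_succ_le {ι : Type*} (s : Finset ι) (f : ι → ℕ) (v : ℕ) :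
    #{i ∈ s | v ≤ f i} = #{i ∈ s | f i = v} + #{i ∈ s | v + 1 ≤ f i} := by
  classical
  rw [← card_union_of_disjoint (disjoint_filter.2 fun i _ h h' => by omega), ← filter_or]
  congr 1
  exact filter_congr fun i _ => by omega

open scoped Classical in
theorem card_orderStat_eq {v : ℕ} (hv : 0 < v) :
    #{i ∈ range n | orderStat J R n i = v} = #{j ∈ range n | J j ∧ R j = v} := by
  have ge := card_orderStat_ge (J := J) (R := R) (n := n) hv
  have gt := card_orderStat_ge (J := J) (R := R) (n := n) (v := v + 1) v.succ_pos
  have split_ranks := card_le_eq_card_eq_add_card_succ_le (range n) (orderStat J R n) v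
  have split_jobs := card_le_eq_card_eq_add_card_succ_le {j ∈ range n | J j} R v
  simp only [filter_filter] at split_jobs
  omega

theorem sum_eq_sum_card_ge {ι : Type*} (s : Finset ι) (f : ι → ℕ) {B : ℕ} (h : ∀ i ∈ s, f i ≤ B) :
    ∑ i ∈ s, f i = ∑ v ∈ Icc 1 B, #{i ∈ s | v ≤ f i} := by
  simp only [card_filter]
  rw [sum_comm]
  refine sum_congr rfl fun i hi => ?_
  rw [← card_filter]
  have : {v ∈ Icc 1 B | v ≤ f i} = Icc 1 (f i) := by
    ext v
    have := h i hi
    simp only [mem_filter, mem_Icc]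
    omega
  rw [this, Nat.card_Icc]
  omega

theorem sum_le_sum_orderStat {s : Finset ℕ} {m : ℕ} (hs : ∀ j ∈ s, j < n ∧ J j)
    (hm : #s ≤ m) : ∑ j ∈ s, R j ≤ ∑ i ∈ range m, orderStat J R n i := by
  classical
  set B := (range n).sup R
  have hRB : ∀ j < n, R j ≤ B := fun j hj => le_sup (f := R) (mem_range.2 hj)
  rw [sum_eq_sum_card_ge s R (B := B) fun j hj => hRB j (hs j hj).1,
    sum_eq_sum_card_ge (range m) (orderStat J R n) (B := B)
      fun i _ => orderStat_le fun j hj _ => hRB j hj]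
  refine sum_le_sum fun v hv => ?_
  have initial : {i ∈ range m | v ≤ orderStat J R n i} = range (min m (countGe J R n v)) := by
    ext i
    simp only [mem_filter, mem_range, le_orderStat_iff (mem_Icc.1 hv).1, lt_min_iff]
  rw [initial, card_range, le_min_iff]
  refine ⟨(card_filter_le _ _).trans hm, ?_⟩
  rw [countGe, countBelow_eq_card]
  refine card_le_card fun j hj => ?_
  simp only [mem_filter, mem_range] at hj ⊢
  exact ⟨(hs j hj.1).1, (hs j hj.1).2, hj.2⟩

theorem sum_orderStat : ∑ i ∈ range n, orderStat J R n i = sumBelow J R n := by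
  classical
  rw [sumBelow_eq_sum]
  set B := (range n).sup R
  have hRB : ∀ j < n, R j ≤ B := fun j hj => le_sup (f := R) (mem_range.2 hj)
  rw [sum_eq_sum_card_ge (range n) (orderStat J R n) (B := B)
      fun i _ => orderStat_le fun j hj _ => hRB j hj,
    sum_eq_sum_card_ge {j ∈ range n | J j} R (B := B) fun j hj => hRB j
      (mem_range.1 (mem_filter.1 hj).1)]
  refine sum_congr rfl fun v hv => ?_
  rw [card_orderStat_ge (mem_Icc.1 hv).1, filter_filter]

/-! ### Distributing a quota within each class of equal sizes -/

theorem card_filter_rank_lt (s : Finset ℕ) (y : ℕ) :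
    #{j ∈ s | #{i ∈ s | i < j} < y} = min y #s := by
  induction s using Finset.induction_on_max with
  | empty => simp
  | insert a s ha ih =>
    have hna : a ∉ s := fun h => lt_irrefl _ (ha a h)
    have rank_old : ∀ j ∈ s, {i ∈ insert a s | i < j} = {i ∈ s | i < j} := by
      intro j hj
      rw [filter_insert, if_neg (ha j hj).not_gt]
    have rank_new : {i ∈ insert a s | i < a} = s := by
      rw [filter_insert, if_neg (lt_irrefl _)]
      exact filter_true_of_mem ha
    rw [filter_insert, rank_new, card_insert_of_notMem hna,
      filter_congr (q := fun j => #{i ∈ s | i < j} < y) fun j hj => by rw [rank_old j hj]]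
    split_ifs with h
    · rw [card_insert_of_notMem (by simp [hna]), ih]
      omega
    · rw [ih]
      omega

/-- Among the jobs of class `J` with equal size, those that come first. -/
def Chosen (J : ℕ → Prop) (R : ℕ → ℕ) (y : ℕ → ℕ) (j : ℕ) : Prop :=
  countBelow (fun i => J i ∧ R i = R j) j < y (R j)

open scoped Classical in
theorem card_chosen (y : ℕ → ℕ) (v : ℕ) :
    #{j ∈ range n | (J j ∧ R j = v) ∧ Chosen J R y j} =
      min (y v) #{j ∈ range n | J j ∧ R j = v} := by
  rw [← card_filter_rank_lt {j ∈ range n | J j ∧ R j = v}, ← filter_filter]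
  congr 1
  refine filter_congr fun j hj => ?_
  simp only [mem_filter, mem_range] at hj
  rw [Chosen, countBelow_eq_card, hj.2.2]
  have earlier : {i ∈ range j | J i ∧ R i = v} = {i ∈ {j ∈ range n | J j ∧ R j = v} | i < j} := by
    ext i
    simp only [mem_filter, mem_range]
    constructor
    · rintro ⟨hij, hi⟩
      exact ⟨⟨hij.trans hj.1, hi⟩, hij⟩
    · rintro ⟨⟨-, hi⟩, hij⟩
      exact ⟨hij, hi⟩
  rw [earlier]

theorem sum_chosen (m : ℕ → Prop) (g : ℕ → ℕ) (hg : g 0 = 0) :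
    sumBelow (fun j => J j ∧
      Chosen J R (fun v => countBelow (fun i => orderStat J R n i = v ∧ m i) n) j)
      (fun j => g (R j)) n = sumBelow m (fun i => g (orderStat J R n i)) n := by
  classical
  set B := (range n).sup R
  have hRB : ∀ j < n, R j ≤ B := fun j hj => le_sup (f := R) (mem_range.2 hj)
  set y : ℕ → ℕ := fun v => countBelow (fun i => orderStat J R n i = v ∧ m i) n with hy
  rw [sumBelow_eq_sum, sumBelow_eq_sum,
    ← sum_fiberwise_of_maps_to' (t := range (B + 1)) (g := R) (f := g) (by
      intro j hj
      simp only [mem_filter, mem_range] at hj ⊢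
      exact Nat.lt_succ_of_le (hRB j hj.1)),
    ← sum_fiberwise_of_maps_to' (t := range (B + 1)) (g := orderStat J R n) (f := g) (by
      intro i _
      rw [mem_range, Nat.lt_succ_iff]
      exact orderStat_le fun j hj _ => hRB j hj)]
  refine sum_congr rfl fun v _ => ?_
  rcases Nat.eq_zero_or_pos v with rfl | hv
  · simp [hg]
  rw [sum_const, sum_const]
  congr 1
  have of_size : {j ∈ {j ∈ range n | J j ∧ Chosen J R y j} | R j = v} =
      {j ∈ range n | (J j ∧ R j = v) ∧ Chosen J R y j} := by
    rw [filter_filter]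
    exact filter_congr fun j _ => and_right_comm
  rw [of_size, card_chosen, ← card_orderStat_eq hv, hy]
  simp only
  rw [countBelow_eq_card, filter_filter,
    filter_congr (q := fun i => orderStat J R n i = v ∧ m i) fun i _ => and_comm]
  refine min_eq_left (card_le_card fun i hi => ?_)
  simp only [mem_filter] at hi ⊢
  exact ⟨hi.1, hi.2.1⟩

open scoped Classical in
theorem card_chosen_ne_le (y y' : ℕ → ℕ) (v : ℕ) :
    #{j ∈ range n | (J j ∧ R j = v) ∧ ¬(Chosen J R y j ↔ Chosen J R y' j)} ≤
      Nat.dist (y v) (y' v) := by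
  wlog hyy : y v ≤ y' v generalizing y y'
  · simpa only [iff_comm, Nat.dist_comm] using this y' y (not_le.1 hyy).le
  have chosen_mono : ∀ j, R j = v → Chosen J R y j → Chosen J R y' j := by
    intro j hj h
    rw [Chosen, hj] at h ⊢
    exact h.trans_le hyy
  have subset : {j ∈ range n | (J j ∧ R j = v) ∧ Chosen J R y j} ⊆
      {j ∈ range n | (J j ∧ R j = v) ∧ Chosen J R y' j} :=
    monotone_filter_right _ fun j _ h => ⟨h.1, chosen_mono j h.1.2 h.2⟩
  calc #{j ∈ range n | (J j ∧ R j = v) ∧ ¬(Chosen J R y j ↔ Chosen J R y' j)}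
      ≤ #({j ∈ range n | (J j ∧ R j = v) ∧ Chosen J R y' j} \
          {j ∈ range n | (J j ∧ R j = v) ∧ Chosen J R y j}) := by
        refine card_le_card fun j hj => ?_
        simp only [mem_filter, mem_sdiff] at hj ⊢
        have := chosen_mono j hj.2.1.2
        tauto
    _ ≤ Nat.dist (y v) (y' v) := by
        rw [card_sdiff_of_subset subset, card_chosen, card_chosen, Nat.dist]
        omega

theorem sum_chosen_ne_le (y y' : ℕ → ℕ) {B : ℕ} (hB : ∀ j < n, R j ≤ B) :
    sumBelow (fun j => J j ∧ ¬(Chosen J R y j ↔ Chosen J R y' j)) R n ≤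
      ∑ v ∈ Icc 1 B, v * Nat.dist (y v) (y' v) := by
  classical
  have maps : ∀ j ∈ {j ∈ range n | J j ∧ ¬(Chosen J R y j ↔ Chosen J R y' j)},
      R j ∈ range (B + 1) := fun j hj =>
    mem_range.2 (Nat.lt_succ_of_le (hB j (mem_range.1 (mem_filter.1 hj).1)))
  have drop_zero : ∑ v ∈ Icc 1 B, v * Nat.dist (y v) (y' v) =
      ∑ v ∈ range (B + 1), v * Nat.dist (y v) (y' v) := by
    rw [range_eq_Ico, sum_eq_sum_Ico_succ_bot (Nat.succ_pos B), zero_mul, zero_add]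
    rfl
  rw [drop_zero, sumBelow_eq_sum, ← sum_fiberwise_of_maps_to' maps fun v => v]
  refine sum_le_sum fun v _ => ?_
  rw [sum_const, smul_eq_mul, mul_comm, filter_filter]
  refine Nat.mul_le_mul_left v (le_of_eq_of_le ?_
    (card_chosen_ne_le (n := n) (J := J) (R := R) y y' v))
  congr 1
  exact filter_congr fun j _ => and_right_comm

end OrderStat

theorem countBelow_mono {P : ℕ → Prop} {m n : ℕ} (h : m ≤ n) : countBelow P m ≤ countBelow P n := by
  classical
  rw [countBelow_eq_card, countBelow_eq_card]
  exact card_le_card (filter_subset_filter _ (range_subset_range.2 h))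

theorem countBelow_add_not (P : ℕ → Prop) (n : ℕ) :
    countBelow P n + countBelow (fun i => ¬ P i) n = n := by
  classical
  rw [countBelow_eq_card, countBelow_eq_card, card_filter_add_card_filter_not, card_range]

theorem sumBelow_add_not (P : ℕ → Prop) (f : ℕ → ℕ) (n : ℕ) :
    sumBelow P f n + sumBelow (fun i => ¬ P i) f n = ∑ i ∈ range n, f i := by
  classical
  rw [sumBelow_eq_sum, sumBelow_eq_sum, ← sum_filter_add_sum_filter_not (range n) P]

theorem sumBelow_le_sumBelow {m n : ℕ} (P : ℕ → Prop) (f : ℕ → ℕ) (h : m ≤ n) :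
    sumBelow P f m ≤ sumBelow P f n := by
  classical
  rw [sumBelow_eq_sum, sumBelow_eq_sum]
  exact sum_le_sum_of_subset (filter_subset_filter _ (range_subset_range.2 h))

/-- Total of `s` over the indices from `q` up to `n`. -/
noncomputable def tailLoad (s : ℕ → ℕ) (n q : ℕ) : ℕ := ∑ i ∈ Ico q n, s i

theorem sumBelow_le_add_tailLoad (P : ℕ → Prop) (s : ℕ → ℕ) (n q : ℕ) :
    sumBelow P s n ≤ sumBelow P s q + tailLoad s n q := by
  classical
  rw [sumBelow_eq_sum, sumBelow_eq_sum, tailLoad]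
  refine (sum_le_sum_of_subset (t := {i ∈ range q | P i} ∪ Ico q n) fun i hi => ?_).trans
    (sum_union_inter (f := s) ▸ Nat.le_add_right _ _)
  simp only [mem_filter, mem_range, mem_union, mem_Ico] at hi ⊢
  by_cases h : i < q
  · exact Or.inl ⟨h, hi.2⟩
  · exact Or.inr ⟨not_lt.1 h, hi.1⟩

section FiniteSupport

variable {s : ℕ → ℕ} {n n' : ℕ}

theorem sum_range_extend (h0 : ∀ i, n ≤ i → s i = 0) (h : n ≤ n') :
    ∑ i ∈ range n, s i = ∑ i ∈ range n', s i :=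
  sum_subset (range_subset_range.2 h) fun i _ hi => h0 i (by simpa using hi)

theorem sumBelow_extend (P : ℕ → Prop) (h0 : ∀ i, n ≤ i → s i = 0) (h : n ≤ n') :
    sumBelow P s n = sumBelow P s n' := by
  classical
  rw [sumBelow_eq_sum, sumBelow_eq_sum]
  refine sum_subset (filter_subset_filter _ (range_subset_range.2 h)) fun i hi hi' => h0 i ?_
  simp only [mem_filter, mem_range] at hi hi'
  exact not_lt.1 fun hin => hi' ⟨hin, hi.2⟩

theorem tailLoad_extend (h0 : ∀ i, n ≤ i → s i = 0) (h : n ≤ n') (q : ℕ) :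
    tailLoad s n q = tailLoad s n' q :=
  sum_subset (Ico_subset_Ico_right h) fun i hi hi' => h0 i (by
    simp only [mem_Ico] at hi hi'
    omega)

end FiniteSupport

/-! ### Splitting a sorted sequence between two machines -/

/-- Up to the factor `Λ`, an upper estimate of `s i - s (2 * κ - 1 - i)`, the amount by which the
first machine gets relieved when rank `i` goes to the second machine and its mirror image to the
first one. Because of the minimum with `Λ * s i`, the insertion of a job lowers the gain only at
ranks of size at most `Λ + 1` times that of the job. -/
def gain (Λ κ n : ℕ) (s : ℕ → ℕ) (i : ℕ) : ℕ :=
  min (Λ * s i) ((Λ + 1) * (s i - s (min n (2 * κ - 1 - i))))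

/-- Number of top ranks that go to the second machine to make up for the lead `D` of the first. -/
noncomputable def cutoff (Λ κ n D : ℕ) (s : ℕ → ℕ) : ℕ :=
  countBelow (fun t => t < κ ∧ ∑ i ∈ range t, gain Λ κ n s i < Λ * D) n

/-- The ranks on the second machine: the `T` top ranks, then every other rank up to the mirror
image of the top ranks, and the ranks from `2 * κ` on if the second machine has fewer big jobs
(`b` of them) than the first (`a` of them). -/
def RankRight (κ T a b i : ℕ) : Prop :=
  i < T ∨ (T ≤ i ∧ i + T < 2 * κ ∧ i % 2 = 0) ∨ (2 * κ ≤ i ∧ b < a)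

/-- Number of ranks with value `v` on the second machine. -/
noncomputable def quota (κ T a b n : ℕ) (s : ℕ → ℕ) (v : ℕ) : ℕ :=
  countBelow (fun i => s i = v ∧ RankRight κ T a b i) n

theorem sum_range_two_mul_mirror {M : Type*} [AddCommMonoid M] (f : ℕ → M) (κ : ℕ) :
    ∑ i ∈ range (2 * κ), f i = ∑ i ∈ range κ, (f i + f (2 * κ - 1 - i)) := by
  rw [two_mul, sum_range_add, sum_add_distrib, ← sum_range_reflect (fun i => f (κ + i)) κ]
  congr 1
  refine sum_congr rfl fun i hi => ?_
  rw [mem_range] at hi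
  congr 1
  omega

section RankRight

variable {κ T a b : ℕ}

theorem rankRight_mirror {i : ℕ} (hT : T ≤ κ) (hi : i < κ) :
    RankRight κ T a b (2 * κ - 1 - i) ↔ ¬ RankRight κ T a b i := by
  rw [RankRight, RankRight]
  omega

theorem countBelow_rankRight (hT : T ≤ κ) : countBelow (RankRight κ T a b) (2 * κ) = κ := by
  classical
  rw [countBelow_eq_card, card_filter, sum_range_two_mul_mirror,
    sum_congr rfl (g := fun _ => 1), sum_const, card_range, smul_eq_mul, mul_one]
  intro i hi
  rw [if_congr (rankRight_mirror hT (mem_range.1 hi)) rfl rfl]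
  split_ifs <;> rfl

theorem countBelow_rankRight_add (hT : T ≤ κ) (c : ℕ) :
    countBelow (RankRight κ T a b) (2 * κ + c) = κ + if b < a then c else 0 := by
  classical
  induction c with
  | zero => simp [countBelow_rankRight hT]
  | succ c ih =>
    have beyond : RankRight κ T a b (2 * κ + c) ↔ b < a := by
      rw [RankRight]
      omega
    rw [← add_assoc, countBelow_succ, ih]
    simp only [beyond]
    split_ifs <;> omega

theorem rankRight_split_feasible {k c : ℕ} (ha : a ≤ k) (hb : b ≤ k) (hc : a + b + c ≤ 2 * k)
    (hT : T ≤ k - max a b) :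
    b + countBelow (RankRight (k - max a b) T a b) c ≤ k ∧
      a + (c - countBelow (RankRight (k - max a b) T a b) c) ≤ k := by
  set κ := k - max a b
  rcases le_total c (2 * κ) with h | h
  · have right_le := countBelow_mono (P := RankRight κ T a b) h
    have left_le := countBelow_mono (P := fun i => ¬ RankRight κ T a b i) h
    have total := countBelow_add_not (RankRight κ T a b) c
    have total' := countBelow_add_not (RankRight κ T a b) (2 * κ)
    rw [countBelow_rankRight hT] at right_le total'
    omega
  · obtain ⟨d, rfl⟩ := Nat.exists_eq_add_of_le h
    rw [countBelow_rankRight_add hT]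
    split_ifs <;> omega

end RankRight

theorem alternating_sum_bounds (d : ℕ → ℤ) {T κ : ℕ}
    (anti : ∀ i j, T ≤ i → i ≤ j → j < κ → d j ≤ d i) (nonneg : ∀ i, T ≤ i → i < κ → 0 ≤ d i)
    (hT : T < κ) :
    0 ≤ ∑ i ∈ Ico T κ, (-1) ^ (i - T) * d i ∧ ∑ i ∈ Ico T κ, (-1) ^ (i - T) * d i ≤ d T := by
  obtain ⟨m, rfl⟩ : ∃ m, κ = T + 1 + m := ⟨κ - T - 1, by omega⟩
  clear hT
  induction m generalizing T with
  | zero => simpa using nonneg T le_rfl (by omega)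
  | succ m ih =>
    have rest := ih (T := T + 1) (fun i j _ hij _ => anti i j (by omega) hij (by omega))
      (fun i _ _ => nonneg i (by omega) (by omega))
    rw [show T + 1 + 1 + m = T + 1 + (m + 1) by omega] at rest
    have peel : ∑ i ∈ Ico T (T + 1 + (m + 1)), (-1) ^ (i - T) * d i =
        d T - ∑ i ∈ Ico (T + 1) (T + 1 + (m + 1)), (-1) ^ (i - (T + 1)) * d i := by
      rw [sum_eq_sum_Ico_succ_bot (by omega), Nat.sub_self, pow_zero, one_mul, sub_eq_add_neg,
        ← sum_neg_distrib]
      congr 1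
      refine sum_congr rfl fun i hi => ?_
      rw [mem_Ico] at hi
      rw [show i - T = i - (T + 1) + 1 by omega, pow_succ]
      ring
    rw [peel]
    have first_two := anti T (T + 1) le_rfl (by omega) (by omega)
    constructor <;> linarith [rest.1, rest.2, first_two]

section Split

variable {s : ℕ → ℕ} {n Λ κ D T a b : ℕ}

theorem sumBelow_rankRight_sub (hT : T ≤ κ) [DecidablePred (RankRight κ T a b)] :
    (sumBelow (RankRight κ T a b) s (2 * κ) : ℤ) -
        sumBelow (fun i => ¬ RankRight κ T a b i) s (2 * κ) =
      ∑ i ∈ range κ, if RankRight κ T a b i then (s i : ℤ) - s (2 * κ - 1 - i)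
        else -((s i : ℤ) - s (2 * κ - 1 - i)) := by
  rw [sumBelow_eq_sum, sumBelow_eq_sum, sum_filter, sum_filter]
  push_cast
  rw [← sum_sub_distrib, sum_range_two_mul_mirror]
  refine sum_congr rfl fun i hi => ?_
  have mirror := rankRight_mirror (a := a) (b := b) hT (mem_range.1 hi)
  by_cases h : RankRight κ T a b i
  · simp only [mirror, h, not_true_eq_false, not_false_eq_true, if_true, if_false]
    ring
  · simp only [mirror, h, not_false_eq_true, not_true_eq_false, if_true, if_false]
    ring

theorem sum_ite_rankRight (d : ℕ → ℤ) (hT : T ≤ κ) [DecidablePred (RankRight κ T a b)] :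
    (∑ i ∈ range κ, if RankRight κ T a b i then d i else -d i) =
      ∑ i ∈ range T, d i + (-1) ^ T * ∑ i ∈ Ico T κ, (-1) ^ (i - T) * d i := by
  rw [range_eq_Ico, ← sum_Ico_consecutive _ (Nat.zero_le T) hT, mul_sum, range_eq_Ico]
  congr 1
  · exact sum_congr rfl fun i hi => if_pos (Or.inl (mem_Ico.1 hi).2)
  · refine sum_congr rfl fun i hi => ?_
    rw [mem_Ico] at hi
    have alternate : RankRight κ T a b i ↔ i % 2 = 0 := by
      rw [RankRight]
      omega
    rw [← mul_assoc, ← pow_add, Nat.add_sub_cancel' hi.1, if_congr alternate rfl rfl]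
    rcases Nat.even_or_odd i with even | odd
    · rw [if_pos (Nat.even_iff.1 even), even.neg_one_pow, one_mul]
    · rw [if_neg (by rw [Nat.odd_iff.1 odd]; exact one_ne_zero), odd.neg_one_pow, neg_one_mul]

theorem abs_sumBelow_rankRight_sub_le (hs : Antitone s) (hT : T ≤ κ) :
    |(sumBelow (RankRight κ T a b) s (2 * κ) : ℤ) -
      sumBelow (fun i => ¬ RankRight κ T a b i) s (2 * κ) -
      ∑ i ∈ range T, ((s i : ℤ) - s (2 * κ - 1 - i))| ≤ s 0 := by
  classical
  rw [sumBelow_rankRight_sub hT, sum_ite_rankRight (fun i => (s i : ℤ) - s (2 * κ - 1 - i)) hT,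
    add_sub_cancel_left, abs_mul, abs_neg_one_pow, one_mul]
  rcases hT.eq_or_lt with rfl | hlt
  · simp
  have anti : ∀ i j, T ≤ i → i ≤ j → j < κ →
      (s j : ℤ) - s (2 * κ - 1 - j) ≤ (s i : ℤ) - s (2 * κ - 1 - i) := by
    intro i j _ hij hj
    have low := hs hij
    have high : s (2 * κ - 1 - i) ≤ s (2 * κ - 1 - j) := hs (by omega)
    omega
  have nonneg : ∀ i, T ≤ i → i < κ → 0 ≤ (s i : ℤ) - s (2 * κ - 1 - i) := by
    intro i _ hi
    have : s (2 * κ - 1 - i) ≤ s i := hs (by omega)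
    omega
  obtain ⟨lower, upper⟩ := alternating_sum_bounds (fun i => (s i : ℤ) - s (2 * κ - 1 - i))
    anti nonneg hlt
  rw [abs_of_nonneg lower]
  have := hs (Nat.zero_le T)
  exact upper.trans (by omega)

theorem gain_eq (h0 : ∀ i, n ≤ i → s i = 0) (i : ℕ) :
    gain Λ κ n s i = min (Λ * s i) ((Λ + 1) * (s i - s (2 * κ - 1 - i))) := by
  rw [gain]
  rcases le_total n (2 * κ - 1 - i) with h | h
  · rw [min_eq_left h, h0 n le_rfl, h0 _ h]
  · rw [min_eq_right h]

theorem sum_mirror_sub (hs : Antitone s) (hT : T ≤ κ) :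
    ∑ i ∈ range T, ((s i : ℤ) - s (2 * κ - 1 - i)) =
      (∑ i ∈ range T, (s i - s (2 * κ - 1 - i)) : ℕ) := by
  push_cast
  refine sum_congr rfl fun i hi => ?_
  rw [mem_range] at hi
  have : s (2 * κ - 1 - i) ≤ s i := hs (by omega)
  omega

theorem mul_sum_mirror_sub_le_sum_gain (hs : Antitone s) (h0 : ∀ i, n ≤ i → s i = 0)
    (hT : T ≤ κ) : (Λ : ℤ) * ∑ i ∈ range T, ((s i : ℤ) - s (2 * κ - 1 - i)) ≤
      (∑ i ∈ range T, gain Λ κ n s i : ℕ) := by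
  rw [sum_mirror_sub hs hT]
  norm_cast
  rw [mul_sum]
  refine sum_le_sum fun i _ => ?_
  rw [gain_eq h0]
  exact le_min (Nat.mul_le_mul_left _ (Nat.sub_le _ _)) (Nat.mul_le_mul_right _ Λ.le_succ)

theorem sum_gain_le (hs : Antitone s) (h0 : ∀ i, n ≤ i → s i = 0) (hT : T ≤ κ) :
    ((∑ i ∈ range T, gain Λ κ n s i : ℕ) : ℤ) ≤
      Λ * ∑ i ∈ range T, ((s i : ℤ) - s (2 * κ - 1 - i)) + (∑ i ∈ range n, s i : ℕ) := by
  have top_le : ∑ i ∈ range T, s i ≤ ∑ i ∈ range n, s i := by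
    rcases le_total T n with h | h
    · exact sum_le_sum_of_subset (range_subset_range.2 h)
    · exact (sum_range_extend h0 h).ge
  rw [sum_mirror_sub hs hT]
  norm_cast
  refine le_trans ?_ (Nat.add_le_add_left top_le _)
  rw [mul_sum, ← sum_add_distrib]
  refine sum_le_sum fun i _ => ?_
  rw [gain_eq h0]
  refine (min_le_right _ _).trans ?_
  rw [add_mul, one_mul]
  exact Nat.add_le_add_left (Nat.sub_le _ _) _

theorem lt_cutoff_iff {t : ℕ} : t < cutoff Λ κ n D s ↔
    t < n ∧ t < κ ∧ ∑ i ∈ range t, gain Λ κ n s i < Λ * D :=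
  lt_countBelow_iff fun _ _ hij h => ⟨by omega,
    (sum_le_sum_of_subset (range_subset_range.2 hij)).trans_lt h.2⟩

theorem cutoff_le : cutoff Λ κ n D s ≤ κ := by
  by_contra h
  exact lt_irrefl _ (lt_cutoff_iff.1 (not_le.1 h)).2.1

theorem le_cutoff_or_cutoff_eq
    (h : ∑ i ∈ range (cutoff Λ κ n D s), gain Λ κ n s i < Λ * D) :
    n ≤ cutoff Λ κ n D s ∨ cutoff Λ κ n D s = κ := by
  by_contra hne
  have := cutoff_le (Λ := Λ) (κ := κ) (n := n) (D := D) (s := s)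
  exact lt_irrefl _ (lt_cutoff_iff.2 ⟨by omega, by omega, h⟩)

theorem sum_gain_cutoff_le (hs : Antitone s) (h0 : ∀ i, n ≤ i → s i = 0) :
    ∑ i ∈ range (cutoff Λ κ n D s), gain Λ κ n s i ≤ Λ * D + Λ * s 0 := by
  rcases hT : cutoff Λ κ n D s with _ | T
  · simp
  have before := (lt_cutoff_iff.1 (show T < cutoff Λ κ n D s by omega)).2.2
  have last : gain Λ κ n s T ≤ Λ * s 0 := by
    rw [gain_eq h0]
    exact (min_le_left _ _).trans (Nat.mul_le_mul_left _ (hs (Nat.zero_le _)))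
  rw [sum_range_succ]
  omega

theorem abs_sumBelow_rankRight_sub_le_add_tailLoad (hs : Antitone s) (h0 : ∀ i, n ≤ i → s i = 0)
    (hT : T ≤ κ) :
    |(sumBelow (RankRight κ T a b) s n : ℤ) - sumBelow (fun i => ¬ RankRight κ T a b i) s n -
      ∑ i ∈ range T, ((s i : ℤ) - s (2 * κ - 1 - i))| ≤ s 0 + tailLoad s n (2 * κ) := by
  have hn : n ≤ 2 * κ + n := Nat.le_add_left n (2 * κ)
  have main := abs_sumBelow_rankRight_sub_le (a := a) (b := b) hs hT
  have right_ge := sumBelow_le_sumBelow (RankRight κ T a b) s (Nat.le_add_right (2 * κ) n)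
  have right_le := sumBelow_le_add_tailLoad (RankRight κ T a b) s (2 * κ + n) (2 * κ)
  have left_ge := sumBelow_le_sumBelow (fun i => ¬ RankRight κ T a b i) s
    (Nat.le_add_right (2 * κ) n)
  have left_le := sumBelow_le_add_tailLoad (fun i => ¬ RankRight κ T a b i) s (2 * κ + n) (2 * κ)
  rw [sumBelow_extend _ h0 hn, sumBelow_extend _ h0 hn, tailLoad_extend h0 hn]
  rw [abs_le] at main ⊢
  omega

theorem balanced_split (hs : Antitone s) (h0 : ∀ i, n ≤ i → s i = 0) {L₁ L₂ S : ℕ}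
    (hL : Λ * L₂ ≤ Λ * L₁ + S) (hs0 : Λ * s 0 ≤ S) (htail : Λ * tailLoad s n (2 * κ) ≤ S)
    (hS : ∑ i ∈ range n, s i ≤ S)
    (balanced : Λ * (L₁ - L₂) ≤ ∑ i ∈ range (cutoff Λ κ n (L₁ - L₂) s), gain Λ κ n s i) :
    |(Λ * (L₂ + sumBelow (RankRight κ (cutoff Λ κ n (L₁ - L₂) s) a b) s n) : ℤ) -
      Λ * (L₁ + sumBelow (fun i => ¬ RankRight κ (cutoff Λ κ n (L₁ - L₂) s) a b i) s n)| ≤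
        4 * S := by
  have gain_upper := sum_gain_cutoff_le (Λ := Λ) (κ := κ) (D := L₁ - L₂) hs h0
  have hT : cutoff Λ κ n (L₁ - L₂) s ≤ κ := cutoff_le
  have diff := mul_le_mul_of_nonneg_left
    (abs_sumBelow_rankRight_sub_le_add_tailLoad (a := a) (b := b) hs h0 hT) (Nat.cast_nonneg Λ)
  have le_gain := mul_sum_mirror_sub_le_sum_gain (Λ := Λ) hs h0 hT
  have gain_le := sum_gain_le (Λ := Λ) hs h0 hT
  have lead_ge : Λ * L₁ ≤ Λ * (L₁ - L₂) + Λ * L₂ := by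
    rw [← mul_add]
    exact Nat.mul_le_mul_left _ (by omega)
  have lead_le : Λ * (L₁ - L₂) + Λ * L₂ ≤ Λ * L₁ + S := by
    rcases le_total L₁ L₂ with h | h
    · rw [Nat.sub_eq_zero_of_le h]
      simpa using hL
    · rw [← mul_add, Nat.sub_add_cancel h]
      exact Nat.le_add_right _ _
  rw [← abs_of_nonneg (Nat.cast_nonneg (α := ℤ) Λ), ← abs_mul,
    abs_of_nonneg (Nat.cast_nonneg (α := ℤ) Λ), abs_le] at diff
  rw [abs_le]
  zify at *
  constructor <;> linarith [diff.1, diff.2]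

theorem sumBelow_not_rankRight_le (hT : n ≤ T ∨ T = κ) :
    sumBelow (fun i => ¬ RankRight κ T a b i) s n ≤ tailLoad s n κ := by
  classical
  rw [sumBelow_eq_sum, tailLoad]
  refine sum_le_sum_of_subset fun i hi => ?_
  rw [mem_filter, mem_range, RankRight] at hi
  rw [mem_Ico]
  omega

theorem sumBelow_rankRight_le (hT : n ≤ T ∨ T = κ) :
    sumBelow (RankRight κ T a b) s n ≤ ∑ i ∈ range T, s i + tailLoad s n (2 * κ) := by
  classical
  rw [sumBelow_eq_sum, tailLoad]
  refine (sum_le_sum_of_subset (t := range T ∪ Ico (2 * κ) n) fun i hi => ?_).trans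
    (sum_union_inter (f := s) ▸ Nat.le_add_right _ _)
  rw [mem_filter, mem_range, RankRight] at hi
  rw [mem_union, mem_range, mem_Ico]
  omega

theorem sum_mirror_le_tailLoad (h0 : ∀ i, n ≤ i → s i = 0) (hT : T ≤ κ) :
    ∑ i ∈ range T, s (2 * κ - 1 - i) ≤ tailLoad s n κ := by
  have injective : Set.InjOn (fun i => 2 * κ - 1 - i) (range T : Set ℕ) := by
    intro i hi j hj hij
    simp only [coe_range, Set.mem_Iio] at hi hj hij
    omega
  rw [tailLoad_extend h0 (Nat.le_add_left n (2 * κ)), tailLoad, ← sum_image (f := s) injective]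
  refine sum_le_sum_of_subset fun i hi => ?_
  obtain ⟨j, hj, rfl⟩ := mem_image.1 hi
  rw [mem_range] at hj
  rw [mem_Ico]
  omega

/-- If all `κ` top ranks together do not make up for the lead of the first machine, then the second
machine gets the largest jobs. -/
theorem unbalanced_split (hs : Antitone s) (h0 : ∀ i, n ≤ i → s i = 0) {L₁ L₂ : ℕ}
    (unbalanced : ∑ i ∈ range (cutoff Λ κ n (L₁ - L₂) s), gain Λ κ n s i < Λ * (L₁ - L₂)) :
    L₁ + sumBelow (fun i => ¬ RankRight κ (cutoff Λ κ n (L₁ - L₂) s) a b i) s n ≤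
        L₁ + tailLoad s n κ ∧
      L₂ + sumBelow (RankRight κ (cutoff Λ κ n (L₁ - L₂) s) a b) s n ≤
        L₁ + tailLoad s n κ + tailLoad s n (2 * κ) := by
  set T := cutoff Λ κ n (L₁ - L₂) s
  have exhausted : n ≤ T ∨ T = κ := le_cutoff_or_cutoff_eq unbalanced
  have hT : T ≤ κ := cutoff_le
  obtain ⟨hΛ, hD⟩ : 0 < Λ ∧ 0 < L₁ - L₂ :=
    CanonicallyOrderedAdd.mul_pos.1 ((Nat.zero_le _).trans_lt unbalanced)
  refine ⟨Nat.add_le_add_left (sumBelow_not_rankRight_le exhausted) _, ?_⟩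
  have right_le := sumBelow_rankRight_le (a := a) (b := b) (s := s) exhausted
  have mirror_le := sum_mirror_le_tailLoad h0 hT
  have diff_le : ∑ i ∈ range T, ((s i : ℤ) - s (2 * κ - 1 - i)) ≤ (L₁ - L₂ : ℕ) := by
    refine le_of_mul_le_mul_left ((mul_sum_mirror_sub_le_sum_gain hs h0 hT).trans ?_)
      (Nat.cast_pos.2 hΛ)
    exact_mod_cast unbalanced.le
  rw [sum_sub_distrib] at diff_le
  have top_le : ∑ i ∈ range T, s i ≤ L₁ - L₂ + ∑ i ∈ range T, s (2 * κ - 1 - i) := by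
    zify
    linarith
  omega

end Split

/-! ### Inserting a job into a sorted sequence -/

theorem sum_le_of_gap {G : ℕ} (hG : 0 < G) (V : Finset ℕ)
    (hV : ∀ v ∈ V, ∀ w ∈ V, v < w → w ≤ G * (w - v)) {B : ℕ} (hB : ∀ v ∈ V, v ≤ B) :
    ∑ v ∈ V, v ≤ G * B := by
  induction V using Finset.induction_on_max generalizing B with
  | empty => simp
  | insert a V ha ih =>
    rw [sum_insert fun h => lt_irrefl _ (ha a h)]
    have haB := Nat.mul_le_mul_left G (hB a (mem_insert_self _ _))
    rcases V.eq_empty_or_nonempty with rfl | hne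
    · have := Nat.le_mul_of_pos_left a hG
      rw [sum_empty]
      omega
    · have sum_le := ih (fun v hv w hw => hV v (mem_insert_of_mem hv) w (mem_insert_of_mem hw))
        (B := V.max' hne) fun v hv => le_max' V v hv
      have hmax := max'_mem V hne
      have gap := hV _ (mem_insert_of_mem hmax) a (mem_insert_self _ _) (ha _ hmax)
      have telescope : G * (V.max' hne) + G * (a - V.max' hne) = G * a := by
        rw [← mul_add, Nat.add_sub_cancel' (ha _ hmax).le]
      omega

/-- The decreasing sequence `s'` arises from the decreasing sequence `s`, which vanishes from `n`
on, by inserting `x`. -/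
structure IsInsertion (s s' : ℕ → ℕ) (n x : ℕ) : Prop where
  anti : Antitone s
  anti' : Antitone s'
  eq_zero : ∀ i, n ≤ i → s i = 0
  eq_zero' : ∀ i, n + 1 ≤ i → s' i = 0
  head : s' 0 = max (s 0) x
  succ : ∀ i, s' (i + 1) = max (s (i + 1)) (min x (s i))

theorem isInsertion_orderStat {J : ℕ → Prop} (R : ℕ → ℕ) {n : ℕ} (hn : J n) :
    IsInsertion (orderStat J R n) (orderStat J R (n + 1)) n (R n) :=
  ⟨orderStat_anti, orderStat_anti, fun _ => orderStat_eq_zero, fun _ => orderStat_eq_zero,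
    orderStat_insert_zero hn, orderStat_insert_succ hn⟩

namespace IsInsertion

variable {s s' : ℕ → ℕ} {n x Λ κ D : ℕ}

theorem le (h : IsInsertion s s' n x) (i : ℕ) : s i ≤ s' i := by
  cases i with
  | zero => rw [h.head]; exact le_max_left _ _
  | succ i => rw [h.succ]; exact le_max_left _ _

theorem le_of_lt (h : IsInsertion s s' n x) {i : ℕ} (hi : s i < s' i) : s' i ≤ x := by
  cases i with
  | zero => rw [h.head] at *; omega
  | succ i => rw [h.succ] at *; omega

theorem last_le (h : IsInsertion s s' n x) : s' n ≤ x := by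
  have := h.le_of_lt (i := n)
  have := h.eq_zero n le_rfl
  omega

theorem sum_add_min (h : IsInsertion s s' n x) (t : ℕ) :
    ∑ i ∈ range (t + 1), s' i + min x (s t) = ∑ i ∈ range (t + 1), s i + x := by
  induction t with
  | zero =>
    simp only [zero_add, sum_range_one, h.head]
    omega
  | succ t ih =>
    rw [sum_range_succ, sum_range_succ _ (t + 1), h.succ]
    have : s (t + 1) ≤ s t := h.anti (Nat.le_succ t)
    omega

theorem sum_sub_le (h : IsInsertion s s' n x) (A : Finset ℕ) : ∑ i ∈ A, (s' i - s i) ≤ x := by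
  obtain ⟨m, hm⟩ := A.exists_nat_subset_range
  refine (sum_le_sum_of_subset (hm.trans (range_subset_range.2 (show m ≤ m + 1 by omega)))).trans ?_
  have total := h.sum_add_min m
  have sub_add : ∑ i ∈ range (m + 1), (s' i - s i) + ∑ i ∈ range (m + 1), s i =
      ∑ i ∈ range (m + 1), s' i := by
    rw [← sum_add_distrib]
    exact sum_congr rfl fun i _ => Nat.sub_add_cancel (h.le i)
  omega

theorem gain_le (h : IsInsertion s s' n x) (i : ℕ) :
    gain Λ κ (n + 1) s' i ≤ gain Λ κ n s i + (Λ + 1) * (s' i - s i) := by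
  rw [gain_eq h.eq_zero, gain_eq h.eq_zero', ← Nat.add_min_add_right]
  have mirror_le := h.le (2 * κ - 1 - i)
  refine min_le_min ?_ ?_
  · calc Λ * s' i = Λ * s i + Λ * (s' i - s i) := by rw [← mul_add, Nat.add_sub_cancel' (h.le i)]
      _ ≤ _ := by gcongr; omega
  · rw [← mul_add]
    gcongr
    omega

theorem le_gain (h : IsInsertion s s' n x) (i : ℕ) : gain Λ κ n s i ≤
    gain Λ κ (n + 1) s' i + (Λ + 1) * (s' (2 * κ - 1 - i) - s (2 * κ - 1 - i)) := by
  rw [gain_eq h.eq_zero, gain_eq h.eq_zero', ← Nat.add_min_add_right]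
  have rank_le := h.le i
  refine min_le_min ?_ ?_
  · exact (Nat.mul_le_mul_left _ rank_le).trans (Nat.le_add_right _ _)
  · rw [← mul_add]
    gcongr
    omega

theorem sum_gain_le (h : IsInsertion s s' n x) (t : ℕ) :
    ∑ i ∈ range t, gain Λ κ (n + 1) s' i ≤ ∑ i ∈ range t, gain Λ κ n s i + (Λ + 1) * x := by
  refine (sum_le_sum fun i _ => h.gain_le i).trans ?_
  rw [sum_add_distrib, ← mul_sum]
  gcongr
  exact h.sum_sub_le _

theorem le_sum_gain (h : IsInsertion s s' n x) {t : ℕ} (ht : t ≤ κ) :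
    ∑ i ∈ range t, gain Λ κ n s i ≤ ∑ i ∈ range t, gain Λ κ (n + 1) s' i + (Λ + 1) * x := by
  have injective : Set.InjOn (fun i => 2 * κ - 1 - i) (range t : Set ℕ) := by
    intro i hi j hj hij
    simp only [coe_range, Set.mem_Iio] at hi hj hij
    omega
  refine (sum_le_sum fun i _ => h.le_gain i).trans ?_
  rw [sum_add_distrib, ← mul_sum, ← sum_image (f := fun i => s' i - s i) injective]
  gcongr
  exact h.sum_sub_le _

theorem lt_of_gain_lt (h : IsInsertion s s' n x) {i : ℕ}
    (hi : gain Λ κ n s i < gain Λ κ (n + 1) s' i) : s i < s' i := by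
  by_contra hle
  have := h.gain_le (Λ := Λ) (κ := κ) i
  rw [Nat.sub_eq_zero_of_le (not_lt.1 hle), mul_zero] at this
  omega

theorem le_of_gain_lt (h : IsInsertion s s' n x) {i : ℕ}
    (hi : gain Λ κ (n + 1) s' i < gain Λ κ n s i) : s' i ≤ (Λ + 1) * x := by
  have le_gain := h.le_gain (Λ := Λ) (κ := κ) i
  rw [gain_eq h.eq_zero, gain_eq h.eq_zero'] at hi le_gain
  have mirror_le : s' (2 * κ - 1 - i) ≤ x := by
    refine h.le_of_lt (lt_of_not_ge fun hge => ?_)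
    rw [Nat.sub_eq_zero_of_le hge, mul_zero] at le_gain
    omega
  have min_right : (Λ + 1) * (s' i - s' (2 * κ - 1 - i)) ≤ Λ * s' i := by
    have := Nat.mul_le_mul_left Λ (h.le i)
    omega
  have expand : (Λ + 1) * s' i ≤ (Λ + 1) * (s' i - s' (2 * κ - 1 - i)) +
      (Λ + 1) * s' (2 * κ - 1 - i) := by
    rw [← mul_add]
    gcongr
    omega
  have := Nat.mul_le_mul_left (Λ + 1) mirror_le
  have : (Λ + 1) * s' i = Λ * s' i + s' i := by ring
  omega

theorem sum_gain_Ico_le_of_cutoff_lt (h : IsInsertion s s' n x)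
    (hlt : cutoff Λ κ n D s < cutoff Λ κ (n + 1) D s') :
    ∑ i ∈ Ico (cutoff Λ κ n D s) (cutoff Λ κ (n + 1) D s'), gain Λ κ (n + 1) s' i ≤
      (Λ + 1) * (Λ + 1) * x := by
  obtain ⟨m, hm⟩ : ∃ m, cutoff Λ κ (n + 1) D s' = m + 1 :=
    ⟨cutoff Λ κ (n + 1) D s' - 1, by omega⟩
  obtain ⟨hmn, hmκ, before⟩ := lt_cutoff_iff.1 (show m < cutoff Λ κ (n + 1) D s' by omega)
  set T := cutoff Λ κ n D s with hT
  have hTκ : T ≤ κ := cutoff_le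
  have gain_last : gain Λ κ (n + 1) s' m ≤ Λ * s' m := min_le_left _ _
  suffices ∑ i ∈ Ico T m, gain Λ κ (n + 1) s' i ≤ (Λ + 1) * x ∧ s' m ≤ (Λ + 1) * x by
    rw [hm, sum_Ico_succ_top (by omega)]
    calc _ ≤ (Λ + 1) * x + Λ * ((Λ + 1) * x) :=
          add_le_add this.1 (gain_last.trans (Nat.mul_le_mul_left _ this.2))
      _ = (Λ + 1) * (Λ + 1) * x := by ring
  rcases Nat.lt_or_ge T n with hn | hn
  · have reached : Λ * D ≤ ∑ i ∈ range T, gain Λ κ n s i := by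
      by_contra hcon
      exact (lt_cutoff_iff.2 ⟨hn, by omega, not_le.1 hcon⟩).ne hT
    have split := sum_range_add_sum_Ico (gain Λ κ (n + 1) s') (show T ≤ m by omega)
    have := h.le_sum_gain (Λ := Λ) hTκ
    refine ⟨by omega, ?_⟩
    obtain ⟨i, hi, hgain⟩ : ∃ i ∈ range T, gain Λ κ (n + 1) s' i < gain Λ κ n s i :=
      exists_lt_of_sum_lt (by omega)
    rw [mem_range] at hi
    exact (h.anti' (by omega)).trans (h.le_of_gain_lt hgain)
  · have last : T = m := by omega
    have last' : m = n := by omega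
    rw [last, last', Ico_self, sum_empty]
    exact ⟨Nat.zero_le _, h.last_le.trans (Nat.le_mul_of_pos_left x Λ.succ_pos)⟩

theorem sum_gain_Ico_le_of_lt_cutoff (h : IsInsertion s s' n x)
    (hlt : cutoff Λ κ (n + 1) D s' < cutoff Λ κ n D s) :
    ∑ i ∈ Ico (cutoff Λ κ (n + 1) D s') (cutoff Λ κ n D s), gain Λ κ (n + 1) s' i ≤
      (Λ + 1) * (Λ + 1) * x := by
  obtain ⟨m, hm⟩ : ∃ m, cutoff Λ κ n D s = m + 1 := ⟨cutoff Λ κ n D s - 1, by omega⟩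
  obtain ⟨hmn, hmκ, before⟩ := lt_cutoff_iff.1 (show m < cutoff Λ κ n D s by omega)
  set T' := cutoff Λ κ (n + 1) D s' with hT'
  have reached : Λ * D ≤ ∑ i ∈ range T', gain Λ κ (n + 1) s' i := by
    by_contra hcon
    exact (lt_cutoff_iff.2 ⟨by omega, by omega, not_le.1 hcon⟩).ne hT'
  have le_before : ∑ i ∈ range T', gain Λ κ n s i ≤ ∑ i ∈ range m, gain Λ κ n s i :=
    sum_le_sum_of_subset (range_subset_range.2 (by omega))
  obtain ⟨i, hi, hgain⟩ : ∃ i ∈ range T', gain Λ κ n s i < gain Λ κ (n + 1) s' i :=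
    exists_lt_of_sum_lt (by omega)
  have increased := h.lt_of_gain_lt hgain
  rw [mem_range] at hi
  have last_le : s m ≤ x := (h.anti (by omega)).trans (increased.le.trans (h.le_of_lt increased))
  have gain_last : gain Λ κ n s m ≤ Λ * x := (min_le_left _ _).trans (Nat.mul_le_mul_left _ last_le)
  have split := sum_range_add_sum_Ico (gain Λ κ (n + 1) s') hlt.le
  have le_old := h.sum_gain_le (Λ := Λ) (κ := κ) (m + 1)
  rw [sum_range_succ (gain Λ κ n s)] at le_old
  calc ∑ i ∈ Ico T' (cutoff Λ κ n D s), gain Λ κ (n + 1) s' i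
      ≤ Λ * x + (Λ + 1) * x := by
        rw [hm] at split ⊢
        omega
    _ ≤ Λ * ((Λ + 1) * x) + (Λ + 1) * x := by
        gcongr
        exact Nat.le_mul_of_pos_left x Λ.succ_pos
    _ = (Λ + 1) * (Λ + 1) * x := by ring

theorem sum_gain_cutoff_le (h : IsInsertion s s' n x) :
    ∑ i ∈ Ico (min (cutoff Λ κ n D s) (cutoff Λ κ (n + 1) D s'))
        (max (cutoff Λ κ n D s) (cutoff Λ κ (n + 1) D s')), gain Λ κ (n + 1) s' i ≤
      (Λ + 1) * (Λ + 1) * x := by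
  rcases lt_trichotomy (cutoff Λ κ n D s) (cutoff Λ κ (n + 1) D s') with hlt | heq | hgt
  · rw [min_eq_left hlt.le, max_eq_right hlt.le]
    exact h.sum_gain_Ico_le_of_cutoff_lt hlt
  · rw [heq, min_self, max_self, Ico_self, sum_empty]
    exact Nat.zero_le _
  · rw [min_eq_right hgt.le, max_eq_left hgt.le]
    exact h.sum_gain_Ico_le_of_lt_cutoff hgt

end IsInsertion

section OrderStat

variable {J : ℕ → Prop} {R : ℕ → ℕ} {n : ℕ}

theorem countBelow_le_orderStat_and (P : ℕ → Prop) {v : ℕ} (hv : 0 < v) :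
    countBelow (fun i => v ≤ orderStat J R n i ∧ P i) n = countBelow P (countGe J R n v) := by
  classical
  rw [countBelow_eq_card, countBelow_eq_card]
  congr 1
  ext i
  simp only [mem_filter, mem_range, le_orderStat_iff hv]
  have : countGe J R n v ≤ n := countBelow_le _ _
  exact ⟨fun h => h.2, fun h => ⟨h.1.trans_le this, h⟩⟩

theorem countBelow_orderStat_eq_and (P : ℕ → Prop) {v : ℕ} (hv : 0 < v) :
    countBelow (fun i => orderStat J R n i = v ∧ P i) n + countBelow P (countGe J R n (v + 1)) =
      countBelow P (countGe J R n v) := by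
  classical
  have split := card_le_eq_card_eq_add_card_succ_le {i ∈ range n | P i} (orderStat J R n) v
  have eq_comm_and : ∀ i, P i ∧ orderStat J R n i = v ↔ orderStat J R n i = v ∧ P i :=
    fun i => and_comm
  have le_comm_and (w : ℕ) : ∀ i, P i ∧ w ≤ orderStat J R n i ↔ w ≤ orderStat J R n i ∧ P i :=
    fun i => and_comm
  simp only [filter_filter, eq_comm_and, le_comm_and] at split
  rw [← countBelow_le_orderStat_and P hv, ← countBelow_le_orderStat_and P v.succ_pos,
    countBelow_eq_card, countBelow_eq_card, countBelow_eq_card]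
  exact split.symm

open scoped Classical in
theorem dist_countBelow_orderStat_insert_le (P : ℕ → Prop) {v : ℕ} (hv : 0 < v) (hn : J n) :
    Nat.dist (countBelow (fun i => orderStat J R n i = v ∧ P i) n)
      (countBelow (fun i => orderStat J R (n + 1) i = v ∧ P i) (n + 1)) ≤
      if v ∈ (range (n + 1)).image R ∧ v ≤ R n then 1 else 0 := by
  have old := countBelow_orderStat_eq_and (J := J) (R := R) (n := n) P hv
  have new := countBelow_orderStat_eq_and (J := J) (R := R) (n := n + 1) P hv
  have mono : countBelow P (countGe J R n (v + 1)) ≤ countBelow P (countGe J R n v) :=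
    countBelow_mono (countGe_anti v.le_succ)
  have succ_ge := countBelow_succ P (countGe J R n v)
  have succ_gt := countBelow_succ P (countGe J R n (v + 1))
  rw [countGe_succ, countGe_succ] at new
  simp only [hn, true_and] at new
  rw [Nat.dist]
  rcases lt_or_ge (R n) v with small | large
  · rw [if_neg (by omega), if_neg (by omega), add_zero, add_zero] at new
    omega
  by_cases present : v ∈ (range (n + 1)).image R
  · rw [if_pos ⟨present, large⟩]
    rw [if_pos large] at new
    by_cases larger : v + 1 ≤ R n
    · rw [if_pos larger] at new
      split_ifs at succ_ge succ_gt <;> omega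
    · rw [if_neg larger, add_zero] at new
      split_ifs at succ_ge <;> omega
  · have absent : ∀ j ≤ n, R j ≠ v := fun j hj hjv =>
      present (mem_image.2 ⟨j, mem_range.2 (Nat.lt_succ_of_le hj), hjv⟩)
    have larger : v + 1 ≤ R n := lt_of_le_of_ne large (absent n le_rfl).symm
    have no_gap : countGe J R n v = countGe J R n (v + 1) := countBelow_congr fun j hj =>
      and_congr_right fun _ => ⟨fun h => lt_of_le_of_ne h (absent j hj.le).symm, Nat.le_of_succ_le⟩
    rw [if_pos larger, if_pos large, no_gap] at new
    rw [no_gap] at old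
    omega

theorem exists_orderStat_eq {i : ℕ} (hi : orderStat J R n i ≠ 0) :
    ∃ j < n, R j = orderStat J R n i := by
  classical
  have hin : i < n := not_le.1 fun h => hi (orderStat_eq_zero h)
  have occurs : 0 < #{i' ∈ range n | orderStat J R n i' = orderStat J R n i} :=
    card_pos.2 ⟨i, mem_filter.2 ⟨mem_range.2 hin, rfl⟩⟩
  rw [card_orderStat_eq (Nat.pos_of_ne_zero hi), card_pos] at occurs
  obtain ⟨j, hj⟩ := occurs
  rw [mem_filter, mem_range] at hj
  exact ⟨j, hj.1, hj.2.2⟩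

theorem sum_mul_dist_orderStat_insert_le (P : ℕ → Prop) (hn : J n) {G : ℕ} (hG : 0 < G)
    (gap : ∀ i ≤ n, ∀ j ≤ n, R i < R j → R j ≤ G * (R j - R i)) (B : ℕ) :
    ∑ v ∈ Icc 1 B, v * Nat.dist (countBelow (fun i => orderStat J R n i = v ∧ P i) n)
      (countBelow (fun i => orderStat J R (n + 1) i = v ∧ P i) (n + 1)) ≤ G * R n := by
  classical
  calc _ ≤ ∑ v ∈ Icc 1 B, v * (if v ∈ (range (n + 1)).image R ∧ v ≤ R n then 1 else 0) :=
        sum_le_sum fun v hv => Nat.mul_le_mul_left _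
          (dist_countBelow_orderStat_insert_le P (mem_Icc.1 hv).1 hn)
    _ = ∑ v ∈ Icc 1 B with v ∈ (range (n + 1)).image R ∧ v ≤ R n, v := by
        rw [sum_filter]
        exact sum_congr rfl fun v _ => by split_ifs <;> simp
    _ ≤ G * R n := by
        refine sum_le_of_gap hG _ (fun v hv w hw hvw => ?_) fun v hv => (mem_filter.1 hv).2.2
        obtain ⟨i, hi, rfl⟩ := mem_image.1 (mem_filter.1 hv).2.1
        obtain ⟨j, hj, rfl⟩ := mem_image.1 (mem_filter.1 hw).2.1
        exact gap i (Nat.lt_succ_iff.1 (mem_range.1 hi)) j (Nat.lt_succ_iff.1 (mem_range.1 hj)) hvw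

theorem orderStat_gap {G : ℕ} (hG : 0 < G)
    (gap : ∀ i < n, ∀ j < n, R i < R j → R j ≤ G * (R j - R i)) {i l : ℕ}
    (hlt : orderStat J R n l < orderStat J R n i) :
    orderStat J R n i ≤ G * (orderStat J R n i - orderStat J R n l) := by
  rcases Nat.eq_zero_or_pos (orderStat J R n l) with h0 | h0
  · rw [h0]
    exact Nat.le_mul_of_pos_left _ hG
  · obtain ⟨j, hj, hji⟩ := exists_orderStat_eq (J := J) (R := R) (n := n) (i := i) (by omega)
    obtain ⟨m, hm, hml⟩ := exists_orderStat_eq h0.ne'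
    rw [← hji, ← hml] at hlt ⊢
    exact gap m hm j hj hlt

end OrderStat

section Quota

variable {s : ℕ → ℕ} {n κ T T' a b : ℕ}

open scoped Classical in
theorem quota_eq_sum (h0 : ∀ i, n ≤ i → s i = 0) {m v : ℕ} (hm : n ≤ m) (hv : 0 < v) :
    (quota κ T a b n s v : ℤ) = ∑ i ∈ range m,
      (if s i = v then 1 else 0) * (if RankRight κ T a b i then 1 else 0) := by
  rw [quota, countBelow_eq_card, natCast_card_filter]
  simp only [ite_zero_mul_ite_zero, mul_one]
  refine sum_subset (range_subset_range.2 hm) fun i _ hi => if_neg fun h => ?_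
  rw [h0 i (by simpa using hi)] at h
  exact hv.ne h.1

theorem rankRight_congr_of_notMem_Ico {i : ℕ} (hT : T ≤ κ) (hT' : T' ≤ κ)
    (hi : i ∉ Ico (min T T') (max T T')) (hi' : i < κ ∨ 2 * κ ≤ i) :
    RankRight κ T a b i ↔ RankRight κ T' a b i := by
  rw [mem_Ico] at hi
  rw [RankRight, RankRight]
  omega

open scoped Classical in
theorem quota_sub_quota (h0 : ∀ i, n ≤ i → s i = 0) (hT : T ≤ κ) (hT' : T' ≤ κ) {v : ℕ}
    (hv : 0 < v) : (quota κ T a b n s v : ℤ) - quota κ T' a b n s v =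
      ∑ i ∈ range κ, ((if RankRight κ T a b i then 1 else 0) -
        (if RankRight κ T' a b i then 1 else 0)) *
        ((if s i = v then 1 else 0) - (if s (2 * κ - 1 - i) = v then 1 else 0)) := by
  have hm : n ≤ n + 2 * κ := Nat.le_add_right _ _
  rw [quota_eq_sum h0 hm hv, quota_eq_sum h0 hm hv, ← sum_sub_distrib,
    ← sum_subset (range_subset_range.2 (show 2 * κ ≤ n + 2 * κ by omega)),
    sum_range_two_mul_mirror]
  · refine sum_congr rfl fun i hi => ?_
    rw [mem_range] at hi
    have mirror := rankRight_mirror (a := a) (b := b) hT hi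
    have mirror' := rankRight_mirror (a := a) (b := b) hT' hi
    by_cases right : RankRight κ T a b i <;> by_cases right' : RankRight κ T' a b i <;>
      simp [mirror, mirror', right, right'] <;> ring
  · intro i _ hi
    rw [mem_range, not_lt] at hi
    have : RankRight κ T a b i ↔ RankRight κ T' a b i :=
      rankRight_congr_of_notMem_Ico hT hT' (by rw [mem_Ico]; omega) (Or.inr hi)
    simp only [this, sub_self]

theorem abs_indicator_sub_mul_le (p q : Prop) [Decidable p] [Decidable q] (x y v : ℕ) :
    |((if p then (1 : ℤ) else 0) - (if q then 1 else 0)) *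
      ((if x = v then 1 else 0) - (if y = v then 1 else 0))| ≤
      if x = y then 0 else (if x = v then 1 else 0) + (if y = v then 1 else 0) := by
  rw [abs_mul]
  by_cases h : x = y
  · rw [h, sub_self, abs_zero, mul_zero, if_pos rfl]
  · have factor_le_one : |(if p then (1 : ℤ) else 0) - (if q then 1 else 0)| ≤ 1 := by
      split_ifs <;> norm_num
    rw [if_neg h]
    refine (mul_le_of_le_one_left (abs_nonneg _) factor_le_one).trans ?_
    split_ifs <;> norm_num

theorem dist_quota_le (h0 : ∀ i, n ≤ i → s i = 0) (hT : T ≤ κ) (hT' : T' ≤ κ) {v : ℕ}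
    (hv : 0 < v) : Nat.dist (quota κ T a b n s v) (quota κ T' a b n s v) ≤
      ∑ i ∈ Ico (min T T') (max T T'), if s i = s (2 * κ - 1 - i) then 0 else
        (if s i = v then 1 else 0) + (if s (2 * κ - 1 - i) = v then 1 else 0) := by
  classical
  have dist_eq : (Nat.dist (quota κ T a b n s v) (quota κ T' a b n s v) : ℤ) =
      |(quota κ T a b n s v : ℤ) - quota κ T' a b n s v| := by
    rw [abs_eq_max_neg, Nat.dist]
    omega
  zify
  rw [dist_eq, quota_sub_quota h0 hT hT' hv]
  refine (abs_sum_le_sum_abs _ _).trans ?_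
  rw [← sum_subset (s₁ := Ico (min T T') (max T T'))]
  · simp only [Nat.cast_inj]
    exact sum_le_sum fun i _ => abs_indicator_sub_mul_le _ _ _ _ _
  · intro i hi
    rw [mem_Ico] at hi
    rw [mem_range]
    omega
  · intro i hi hi'
    have := rankRight_congr_of_notMem_Ico (a := a) (b := b) hT hT' hi' (Or.inl (mem_range.1 hi))
    simp only [this, sub_self, zero_mul, abs_zero]

theorem sum_mul_dist_quota_le (hs : Antitone s) (h0 : ∀ i, n ≤ i → s i = 0) (hT : T ≤ κ)
    (hT' : T' ≤ κ) (B : ℕ) :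
    ∑ v ∈ Icc 1 B, v * Nat.dist (quota κ T a b n s v) (quota κ T' a b n s v) ≤
      ∑ i ∈ Ico (min T T') (max T T'), if s i = s (2 * κ - 1 - i) then 0 else 2 * s i := by
  refine (sum_le_sum fun v hv =>
    Nat.mul_le_mul_left v (dist_quota_le h0 hT hT' (mem_Icc.1 hv).1)).trans ?_
  simp only [mul_sum]
  rw [sum_comm]
  refine sum_le_sum fun i hi => ?_
  have mirror_le : s (2 * κ - 1 - i) ≤ s i := by
    rw [mem_Ico] at hi
    exact hs (by omega)
  have sum_indicator : ∀ w, ∑ v ∈ Icc 1 B, v * (if w = v then 1 else 0) ≤ w := by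
    intro w
    simp only [mul_ite, mul_one, mul_zero, sum_ite_eq]
    split_ifs <;> omega
  split_ifs with h
  · simp
  · simp only [mul_add, sum_add_distrib]
    calc _ ≤ s i + s (2 * κ - 1 - i) :=
          add_le_add (sum_indicator (s i)) (sum_indicator (s (2 * κ - 1 - i)))
      _ ≤ 2 * s i := by omega

theorem mul_ite_le_mul_gain (h0 : ∀ i, n ≤ i → s i = 0) {Λ G i : ℕ} (hG : 0 < G)
    (gap : s i ≠ s (2 * κ - 1 - i) → s i ≤ G * (s i - s (2 * κ - 1 - i))) :
    Λ * (if s i = s (2 * κ - 1 - i) then 0 else 2 * s i) ≤ 2 * G * gain Λ κ n s i := by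
  split_ifs with h
  · simp
  rw [gain_eq h0, mul_min_of_nonneg _ _ (Nat.zero_le _)]
  refine le_min ?_ ?_
  · calc Λ * (2 * s i) = 1 * (2 * (Λ * s i)) := by ring
      _ ≤ G * (2 * (Λ * s i)) := Nat.mul_le_mul_right _ hG
      _ = 2 * G * (Λ * s i) := by ring
  · calc Λ * (2 * s i)
        ≤ (Λ + 1) * (2 * (G * (s i - s (2 * κ - 1 - i)))) :=
          Nat.mul_le_mul Λ.le_succ (Nat.mul_le_mul_left 2 (gap h))
      _ = 2 * G * ((Λ + 1) * (s i - s (2 * κ - 1 - i))) := by ring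

theorem IsInsertion.mul_sum_mul_dist_quota_cutoff_le {s' : ℕ → ℕ} {x Λ D G : ℕ}
    (h : IsInsertion s s' n x) (hG : 0 < G)
    (gap : ∀ i l, s' l < s' i → s' i ≤ G * (s' i - s' l)) (B : ℕ) :
    Λ * ∑ v ∈ Icc 1 B, v * Nat.dist (quota κ (cutoff Λ κ n D s) a b (n + 1) s' v)
        (quota κ (cutoff Λ κ (n + 1) D s') a b (n + 1) s' v) ≤
      2 * G * ((Λ + 1) * (Λ + 1) * x) := by
  have hT : cutoff Λ κ n D s ≤ κ := cutoff_le
  have hT' : cutoff Λ κ (n + 1) D s' ≤ κ := cutoff_le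
  refine (Nat.mul_le_mul_left Λ (sum_mul_dist_quota_le h.anti' h.eq_zero' hT hT' B)).trans ?_
  refine le_trans ?_
    (Nat.mul_le_mul_left (2 * G) (h.sum_gain_cutoff_le (Λ := Λ) (κ := κ) (D := D)))
  rw [mul_sum, mul_sum]
  refine sum_le_sum fun i hi => mul_ite_le_mul_gain h.eq_zero' hG fun hne => gap i _ ?_
  rw [mem_Ico] at hi
  exact lt_of_le_of_ne (h.anti' (by omega)) hne.symm

end Quota

/-! ### The algorithm -/

/-- Total size of the first `t` jobs. -/
def prefixLoad (R : ℕ → ℕ) (t : ℕ) : ℕ := ∑ i ∈ range t, R i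

/-- The data that determine the schedules between two fresh starts: the accuracy `N`, the bound `k`
on the number of jobs per machine, the number `t` of jobs at the last fresh start, and the job sizes
`R`. Of the first `t` jobs, those whose size is at least their total size divided by `Δ` are big. -/
structure Phase where
  N : ℕ
  k : ℕ
  Δ : ℕ
  t : ℕ
  R : ℕ → ℕ

namespace Phase

variable (S : Phase)

/-- The jobs that stay on their machine until the next fresh start. -/
def IsBig (j : ℕ) : Prop := j < S.t ∧ prefixLoad S.R S.t ≤ S.Δ * S.R j

open scoped Classical in
/-- The big jobs below `m`. -/
noncomputable def bigJobs (m : ℕ) : Finset ℕ := {j ∈ range m | S.IsBig j}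

/-- Number of units of the dynamic program that make up the total size of the first `t` jobs. -/
def resolution : ℕ := 64 * S.N * (S.t + 1)

/-- Size of a job in units of the dynamic program, rounded down. -/
def weight (j : ℕ) : ℕ := min S.resolution (S.R j * S.resolution / prefixLoad S.R S.t)

/-- The weight of a job, with a lower digit that counts jobs when codes are added up. -/
def code (j : ℕ) : ℕ := S.weight j * (S.t + 1) + 1

open scoped Classical in
/-- Generating function of the codes of sets of big jobs below `m`, at `2 ^ (t + 1)`: this base is
so large that the coefficients can be read off as digits. -/
noncomputable def genFun (m : ℕ) : ℕ :=
  ∏ j ∈ range m, if S.IsBig j then 1 + (2 ^ (S.t + 1)) ^ S.code j else 1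

/-- Some set of big jobs below `m` has total code `v`. -/
def Reach (m v : ℕ) : Prop := 0 < S.genFun m / (2 ^ (S.t + 1)) ^ v % 2 ^ (S.t + 1)

/-- `v` is the code of the heavier side of a feasible partition of the big jobs. -/
def GoodCode (v : ℕ) : Prop :=
  S.Reach S.t v ∧ v % (S.t + 1) ≤ S.k ∧ #(S.bigJobs S.t) ≤ S.k + v % (S.t + 1) ∧
    ∑ j ∈ S.bigJobs S.t, S.weight j ≤ 2 * (v / (S.t + 1))

/-- A strict upper bound on the codes of sets of big jobs. -/
def codeBound : ℕ := (S.t * S.resolution + 1) * (S.t + 1)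

/-- The least good code. -/
noncomputable def bestCode : ℕ :=
  countBelow (fun v => ¬∃ w < S.codeBound, w ≤ v ∧ S.GoodCode w) S.codeBound

open scoped Classical in
/-- What remains of the best code after the decisions for the last `i` jobs. -/
noncomputable def residual : ℕ → ℕ
  | 0 => S.bestCode
  | i + 1 => residual i - if S.Reach (S.t - 1 - i) (residual i) then 0 else S.code (S.t - 1 - i)

/-- The big jobs on the first machine: a job is put there if the remaining code cannot be reached
without it. -/
def IsHeavy (j : ℕ) : Prop := S.IsBig j ∧ ¬S.Reach j (S.residual (S.t - 1 - j))

open scoped Classical in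
/-- The set of big jobs on the first machine. -/
noncomputable def heavyJobs : Finset ℕ := {j ∈ range S.t | S.IsHeavy j}

open scoped Classical in
/-- The set of big jobs on the second machine. -/
noncomputable def lightJobs : Finset ℕ := {j ∈ range S.t | S.IsBig j ∧ ¬S.IsHeavy j}

/-- Total size of the big jobs on the first machine. -/
noncomputable def heavyLoad : ℕ := ∑ j ∈ S.heavyJobs, S.R j

/-- Total size of the big jobs on the second machine. -/
noncomputable def lightLoad : ℕ := ∑ j ∈ S.lightJobs, S.R j

/-- Number of small jobs that fit on either machine. -/
noncomputable def capacity : ℕ := S.k - max #S.heavyJobs #S.lightJobs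

/-- Sizes of the small jobs below `n` in decreasing order. -/
noncomputable def smallStat (n : ℕ) : ℕ → ℕ := orderStat (fun j => ¬S.IsBig j) S.R n

/-- Number of largest small jobs that make up for the smaller load of the second machine. -/
noncomputable def lead (n : ℕ) : ℕ :=
  cutoff (64 * S.N) S.capacity n (S.heavyLoad - S.lightLoad) (S.smallStat n)

/-- Number of small jobs of size `v` on the second machine. -/
noncomputable def rightQuota (n v : ℕ) : ℕ :=
  quota S.capacity (S.lead n) #S.heavyJobs #S.lightJobs n (S.smallStat n) v

/-- Job `j` is on the second machine after the release of `n` jobs. -/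
def RightAt (n j : ℕ) : Prop :=
  (S.IsBig j ∧ ¬S.IsHeavy j) ∨
    (¬S.IsBig j ∧ Chosen (fun i => ¬S.IsBig i) S.R (S.rightQuota n) j)

end Phase

/-- The number `Δ` of a phase. For small `k` it is so large that the small jobs are negligible in
total; otherwise the big jobs are so few that they take up a negligible part of the capacities. -/
def granularity (N k : ℕ) : ℕ := if k ≤ 8192 * (N * N) then 1048576 * (N * N * N) else 64 * N

/-- The release of job `u` makes the algorithm start afresh. -/
def Renews (Δ : ℕ) (R : ℕ → ℕ) (u : ℕ) : Prop := prefixLoad R (u + 1) ≤ Δ * R u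

/-- Number of jobs at the last fresh start. -/
noncomputable def epoch (Δ : ℕ) (R : ℕ → ℕ) (n : ℕ) : ℕ :=
  countBelow (fun t => ∃ u < n, t ≤ u ∧ Renews Δ R u) n

/-- The phase to which the schedule of the first `n` jobs belongs. -/
noncomputable def currentPhase (N k : ℕ) (R : ℕ → ℕ) (n : ℕ) : Phase where
  N := N
  k := k
  Δ := granularity N k
  t := epoch (granularity N k) R n
  R := R

/-- Significant digits of the size of job `j`: the size divided by a power of two and multiplied by
`8 * N`, rounded down. -/
def mantissa (I : Input) (j : ℕ) : ℕ :=
  8 * I.N * I.num j * 2 ^ Nat.size (I.den j) / (I.den j * 2 ^ Nat.size (I.num j))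

/-- The binary exponent that goes with `mantissa` when all sizes are scaled to integers. -/
def exponent (I : Input) (j : ℕ) : ℕ :=
  Nat.size (I.num j) + (∑ i ∈ range I.n, Nat.size (I.den i) - Nat.size (I.den j))

/-- Job sizes rounded down to few significant binary digits and scaled to integers. -/
def rounded (I : Input) (j : ℕ) : ℕ := mantissa I j * 2 ^ exponent I j

open scoped Classical in
/-- The machine of job `j`. An arbitrary feasible schedule will do if `N ≤ 1`. -/
noncomputable def machine (I : Input) (j : ℕ) : ℕ :=
  if I.N ≤ 1 then (if I.k ≤ j then 1 else 0)
  else if (currentPhase I.N I.k (rounded I) I.n).RightAt I.n j then 1 else 0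

/-! ### The algorithm runs in polynomial time -/

section

variable {γ : Growth} {P : Input → ℕ → List ℕ → Prop} {f : Input → ℕ → List ℕ → ℕ} {g : InputFun}

theorem polyTime_sum_filter {d : ∀ I i e, Decidable (P I i e)} (hg : PolyTime .value g)
    (hP : PolyTimePred fun I e => P I e.headI e.tail)
    (hf : PolyTime γ fun I e => f I e.headI e.tail) :
    PolyTime γ fun I e => ∑ i ∈ range (g I e) with P I i e, f I i e := by
  simp only [sum_filter]
  exact .sum hg (hP.ite hf (.const 0))

theorem polyTime_card_filter {d : ∀ I i e, Decidable (P I i e)} (hg : PolyTime .value g)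
    (hP : PolyTimePred fun I e => P I e.headI e.tail) :
    PolyTime .value fun I e => #{i ∈ range (g I e) | P I i e} := by
  simp only [card_eq_sum_ones]
  exact polyTime_sum_filter hg hP (.const 1)

theorem polyTime_countBelow (hg : PolyTime .value g)
    (hP : PolyTimePred fun I e => P I e.headI e.tail) :
    PolyTime .value fun I e => countBelow (fun i => P I i e) (g I e) := by
  unfold countBelow
  exact polyTime_card_filter hg hP

end

/-- `R` can be evaluated in polynomial time at polynomially bounded indices. -/
abbrev PolyTimeSeq (R : Input → ℕ → ℕ) : Prop :=
  ∀ {a : InputFun}, PolyTime .value a → PolyTime .bits fun I e => R I (a I e)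

theorem polyTime_prefixLoad {R : Input → ℕ → ℕ} {a : InputFun} (hR : PolyTimeSeq R)
    (ha : PolyTime .value a) : PolyTime .bits fun I e => prefixLoad (R I) (a I e) := by
  unfold prefixLoad
  exact .sum ha (hR .head)

/-- The parameters of the phase can be computed in polynomial time. -/
structure PolyTimePhase (S : Input → Phase) : Prop where
  N : PolyTime .value fun I _ => (S I).N
  k : PolyTime .bits fun I _ => (S I).k
  Δ : PolyTime .bits fun I _ => (S I).Δ
  t : PolyTime .value fun I _ => (S I).t
  R : PolyTimeSeq fun I => (S I).R

namespace PolyTimePhase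

variable {S : Input → Phase} {a b : InputFun}

theorem isBig (hS : PolyTimePhase S) (ha : PolyTime .value a) :
    PolyTimePred fun I e => (S I).IsBig (a I e) := by
  unfold Phase.IsBig
  exact .and (.lt ha.bits hS.t.bits) (.le (polyTime_prefixLoad hS.R hS.t) (.mul hS.Δ (hS.R ha)))

theorem resolution (hS : PolyTimePhase S) : PolyTime .value fun I _ => (S I).resolution := by
  unfold Phase.resolution
  exact .mul (.mul (.const _) hS.N) (.add hS.t (.const _))

theorem weight (hS : PolyTimePhase S) (ha : PolyTime .value a) :
    PolyTime .value fun I e => (S I).weight (a I e) := by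
  unfold Phase.weight
  exact .min hS.resolution
    (.div (.mul (hS.R ha) hS.resolution.bits) (polyTime_prefixLoad hS.R hS.t))

theorem code (hS : PolyTimePhase S) (ha : PolyTime .value a) :
    PolyTime .value fun I e => (S I).code (a I e) := by
  unfold Phase.code
  exact .add (.mul (hS.weight ha) (.add hS.t (.const _))) (.const _)

theorem genFun (hS : PolyTimePhase S) (ha : PolyTime .value a) :
    PolyTime .bits fun I e => (S I).genFun (a I e) := by
  have base : PolyTime .bits fun I _ => 2 ^ ((S I).t + 1) := .pow (.const _) (.add hS.t (.const _))
  unfold Phase.genFun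
  exact .prod ha (PolyTimePred.ite (hS.isBig .head)
    (.add (.const _) (.pow base (hS.code .head))) (.const _))

theorem reach (hS : PolyTimePhase S) (ha : PolyTime .value a) (hb : PolyTime .value b) :
    PolyTimePred fun I e => (S I).Reach (a I e) (b I e) := by
  have base : PolyTime .bits fun I _ => 2 ^ ((S I).t + 1) := .pow (.const _) (.add hS.t (.const _))
  unfold Phase.Reach
  exact .lt (.const 0) (.mod (.div (hS.genFun ha) (.pow base hb)) base)

theorem goodCode (hS : PolyTimePhase S) (ha : PolyTime .value a) :
    PolyTimePred fun I e => (S I).GoodCode (a I e) := by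
  have modulus : PolyTime .bits fun I _ => (S I).t + 1 := (hS.t.add (.const _)).bits
  have count : PolyTime .bits fun I e => a I e % ((S I).t + 1) := .mod ha.bits modulus
  unfold Phase.GoodCode Phase.bigJobs
  exact .and (hS.reach hS.t ha) (.and (.le count hS.k) (.and
    (.le (polyTime_card_filter hS.t (hS.isBig .head)).bits (.add hS.k count))
    (.le (polyTime_sum_filter hS.t (hS.isBig .head) (hS.weight .head)).bits
      (.mul (.const _) (.div ha.bits modulus)))))

theorem codeBound (hS : PolyTimePhase S) : PolyTime .value fun I _ => (S I).codeBound := by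
  unfold Phase.codeBound
  exact .mul (.add (.mul hS.t hS.resolution) (.const _)) (.add hS.t (.const _))

theorem bestCode (hS : PolyTimePhase S) : PolyTime .value fun I _ => (S I).bestCode := by
  unfold Phase.bestCode
  exact polyTime_countBelow hS.codeBound (.not (.exists_lt hS.codeBound
    (.and (.le PolyTime.head.bits (PolyTime.tail .head).bits) (hS.goodCode .head))))

theorem residual (hS : PolyTimePhase S) (ha : PolyTime .value a) :
    PolyTime .value fun I e => (S I).residual (a I e) := by
  classical
  have residual_eq_rec (T : Phase) (i : ℕ) : T.residual i = Nat.rec T.bestCode (fun i acc =>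
      acc - if T.Reach (T.t - 1 - i) acc then 0 else T.code (T.t - 1 - i)) i := by
    induction i with
    | zero => rfl
    | succ i ih => rw [Phase.residual, ih]
  have job : PolyTime .value fun I e => (S I).t - 1 - e.headI :=
    .sub (.sub hS.t (.const _)) PolyTime.head.bits
  simp only [residual_eq_rec]
  exact .iterSub ha hS.bestCode
    (PolyTimePred.ite (d := fun _ _ => Classical.propDecidable _)
      (hS.reach job (.tail .head)) (.const 0) (hS.code job))

theorem isHeavy (hS : PolyTimePhase S) (ha : PolyTime .value a) :
    PolyTimePred fun I e => (S I).IsHeavy (a I e) := by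
  unfold Phase.IsHeavy
  exact .and (hS.isBig ha) (.not (hS.reach ha
    (hS.residual (.sub (.sub hS.t (.const _)) ha.bits))))

theorem isLight (hS : PolyTimePhase S) (ha : PolyTime .value a) :
    PolyTimePred fun I e => (S I).IsBig (a I e) ∧ ¬(S I).IsHeavy (a I e) :=
  (hS.isBig ha).and (hS.isHeavy ha).not

theorem card_heavyJobs (hS : PolyTimePhase S) : PolyTime .value fun I _ => #(S I).heavyJobs := by
  unfold Phase.heavyJobs
  exact polyTime_card_filter hS.t (hS.isHeavy .head)

theorem card_lightJobs (hS : PolyTimePhase S) : PolyTime .value fun I _ => #(S I).lightJobs := by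
  unfold Phase.lightJobs
  exact polyTime_card_filter hS.t (hS.isLight .head)

theorem heavyLoad (hS : PolyTimePhase S) : PolyTime .bits fun I _ => (S I).heavyLoad := by
  unfold Phase.heavyLoad Phase.heavyJobs
  exact polyTime_sum_filter hS.t (hS.isHeavy .head) (hS.R .head)

theorem lightLoad (hS : PolyTimePhase S) : PolyTime .bits fun I _ => (S I).lightLoad := by
  unfold Phase.lightLoad Phase.lightJobs
  exact polyTime_sum_filter hS.t (hS.isLight .head) (hS.R .head)

theorem capacity (hS : PolyTimePhase S) : PolyTime .bits fun I _ => (S I).capacity := by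
  unfold Phase.capacity
  exact .sub hS.k (.bits (.max hS.card_heavyJobs hS.card_lightJobs))

theorem smallStat (hS : PolyTimePhase S) (ha : PolyTime .bits a) :
    PolyTime .bits fun I e => (S I).smallStat I.n (a I e) := by
  unfold Phase.smallStat orderStat countGe
  exact .sup .n (PolyTimePred.ite (.and (.not (hS.isBig .head)) (.lt ha.tail
    (polyTime_countBelow .n (.and (.not (hS.isBig .head))
      (.le (hS.R (.tail .head)) (hS.R .head)))).bits)) (hS.R .head) (.const 0))

theorem gain (hS : PolyTimePhase S) (ha : PolyTime .bits a) : PolyTime .bits fun I e =>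
    gain (64 * (S I).N) (S I).capacity I.n ((S I).smallStat I.n) (a I e) := by
  have factor : PolyTime .bits fun I _ => 64 * (S I).N := .mul (.const _) hS.N.bits
  unfold CCS.gain
  exact .min (.mul factor (hS.smallStat ha)) (.mul (.add factor (.const _))
    (.sub (hS.smallStat ha) (hS.smallStat (.min (.bits .n)
      (.sub (.sub (.mul (.const _) hS.capacity) (.const _)) ha)))))

theorem lead (hS : PolyTimePhase S) : PolyTime .value fun I _ => (S I).lead I.n := by
  unfold Phase.lead cutoff
  exact polyTime_countBelow .n (.and (.lt PolyTime.head.bits hS.capacity)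
    (.lt (.sum .head (hS.gain PolyTime.head.bits))
      (.mul (.mul (.const _) hS.N.bits) (.sub hS.heavyLoad hS.lightLoad))))

theorem rankRight (hS : PolyTimePhase S) (ha : PolyTime .bits a) : PolyTimePred fun I e =>
    RankRight (S I).capacity ((S I).lead I.n) #(S I).heavyJobs #(S I).lightJobs (a I e) := by
  have double : PolyTime .bits fun I _ => 2 * (S I).capacity := .mul (.const _) hS.capacity
  have lead := hS.lead.bits
  unfold RankRight
  exact .or (.lt ha lead) (.or
    (.and (.le lead ha) (.and (.lt (.add ha lead) double) (.eq (.mod ha (.const _)) (.const _))))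
    (.and (.le double ha) (.lt hS.card_lightJobs.bits hS.card_heavyJobs.bits)))

theorem rightQuota (hS : PolyTimePhase S) (ha : PolyTime .bits a) :
    PolyTime .value fun I e => (S I).rightQuota I.n (a I e) := by
  unfold Phase.rightQuota quota
  exact polyTime_countBelow .n (.and (.eq (hS.smallStat PolyTime.head.bits) ha.tail)
    (hS.rankRight PolyTime.head.bits))

theorem rightAt (hS : PolyTimePhase S) (ha : PolyTime .value a) :
    PolyTimePred fun I e => (S I).RightAt I.n (a I e) := by
  unfold Phase.RightAt Chosen
  exact .or (hS.isLight ha) (.and (.not (hS.isBig ha)) (.lt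
    (polyTime_countBelow ha (.and (.not (hS.isBig .head)) (.eq (hS.R .head) (hS.R ha.tail)))).bits
    (hS.rightQuota (hS.R ha)).bits))

end PolyTimePhase

theorem polyTime_granularity : PolyTime .value fun I _ => granularity I.N I.k := by
  unfold granularity
  exact PolyTimePred.ite (.le .k (.bits (.mul (.const _) (.mul .N .N))))
    (.mul (.const _) (.mul (.mul .N .N) .N)) (.mul (.const _) .N)

theorem polyTime_epoch {R : Input → ℕ → ℕ} {Δ : Input → ℕ} (hR : PolyTimeSeq R)
    (hΔ : PolyTime .bits fun I _ => Δ I) : PolyTime .value fun I _ => epoch (Δ I) (R I) I.n := by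
  unfold epoch Renews
  exact polyTime_countBelow .n (.exists_lt .n (.and
    (.le (PolyTime.tail .head).bits PolyTime.head.bits)
    (.le (polyTime_prefixLoad hR (.add .head (.const 1))) (.mul hΔ (hR .head)))))

theorem polyTimeSeq_rounded : PolyTimeSeq rounded := by
  intro a ha
  have two_pow_size {g : InputFun} (hg : PolyTime .bits g) :
      PolyTime .bits fun I e => 2 ^ Nat.size (g I e) := .pow (.const _) (.size hg)
  unfold rounded mantissa exponent
  exact .mul (.div (.mul (.mul (.mul (.const _) (.bits .N)) (.num ha)) (two_pow_size (.den ha)))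
    (.mul (.den ha) (two_pow_size (.num ha)))) (.pow (.const _) (.add (.size (.num ha))
      (.sub (.sum .n (.size (.den .head))) (.bits (.size (.den ha))))))

theorem polyTimePhase_currentPhase :
    PolyTimePhase fun I => currentPhase I.N I.k (rounded I) I.n where
  N := .N
  k := .k
  Δ := polyTime_granularity.bits
  t := polyTime_epoch polyTimeSeq_rounded polyTime_granularity.bits
  R := polyTimeSeq_rounded

theorem polyTime_machine : PolyTime .value fun I e => machine I e.headI := by
  unfold machine
  exact PolyTimePred.ite (.le (.bits .N) (.const _))
    (PolyTimePred.ite (.le .k (.bits .head)) (.const _) (.const _))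
    (PolyTimePred.ite (polyTimePhase_currentPhase.rightAt .head) (.const _) (.const _))

/-! ### Partitioning the big jobs -/

theorem digit_sum_pow {ι : Type*} (s : Finset ι) (w : ι → ℕ) {B : ℕ} (hB : #s < B) (v : ℕ) :
    (∑ x ∈ s, B ^ w x) / B ^ v % B = #{x ∈ s | w x = v} := by
  have B_pos : 0 < B := by omega
  have lower : ∑ x ∈ s with w x < v, B ^ w x < B ^ v := by
    rcases Nat.eq_zero_or_pos v with rfl | hv
    · simp
    · calc ∑ x ∈ s with w x < v, B ^ w x ≤ ∑ x ∈ s with w x < v, B ^ (v - 1) := by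
            refine sum_le_sum fun x hx => Nat.pow_le_pow_right B_pos ?_
            have := (mem_filter.1 hx).2
            omega
        _ ≤ #s * B ^ (v - 1) := by
            rw [sum_const, smul_eq_mul]
            exact Nat.mul_le_mul_right _ (card_filter_le _ _)
        _ < B * B ^ (v - 1) := Nat.mul_lt_mul_of_pos_right hB (by positivity)
        _ = B ^ v := by rw [← pow_succ', Nat.sub_add_cancel hv]
  have middle : ∑ x ∈ s with w x = v, B ^ w x = #{x ∈ s | w x = v} * B ^ v := by
    rw [sum_congr rfl (g := fun _ => B ^ v) fun x hx => by rw [(mem_filter.1 hx).2], sum_const,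
      smul_eq_mul]
  obtain ⟨c, upper⟩ : B ^ (v + 1) ∣ ∑ x ∈ s with v < w x, B ^ w x :=
    dvd_sum fun x hx => pow_dvd_pow B (mem_filter.1 hx).2
  have total : ∑ x ∈ s, B ^ w x = ∑ x ∈ s with w x < v, B ^ w x +
      B ^ v * (#{x ∈ s | w x = v} + B * c) := by
    rw [← sum_filter_add_sum_filter_not s (fun x => w x < v), add_right_inj,
      ← sum_filter_add_sum_filter_not _ (fun x => w x = v), filter_filter, filter_filter,
      filter_congr (q := fun x => w x = v) fun x _ => by omega,
      filter_congr (p := fun x => ¬w x < v ∧ ¬w x = v) (q := fun x => v < w x)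
        fun x _ => by omega, middle, upper]
    ring
  rw [total, Nat.add_mul_div_left _ _ (by positivity), Nat.div_eq_of_lt lower, zero_add,
    Nat.add_mul_mod_self_left]
  exact Nat.mod_eq_of_lt ((card_filter_le _ _).trans_lt hB)

/-- The jobs of `A` can be scheduled at cost at most `c`, with the jobs of `X` on one machine and
the others on the other. -/
structure IsSplit (A : Finset ℕ) (R : ℕ → ℕ) (k c : ℕ) (X : Finset ℕ) : Prop where
  subset : X ⊆ A
  card_le : #X ≤ k
  card_sdiff_le : #(A \ X) ≤ k
  load_le : ∑ j ∈ X, R j ≤ c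
  load_sdiff_le : ∑ j ∈ A \ X, R j ≤ c

namespace IsSplit

variable {A X : Finset ℕ} {R : ℕ → ℕ} {k c : ℕ}

theorem swap (h : IsSplit A R k c X) : IsSplit A R k c (A \ X) where
  subset := sdiff_subset
  card_le := h.card_sdiff_le
  card_sdiff_le := by rw [Finset.sdiff_sdiff_eq_self h.subset]; exact h.card_le
  load_le := h.load_sdiff_le
  load_sdiff_le := by rw [Finset.sdiff_sdiff_eq_self h.subset]; exact h.load_le

theorem restrict (h : IsSplit A R k c X) {B : Finset ℕ} (hB : B ⊆ A) {c' : ℕ}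
    (hc : ∑ j ∈ B ∩ X, R j ≤ c') (hc' : ∑ j ∈ B ∩ (A \ X), R j ≤ c') :
    IsSplit B R k c' (B ∩ X) := by
  have rest : B \ (B ∩ X) = B ∩ (A \ X) := by
    rw [sdiff_inter_self_left, ← inter_sdiff_assoc, inter_eq_left.2 hB]
  exact {
    subset := inter_subset_left
    card_le := (card_le_card inter_subset_right).trans h.card_le
    card_sdiff_le := rest ▸ (card_le_card inter_subset_right).trans h.card_sdiff_le
    load_le := hc
    load_sdiff_le := rest ▸ hc' }

end IsSplit

theorem prefixLoad_mono {R : ℕ → ℕ} {m m' : ℕ} (h : m ≤ m') : prefixLoad R m ≤ prefixLoad R m' :=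
  sum_le_sum_of_subset (range_subset_range.2 h)

namespace Phase

variable {S : Phase}

theorem mem_bigJobs {m j : ℕ} : j ∈ S.bigJobs m ↔ j < m ∧ S.IsBig j := by
  simp only [bigJobs, mem_filter, mem_range]

theorem mem_heavyJobs {j : ℕ} : j ∈ S.heavyJobs ↔ j < S.t ∧ S.IsHeavy j := by
  simp only [heavyJobs, mem_filter, mem_range]

theorem card_bigJobs_le {m : ℕ} : #(S.bigJobs m) ≤ m := by
  classical exact (card_filter_le _ _).trans (card_range m).le

theorem card_le_of_subset_bigJobs {m : ℕ} {X : Finset ℕ} (hX : X ⊆ S.bigJobs m) : #X ≤ m :=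
  (card_le_card hX).trans card_bigJobs_le

theorem heavyJobs_subset : S.heavyJobs ⊆ S.bigJobs S.t := fun _ hj =>
  mem_bigJobs.2 ⟨(mem_heavyJobs.1 hj).1, (mem_heavyJobs.1 hj).2.1⟩

theorem lightJobs_eq_sdiff : S.lightJobs = S.bigJobs S.t \ S.heavyJobs := by
  ext j
  simp only [lightJobs, mem_sdiff, bigJobs, heavyJobs, mem_filter]
  tauto

theorem card_heavyJobs_add_card_lightJobs : #S.heavyJobs + #S.lightJobs = #(S.bigJobs S.t) := by
  rw [lightJobs_eq_sdiff, add_comm, card_sdiff_add_card_eq_card heavyJobs_subset]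

theorem heavyLoad_add_lightLoad : S.heavyLoad + S.lightLoad = ∑ j ∈ S.bigJobs S.t, S.R j := by
  rw [heavyLoad, lightLoad, lightJobs_eq_sdiff, add_comm, sum_sdiff heavyJobs_subset]

theorem reach_iff {m v : ℕ} (hm : m ≤ S.t) :
    S.Reach m v ↔ ∃ X ⊆ S.bigJobs m, ∑ j ∈ X, S.code j = v := by
  have genFun_eq : S.genFun m =
      ∑ X ∈ (S.bigJobs m).powerset, (2 ^ (S.t + 1)) ^ ∑ j ∈ X, S.code j := by
    rw [genFun, ← prod_filter, Finset.prod_one_add]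
    exact sum_congr rfl fun X _ => prod_pow_eq_pow_sum _ _ _
  have few_sets : #(S.bigJobs m).powerset < 2 ^ (S.t + 1) := by
    rw [card_powerset]
    exact Nat.pow_lt_pow_right one_lt_two (Nat.lt_succ_of_le (card_bigJobs_le.trans hm))
  rw [Reach, genFun_eq, digit_sum_pow _ _ few_sets, card_pos, filter_nonempty_iff]
  simp only [mem_powerset]

theorem sum_code (X : Finset ℕ) :
    ∑ j ∈ X, S.code j = (∑ j ∈ X, S.weight j) * (S.t + 1) + #X := by
  simp only [code, sum_add_distrib, sum_mul, sum_const, smul_eq_mul, mul_one]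

theorem Reach.of_succ_of_not {j v : ℕ} (hj : j < S.t) (h : S.Reach (j + 1) v)
    (hn : ¬S.Reach j v) : S.IsBig j ∧ S.code j ≤ v ∧ S.Reach j (v - S.code j) := by
  obtain ⟨X, hX, sum_X⟩ := (reach_iff (by omega)).1 h
  have below {l : ℕ} (hl : l ∈ X) (hlj : l ≠ j) : l ∈ S.bigJobs j := by
    have := mem_bigJobs.1 (hX hl)
    exact mem_bigJobs.2 ⟨by omega, this.2⟩
  have j_mem : j ∈ X := by
    by_contra hjX
    exact hn ((reach_iff hj.le).2 ⟨X, fun l hl => below hl fun h => hjX (h ▸ hl), sum_X⟩)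
  rw [← add_sum_erase X _ j_mem] at sum_X
  exact ⟨(mem_bigJobs.1 (hX j_mem)).2, by omega, (reach_iff hj.le).2
    ⟨X.erase j, fun l hl => below (mem_of_mem_erase hl) (ne_of_mem_erase hl), by omega⟩⟩

open scoped Classical in
theorem reach_residual_and_sum_add_residual (h : S.Reach S.t S.bestCode) {i : ℕ} (hi : i ≤ S.t) :
    S.Reach (S.t - i) (S.residual i) ∧
      (∑ j ∈ Ico (S.t - i) S.t, if S.IsHeavy j then S.code j else 0) + S.residual i =
        S.bestCode := by
  induction i with
  | zero => exact ⟨h, by rw [Nat.sub_zero, Ico_self, sum_empty, zero_add, residual]⟩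
  | succ i ih =>
    obtain ⟨reach, sum_add⟩ := ih (by omega)
    obtain ⟨j, hj⟩ : ∃ j, S.t - i = j + 1 := ⟨S.t - 1 - i, by omega⟩
    have heavy_iff : S.IsHeavy j ↔ S.IsBig j ∧ ¬S.Reach j (S.residual i) := by
      rw [IsHeavy, show S.t - 1 - j = i by omega]
    rw [hj] at reach sum_add
    rw [residual, show S.t - 1 - i = j by omega, show S.t - (i + 1) = j by omega,
      sum_eq_sum_Ico_succ_bot (by omega)]
    by_cases avoidable : S.Reach j (S.residual i)
    · rw [if_pos avoidable, if_neg (by tauto), zero_add]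
      exact ⟨avoidable, sum_add⟩
    · obtain ⟨big, code_le, reach'⟩ := reach.of_succ_of_not (by omega) avoidable
      rw [if_neg avoidable, if_pos (heavy_iff.2 ⟨big, avoidable⟩)]
      exact ⟨reach', by omega⟩

theorem sum_code_heavyJobs (h : S.Reach S.t S.bestCode) :
    ∑ j ∈ S.heavyJobs, S.code j = S.bestCode := by
  obtain ⟨reach, sum_add⟩ := reach_residual_and_sum_add_residual h le_rfl
  rw [Nat.sub_self] at reach sum_add
  obtain ⟨X, hX, sum_X⟩ := (reach_iff (Nat.zero_le _)).1 reach
  rw [bigJobs, range_zero, filter_empty, subset_empty] at hX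
  rw [← sum_X, hX, sum_empty, add_zero] at sum_add
  rw [← sum_add, heavyJobs, sum_filter, range_eq_Ico]

theorem goodCode_sum_iff {X : Finset ℕ} (hX : X ⊆ S.bigJobs S.t) :
    S.GoodCode (∑ j ∈ X, S.code j) ↔ #X ≤ S.k ∧ #(S.bigJobs S.t \ X) ≤ S.k ∧
      ∑ j ∈ S.bigJobs S.t, S.weight j ≤ 2 * ∑ j ∈ X, S.weight j := by
  have card_lt : #X < S.t + 1 := Nat.lt_succ_of_le (card_le_of_subset_bigJobs hX)
  have div_eq : (∑ j ∈ X, S.code j) / (S.t + 1) = ∑ j ∈ X, S.weight j := by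
    rw [sum_code, mul_comm, Nat.mul_add_div (by omega), Nat.div_eq_of_lt card_lt, add_zero]
  have mod_eq : (∑ j ∈ X, S.code j) % (S.t + 1) = #X := by
    rw [sum_code, mul_comm, Nat.mul_add_mod, Nat.mod_eq_of_lt card_lt]
  have reach : S.Reach S.t (∑ j ∈ X, S.code j) := (reach_iff le_rfl).2 ⟨X, hX, rfl⟩
  rw [GoodCode, div_eq, mod_eq, card_sdiff_of_subset hX, Nat.sub_le_iff_le_add]
  exact and_iff_right reach

theorem sum_code_lt_codeBound {X : Finset ℕ} (hX : X ⊆ S.bigJobs S.t) :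
    ∑ j ∈ X, S.code j < S.codeBound := by
  have card_le := card_le_of_subset_bigJobs hX
  have weight_le : ∑ j ∈ X, S.weight j ≤ S.t * S.resolution :=
    (sum_le_card_nsmul X _ _ fun j _ => min_le_left _ _).trans (Nat.mul_le_mul_right _ card_le)
  have := Nat.mul_le_mul_right (S.t + 1) weight_le
  rw [sum_code, codeBound, add_mul]
  omega

theorem GoodCode.bestCode {v : ℕ} (hv : S.GoodCode v) :
    S.GoodCode S.bestCode ∧ S.bestCode ≤ v := by
  obtain ⟨X, hX, rfl⟩ := (reach_iff le_rfl).1 hv.1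
  have in_bound := sum_code_lt_codeBound hX
  have lt_best_iff (i : ℕ) : i < S.bestCode ↔
      i < S.codeBound ∧ ¬∃ w < S.codeBound, w ≤ i ∧ S.GoodCode w :=
    lt_countBelow_iff fun i j hij h ⟨w, hw, hwi, good⟩ => h ⟨w, hw, hwi.trans hij, good⟩
  have best_le : S.bestCode ≤ ∑ j ∈ X, S.code j := not_lt.1 fun h =>
    ((lt_best_iff _).1 h).2 ⟨_, in_bound, le_rfl, hv⟩
  refine ⟨?_, best_le⟩
  have reached := mt (lt_best_iff S.bestCode).2 (lt_irrefl _)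
  rw [not_and, not_not] at reached
  obtain ⟨w, hw, hwb, good⟩ := reached (by omega)
  rcases hwb.eq_or_lt with rfl | hlt
  · exact good
  · exact absurd ⟨w, hw, le_rfl, good⟩ ((lt_best_iff w).1 hlt).2

theorem exists_goodCode_sum {X : Finset ℕ} (hX : X ⊆ S.bigJobs S.t) (hXk : #X ≤ S.k)
    (hXk' : #(S.bigJobs S.t \ X) ≤ S.k) : ∃ Y, (Y = X ∨ Y = S.bigJobs S.t \ X) ∧
      Y ⊆ S.bigJobs S.t ∧ S.GoodCode (∑ j ∈ Y, S.code j) := by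
  have split := sum_sdiff (f := S.weight) hX
  rcases le_total (∑ j ∈ S.bigJobs S.t \ X, S.weight j) (∑ j ∈ X, S.weight j) with h | h
  · exact ⟨X, Or.inl rfl, hX, (goodCode_sum_iff hX).2 ⟨hXk, hXk', by omega⟩⟩
  · exact ⟨_, Or.inr rfl, sdiff_subset, (goodCode_sum_iff sdiff_subset).2
      ⟨hXk', by rwa [Finset.sdiff_sdiff_eq_self hX], by omega⟩⟩

theorem goodCode_heavyJobs (hk : #(S.bigJobs S.t) ≤ 2 * S.k) :
    S.GoodCode (∑ j ∈ S.heavyJobs, S.code j) ∧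
      ∀ v, S.GoodCode v → ∑ j ∈ S.heavyJobs, S.code j ≤ v := by
  obtain ⟨X, hX, card_X⟩ := exists_subset_card_eq (min_le_right S.k #(S.bigJobs S.t))
  obtain ⟨Y, -, -, good_Y⟩ := exists_goodCode_sum hX (by omega)
    (by rw [card_sdiff_of_subset hX]; omega)
  have good := good_Y.bestCode.1
  rw [sum_code_heavyJobs good.1]
  exact ⟨good, fun v hv => hv.bestCode.2⟩

theorem card_heavyJobs_le (hk : #(S.bigJobs S.t) ≤ 2 * S.k) : #S.heavyJobs ≤ S.k :=
  ((goodCode_sum_iff heavyJobs_subset).1 (goodCode_heavyJobs hk).1).1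

theorem card_lightJobs_le (hk : #(S.bigJobs S.t) ≤ 2 * S.k) : #S.lightJobs ≤ S.k := by
  rw [lightJobs_eq_sdiff]
  exact ((goodCode_sum_iff heavyJobs_subset).1 (goodCode_heavyJobs hk).1).2.1

theorem sum_weight_lightJobs_le (hk : #(S.bigJobs S.t) ≤ 2 * S.k) :
    ∑ j ∈ S.lightJobs, S.weight j ≤ ∑ j ∈ S.heavyJobs, S.weight j := by
  have half := ((goodCode_sum_iff heavyJobs_subset).1 (goodCode_heavyJobs hk).1).2.2
  have split := sum_sdiff (f := S.weight) (heavyJobs_subset (S := S))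
  rw [lightJobs_eq_sdiff]
  omega

theorem sum_weight_heavyJobs_le (hk : #(S.bigJobs S.t) ≤ 2 * S.k) {Y : Finset ℕ}
    (hY : Y ⊆ S.bigJobs S.t) (good : S.GoodCode (∑ j ∈ Y, S.code j)) :
    ∑ j ∈ S.heavyJobs, S.weight j ≤ ∑ j ∈ Y, S.weight j := by
  have code_le := (goodCode_heavyJobs hk).2 _ good
  have card_Y := card_le_of_subset_bigJobs hY
  rw [sum_code, sum_code] at code_le
  refine Nat.lt_succ_iff.1 (Nat.lt_of_mul_lt_mul_right (a := S.t + 1) ?_)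
  rw [Nat.succ_mul]
  omega

theorem weight_bounds {j : ℕ} (hj : j < S.t) (pos : 0 < prefixLoad S.R S.t) :
    S.weight j * prefixLoad S.R S.t ≤ S.R j * S.resolution ∧
      S.R j * S.resolution ≤ (S.weight j + 1) * prefixLoad S.R S.t := by
  have le_total : S.R j ≤ prefixLoad S.R S.t :=
    single_le_sum (f := S.R) (fun _ _ => Nat.zero_le _) (mem_range.2 hj)
  have weight_eq : S.weight j = S.R j * S.resolution / prefixLoad S.R S.t :=
    min_eq_right (Nat.div_le_of_le_mul (Nat.mul_le_mul_right _ le_total))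
  rw [weight_eq, add_mul, one_mul]
  exact ⟨Nat.div_mul_le_self _ _, (Nat.lt_div_mul_add pos).le⟩

theorem sum_weight_bounds {X : Finset ℕ} (hX : X ⊆ S.bigJobs S.t)
    (pos : 0 < prefixLoad S.R S.t) :
    (∑ j ∈ X, S.weight j) * prefixLoad S.R S.t ≤ (∑ j ∈ X, S.R j) * S.resolution ∧
      (∑ j ∈ X, S.R j) * S.resolution ≤
        (∑ j ∈ X, S.weight j + S.t) * prefixLoad S.R S.t := by
  have lt (j) (hj : j ∈ X) : j < S.t := (mem_bigJobs.1 (hX hj)).1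
  rw [sum_mul, sum_mul]
  refine ⟨sum_le_sum fun j hj => (weight_bounds (lt j hj) pos).1, ?_⟩
  calc ∑ j ∈ X, S.R j * S.resolution
      ≤ ∑ j ∈ X, (S.weight j + 1) * prefixLoad S.R S.t :=
        sum_le_sum fun j hj => (weight_bounds (lt j hj) pos).2
    _ = (∑ j ∈ X, S.weight j + #X) * prefixLoad S.R S.t := by
        rw [← sum_mul, sum_add_distrib, sum_const, smul_eq_mul, mul_one]
    _ ≤ _ := by
        gcongr
        exact card_le_of_subset_bigJobs hX

theorem load_le_of_weight_le {X Y : Finset ℕ} (hX : X ⊆ S.bigJobs S.t) (hY : Y ⊆ S.bigJobs S.t)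
    (h : ∑ j ∈ X, S.weight j ≤ ∑ j ∈ Y, S.weight j) :
    64 * S.N * ∑ j ∈ X, S.R j ≤ 64 * S.N * ∑ j ∈ Y, S.R j + prefixLoad S.R S.t := by
  rcases Nat.eq_zero_or_pos (prefixLoad S.R S.t) with no_load | pos
  · have : ∑ j ∈ X, S.R j ≤ prefixLoad S.R S.t :=
      sum_le_sum_of_subset fun j hj => mem_range.2 (mem_bigJobs.1 (hX hj)).1
    rw [no_load, Nat.le_zero] at this
    rw [this]
    omega
  · have upper := (sum_weight_bounds hX pos).2
    have lower := (sum_weight_bounds hY pos).1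
    rw [resolution] at upper lower
    refine Nat.le_of_mul_le_mul_right (c := S.t + 1) ?_ (by omega)
    calc 64 * S.N * (∑ j ∈ X, S.R j) * (S.t + 1)
        = (∑ j ∈ X, S.R j) * (64 * S.N * (S.t + 1)) := by ring
      _ ≤ (∑ j ∈ Y, S.weight j) * prefixLoad S.R S.t + S.t * prefixLoad S.R S.t := by
          rw [← add_mul]
          exact upper.trans (by gcongr)
      _ ≤ (∑ j ∈ Y, S.R j) * (64 * S.N * (S.t + 1)) + (S.t + 1) * prefixLoad S.R S.t := by
          gcongr
          omega
      _ = _ := by ring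

theorem lightLoad_le (hk : #(S.bigJobs S.t) ≤ 2 * S.k) :
    64 * S.N * S.lightLoad ≤ 64 * S.N * S.heavyLoad + prefixLoad S.R S.t :=
  load_le_of_weight_le (lightJobs_eq_sdiff.trans_subset sdiff_subset) heavyJobs_subset
    (sum_weight_lightJobs_le hk)

theorem loads_le (hk : #(S.bigJobs S.t) ≤ 2 * S.k) {X : Finset ℕ} {c : ℕ}
    (hX : IsSplit (S.bigJobs S.t) S.R S.k c X) :
    64 * S.N * S.heavyLoad ≤ 64 * S.N * c + prefixLoad S.R S.t ∧
      64 * S.N * S.lightLoad ≤ 64 * S.N * c + prefixLoad S.R S.t := by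
  obtain ⟨Y, hYX, hY, good⟩ := exists_goodCode_sum hX.subset hX.card_le hX.card_sdiff_le
  have Y_le : ∑ j ∈ Y, S.R j ≤ c := by
    rcases hYX with rfl | rfl
    · exact hX.load_le
    · exact hX.load_sdiff_le
  have weight_le := sum_weight_heavyJobs_le hk hY good
  have heavy_le := load_le_of_weight_le heavyJobs_subset hY weight_le
  have light_le := load_le_of_weight_le (lightJobs_eq_sdiff.trans_subset sdiff_subset) hY
    ((sum_weight_lightJobs_le hk).trans weight_le)
  have := Nat.mul_le_mul_left (64 * S.N) Y_le
  rw [heavyLoad, lightLoad]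
  exact ⟨by omega, by omega⟩

end Phase

/-! ### Feasibility and approximation ratio -/

theorem sumBelow_one (P : ℕ → Prop) (n : ℕ) : sumBelow P (fun _ => 1) n = countBelow P n := by
  rw [sumBelow, countBelow, card_eq_sum_ones]

theorem mul_sum_le_sum_range_of_few {s : ℕ → ℕ} {n : ℕ} (hs : Antitone s)
    (h0 : ∀ i, n ≤ i → s i = 0) {A : Finset ℕ} {κ M : ℕ} (hκ : M * M ≤ κ) (hA : ∀ i ∈ A, κ ≤ i)
    (few : #A ≤ M) : M * ∑ i ∈ A, s i ≤ ∑ i ∈ range n, s i := by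
  calc M * ∑ i ∈ A, s i ≤ M * (#A * s κ) := by
        gcongr
        simpa only [smul_eq_mul] using sum_le_card_nsmul A s (s κ) fun i hi => hs (hA i hi)
    _ ≤ M * (M * s κ) := by gcongr
    _ = M * M * s κ := by ring
    _ ≤ κ * s κ := by gcongr
    _ ≤ ∑ i ∈ range κ, s i := by
        simpa only [card_range, smul_eq_mul] using
          card_nsmul_le_sum (range κ) s (s κ) fun i hi => hs (mem_range.1 hi).le
    _ ≤ ∑ i ∈ range (max n κ), s i :=
        sum_le_sum_of_subset (range_subset_range.2 (le_max_right n κ))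
    _ = ∑ i ∈ range n, s i := (sum_range_extend h0 (le_max_left n κ)).symm

theorem tailLoad_le_sum_Ico_add_tailLoad (s : ℕ → ℕ) (n q q' : ℕ) :
    tailLoad s n q ≤ ∑ i ∈ Ico q q', s i + tailLoad s n q' := by
  rw [tailLoad, tailLoad, ← sum_union (Ico_disjoint_Ico_consecutive q q' n)]
  exact sum_le_sum_of_subset Ico_subset_Ico_union_Ico

theorem sum_range_add_tailLoad {s : ℕ → ℕ} {n : ℕ} (h0 : ∀ i, n ≤ i → s i = 0) (q : ℕ) :
    ∑ i ∈ range q, s i + tailLoad s n q = ∑ i ∈ range n, s i := by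
  rcases le_total q n with h | h
  · exact sum_range_add_sum_Ico _ h
  · rw [tailLoad, Ico_eq_empty_of_le h, sum_empty, add_zero, sum_range_extend h0 h]

namespace Phase

variable {S : Phase} {n : ℕ}

open scoped Classical in
/-- The small jobs below `n`. -/
noncomputable def smallJobs (S : Phase) (n : ℕ) : Finset ℕ := {j ∈ range n | ¬S.IsBig j}

/-- The ranks, in order of decreasing size, of the small jobs on the second machine. -/
def RightRank (S : Phase) (n : ℕ) : ℕ → Prop :=
  RankRight S.capacity (S.lead n) #S.heavyJobs #S.lightJobs

theorem mem_smallJobs {j : ℕ} : j ∈ S.smallJobs n ↔ j < n ∧ ¬S.IsBig j := by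
  simp only [smallJobs, mem_filter, mem_range]

theorem bigJobs_eq (ht : S.t ≤ n) : S.bigJobs S.t = S.bigJobs n := by
  ext j
  rw [mem_bigJobs, mem_bigJobs]
  exact ⟨fun h => ⟨h.1.trans_le ht, h.2⟩, fun h => ⟨h.2.1, h.2⟩⟩

theorem bigJobs_subset_range (ht : S.t ≤ n) : S.bigJobs S.t ⊆ range n := fun _ hj =>
  mem_range.2 ((mem_bigJobs.1 hj).1.trans_le ht)

theorem disjoint_bigJobs_smallJobs : Disjoint (S.bigJobs n) (S.smallJobs n) :=
  disjoint_left.2 fun _ big small => (mem_smallJobs.1 small).2 (mem_bigJobs.1 big).2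

theorem bigJobs_union_smallJobs : S.bigJobs n ∪ S.smallJobs n = range n := by
  ext j
  rw [mem_union, mem_bigJobs, mem_smallJobs, mem_range]
  tauto

theorem card_bigJobs_add_card_smallJobs (ht : S.t ≤ n) :
    #(S.bigJobs S.t) + #(S.smallJobs n) = n := by
  rw [bigJobs_eq ht, ← card_union_of_disjoint disjoint_bigJobs_smallJobs, bigJobs_union_smallJobs,
    card_range]

theorem sum_bigJobs_add_sum_smallJobs (ht : S.t ≤ n) :
    ∑ j ∈ S.bigJobs S.t, S.R j + ∑ j ∈ S.smallJobs n, S.R j = prefixLoad S.R n := by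
  rw [bigJobs_eq ht, ← sum_union disjoint_bigJobs_smallJobs, bigJobs_union_smallJobs, prefixLoad]

theorem smallStat_anti : Antitone (S.smallStat n) := orderStat_anti

theorem smallStat_eq_zero (i : ℕ) (h : n ≤ i) : S.smallStat n i = 0 := orderStat_eq_zero h

theorem sum_smallStat : ∑ i ∈ range n, S.smallStat n i = ∑ j ∈ S.smallJobs n, S.R j := by
  classical exact sum_orderStat.trans (sumBelow_eq_sum _ _ _)

theorem sum_smallStat_le (ht : S.t ≤ n) :
    ∑ i ∈ range n, S.smallStat n i ≤ prefixLoad S.R n := by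
  rw [sum_smallStat, ← sum_bigJobs_add_sum_smallJobs ht]
  exact Nat.le_add_left _ _

theorem smallStat_ne_zero_iff (pos : ∀ j < n, 0 < S.R j) {i : ℕ} :
    S.smallStat n i ≠ 0 ↔ i < #(S.smallJobs n) := by
  classical
  rw [← Nat.one_le_iff_ne_zero, smallStat, le_orderStat_iff one_pos, countGe, countBelow_eq_card,
    smallJobs, filter_congr fun j hj => and_iff_left (Nat.one_le_iff_ne_zero.2
      (pos j (mem_range.1 hj)).ne')]

theorem sumBelow_rightAt (ht : S.t ≤ n) (f : ℕ → ℕ) : sumBelow (S.RightAt n) f n =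
    ∑ j ∈ S.lightJobs, f j +
      sumBelow (fun j => ¬S.IsBig j ∧ Chosen (fun i => ¬S.IsBig i) S.R (S.rightQuota n) j) f n := by
  classical
  have early (j) (big : S.IsBig j) : j < S.t := big.1
  rw [sumBelow_eq_sum, sumBelow_eq_sum, ← sum_union]
  · refine sum_congr ?_ fun _ _ => rfl
    ext j
    simp only [lightJobs, mem_union, mem_filter, mem_range]
    rw [RightAt]
    constructor
    · rintro ⟨hj, light | small⟩
      · exact Or.inl ⟨early j light.1, light⟩
      · exact Or.inr ⟨hj, small⟩
    · rintro (⟨hj, light⟩ | ⟨hj, small⟩)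
      · exact ⟨hj.trans_le ht, Or.inl light⟩
      · exact ⟨hj, Or.inr small⟩
  · rw [disjoint_left]
    intro j light small
    exact (mem_filter.1 small).2.1 (mem_filter.1 light).2.1

theorem load_rightAt (ht : S.t ≤ n) : sumBelow (S.RightAt n) S.R n =
    S.lightLoad + sumBelow (S.RightRank n) (S.smallStat n) n := by
  rw [sumBelow_rightAt ht, lightLoad]
  congr 1
  exact sum_chosen (S.RightRank n) (fun v => v) rfl

theorem load_not_rightAt (ht : S.t ≤ n) : sumBelow (fun j => ¬S.RightAt n j) S.R n =
    S.heavyLoad + sumBelow (fun i => ¬S.RightRank n i) (S.smallStat n) n := by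
  have jobs := sumBelow_add_not (S.RightAt n) S.R n
  have ranks := sumBelow_add_not (S.RightRank n) (S.smallStat n) n
  have big := S.heavyLoad_add_lightLoad
  have total := sum_bigJobs_add_sum_smallJobs ht
  rw [load_rightAt ht] at jobs
  rw [sum_smallStat] at ranks
  rw [prefixLoad] at total
  omega

theorem card_rightAt (ht : S.t ≤ n) (pos : ∀ j < n, 0 < S.R j) :
    countBelow (S.RightAt n) n =
      #S.lightJobs + countBelow (S.RightRank n) #(S.smallJobs n) := by
  classical
  have small_le : #(S.smallJobs n) ≤ n := (card_filter_le _ _).trans (card_range n).le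
  have small_right : sumBelow (fun j => ¬S.IsBig j ∧
      Chosen (fun i => ¬S.IsBig i) S.R (S.rightQuota n) j) (fun _ => 1) n =
        sumBelow (S.RightRank n) (fun i => if S.smallStat n i = 0 then 0 else 1) n :=
    (sumBelow_congr (fun _ _ => Iff.rfl) fun j hj => (if_neg (pos j hj).ne').symm).trans
      (sum_chosen (S.RightRank n) (fun v => if v = 0 then 0 else 1) rfl)
  have zero_beyond (i : ℕ) (hi : #(S.smallJobs n) ≤ i) :
      (if S.smallStat n i = 0 then 0 else 1) = 0 :=
    if_pos (not_not.1 (mt (smallStat_ne_zero_iff pos).1 hi.not_gt))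
  rw [← sumBelow_one, sumBelow_rightAt ht, small_right, ← sumBelow_extend _ zero_beyond small_le,
    ← card_eq_sum_ones, ← sumBelow_one]
  exact congrArg _ (sumBelow_congr (fun _ _ => Iff.rfl) fun i hi =>
    if_neg ((smallStat_ne_zero_iff pos).2 hi))

theorem feasible_rightAt (ht : S.t ≤ n) (hn : n ≤ 2 * S.k) (pos : ∀ j < n, 0 < S.R j) :
    countBelow (S.RightAt n) n ≤ S.k ∧ countBelow (fun j => ¬S.RightAt n j) n ≤ S.k := by
  have card_eq := card_bigJobs_add_card_smallJobs ht
  have card_big := S.card_heavyJobs_add_card_lightJobs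
  have big_le : #(S.bigJobs S.t) ≤ 2 * S.k := by omega
  have split := rankRight_split_feasible (card_heavyJobs_le big_le) (card_lightJobs_le big_le)
    (c := #(S.smallJobs n)) (by omega) (T := S.lead n) cutoff_le
  have right := card_rightAt ht pos
  have both := countBelow_add_not (S.RightAt n) n
  have ranks := countBelow_le (S.RightRank n) #(S.smallJobs n)
  change #S.lightJobs + countBelow (S.RightRank n) #(S.smallJobs n) ≤ S.k ∧
    #S.heavyJobs + (#(S.smallJobs n) - countBelow (S.RightRank n) #(S.smallJobs n)) ≤ S.k at split
  omega

theorem card_bigJobs_le_of_pos (pos : ∀ j < S.t, 0 < S.R j) : #(S.bigJobs S.t) ≤ S.Δ := by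
  rcases Nat.eq_zero_or_pos S.t with no_jobs | some_jobs
  · rw [bigJobs, no_jobs, range_zero, filter_empty, card_empty]
    exact Nat.zero_le _
  have load_pos : 0 < prefixLoad S.R S.t :=
    sum_pos (fun j hj => pos j (mem_range.1 hj)) ⟨0, mem_range.2 some_jobs⟩
  refine Nat.le_of_mul_le_mul_right (c := prefixLoad S.R S.t) ?_ load_pos
  calc #(S.bigJobs S.t) * prefixLoad S.R S.t ≤ ∑ j ∈ S.bigJobs S.t, S.Δ * S.R j :=
        card_nsmul_le_sum _ _ _ fun j hj => (mem_bigJobs.1 hj).2.2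
    _ = S.Δ * ∑ j ∈ S.bigJobs S.t, S.R j := (mul_sum _ _ _).symm
    _ ≤ S.Δ * prefixLoad S.R S.t :=
        Nat.mul_le_mul_left _ (sum_le_sum_of_subset (bigJobs_subset_range le_rfl))

theorem sum_bigJobs_inter_add_tailLoad_le (ht : S.t ≤ n) {Y : Finset ℕ} (hY : Y ⊆ range n) {k : ℕ}
    (hYk : #(range n \ Y) ≤ k) :
    ∑ j ∈ S.bigJobs S.t ∩ Y, S.R j + tailLoad (S.smallStat n) n k ≤ ∑ j ∈ Y, S.R j := by
  have small_subset : S.smallJobs n \ Y ⊆ range n \ Y :=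
    sdiff_subset_sdiff (fun j hj => mem_range.2 (mem_smallJobs.1 hj).1) Subset.rfl
  have small_le : ∑ j ∈ S.smallJobs n \ Y, S.R j ≤ ∑ i ∈ range k, S.smallStat n i :=
    sum_le_sum_orderStat (fun j hj => mem_smallJobs.1 (mem_sdiff.1 hj).1)
      ((card_le_card small_subset).trans hYk)
  have small_split := sum_inter_add_sum_sdiff (S.smallJobs n) Y S.R
  have ranks_split := sum_range_add_tailLoad (S.smallStat_eq_zero (n := n)) k
  have Y_split : ∑ j ∈ S.bigJobs S.t ∩ Y, S.R j + ∑ j ∈ S.smallJobs n ∩ Y, S.R j =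
      ∑ j ∈ Y, S.R j := by
    rw [bigJobs_eq ht, ← sum_union
      (disjoint_bigJobs_smallJobs.mono inter_subset_left inter_subset_left),
      ← union_inter_distrib_right, bigJobs_union_smallJobs, inter_eq_right.2 hY]
  rw [sum_smallStat] at ranks_split
  omega

theorem heavyLoad_add_tailLoad_le (ht : S.t ≤ n) (hn : n ≤ 2 * S.k) {X : Finset ℕ} {c : ℕ}
    (hX : IsSplit (range n) S.R S.k c X) :
    64 * S.N * (S.heavyLoad + tailLoad (S.smallStat n) n S.k) ≤
      64 * S.N * c + prefixLoad S.R S.t := by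
  have big_le : #(S.bigJobs S.t) ≤ 2 * S.k := by
    have := card_bigJobs_add_card_smallJobs ht
    omega
  have left := (sum_bigJobs_inter_add_tailLoad_le ht hX.subset hX.card_sdiff_le).trans hX.load_le
  have right := (sum_bigJobs_inter_add_tailLoad_le ht hX.swap.subset
    hX.swap.card_sdiff_le).trans hX.swap.load_le
  obtain ⟨c', rfl⟩ : ∃ c', c = c' + tailLoad (S.smallStat n) n S.k :=
    ⟨c - tailLoad (S.smallStat n) n S.k, by omega⟩
  have heavy := (loads_le big_le (hX.restrict (bigJobs_subset_range ht) (c' := c') (by omega)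
    (by omega))).1
  rw [mul_add, mul_add]
  omega

theorem mul_smallStat_zero_le
    (small : ∀ j < n, ¬S.IsBig j → S.Δ * S.R j ≤ prefixLoad S.R n) (coarse : S.Δ = 64 * S.N)
    (hN : 0 < S.N) : 64 * S.N * S.smallStat n 0 ≤ prefixLoad S.R n := by
  have : S.smallStat n 0 ≤ prefixLoad S.R n / (64 * S.N) := orderStat_le fun j hj not_big => by
    rw [Nat.le_div_iff_mul_le (by omega), mul_comm, ← coarse]
    exact small j hj not_big
  rw [mul_comm]
  exact (Nat.le_div_iff_mul_le (by omega)).1 this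

section Fine

variable (ht : S.t ≤ n) (small : ∀ j < n, ¬S.IsBig j → S.Δ * S.R j ≤ prefixLoad S.R n)

include ht small

theorem mul_sum_smallStat_le (fine : 64 * S.N * n ≤ S.Δ) :
    64 * S.N * ∑ i ∈ range n, S.smallStat n i ≤ prefixLoad S.R n := by
  rcases Nat.eq_zero_or_pos n with rfl | n_pos
  · rw [range_zero, sum_empty, mul_zero]
    exact Nat.zero_le _
  refine le_of_mul_le_mul_left ?_ n_pos
  calc n * (64 * S.N * ∑ i ∈ range n, S.smallStat n i)
      = ∑ j ∈ S.smallJobs n, 64 * S.N * n * S.R j := by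
        rw [sum_smallStat, ← mul_sum]
        ring
    _ ≤ ∑ _j ∈ S.smallJobs n, prefixLoad S.R n := sum_le_sum fun _ hj =>
        (Nat.mul_le_mul_right _ fine).trans (small _ (mem_smallJobs.1 hj).1 (mem_smallJobs.1 hj).2)
    _ = #(S.smallJobs n) * prefixLoad S.R n := by rw [sum_const, smul_eq_mul]
    _ ≤ n * prefixLoad S.R n := by
        gcongr
        exact (Nat.le_add_left _ _).trans (card_bigJobs_add_card_smallJobs ht).le

theorem loads_le_of_fine (hn : n ≤ 2 * S.k) (fine : 64 * S.N * n ≤ S.Δ) {X : Finset ℕ} {c : ℕ}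
    (hX : IsSplit (range n) S.R S.k c X) :
    64 * S.N * sumBelow (S.RightAt n) S.R n ≤ 64 * S.N * c + 3 * prefixLoad S.R n ∧
      64 * S.N * sumBelow (fun j => ¬S.RightAt n j) S.R n ≤
        64 * S.N * c + 3 * prefixLoad S.R n := by
  have negligible := mul_sum_smallStat_le ht small fine
  have card_eq := card_bigJobs_add_card_smallJobs ht
  have total_le := prefixLoad_mono (R := S.R) ht
  have big := loads_le (by omega) (hX.restrict (bigJobs_subset_range ht)
    ((sum_le_sum_of_subset inter_subset_right).trans hX.load_le)
    ((sum_le_sum_of_subset inter_subset_right).trans hX.load_sdiff_le))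
  have ranks := congrArg (64 * S.N * ·) (sumBelow_add_not (S.RightRank n) (S.smallStat n) n)
  simp only [mul_add] at ranks
  rw [load_rightAt ht, load_not_rightAt ht, mul_add, mul_add]
  omega

end Fine

section Coarse

variable (ht : S.t ≤ n) (pos : ∀ j < n, 0 < S.R j) (coarse : S.Δ = 64 * S.N)
  (large : 8192 * (S.N * S.N) ≤ S.k)

include ht pos coarse

theorem card_heavyJobs_add_card_lightJobs_le : #S.heavyJobs + #S.lightJobs ≤ 64 * S.N := by
  rw [card_heavyJobs_add_card_lightJobs, ← coarse]
  exact card_bigJobs_le_of_pos fun j hj => pos j (hj.trans_le ht)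

include large

theorem mul_self_le_capacity : 64 * S.N * (64 * S.N) ≤ S.capacity := by
  have few_big := card_heavyJobs_add_card_lightJobs_le ht pos coarse
  have square : 64 * S.N * (64 * S.N) = 4096 * (S.N * S.N) := by ring
  have := Nat.le_mul_self S.N
  rw [capacity, square]
  omega

theorem mul_tailLoad_two_mul_capacity_le (hn : n ≤ 2 * S.k) :
    64 * S.N * tailLoad (S.smallStat n) n (2 * S.capacity) ≤ prefixLoad S.R n := by
  have few_big := card_heavyJobs_add_card_lightJobs_le ht pos coarse
  have card_eq := card_bigJobs_add_card_smallJobs ht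
  have card_big := S.card_heavyJobs_add_card_lightJobs
  have capacity_eq : S.capacity = S.k - max #S.heavyJobs #S.lightJobs := rfl
  have tail_eq : tailLoad (S.smallStat n) n (2 * S.capacity) =
      ∑ i ∈ Ico (2 * S.capacity) #(S.smallJobs n), S.smallStat n i :=
    (sum_subset (Ico_subset_Ico_right (by omega)) fun i hi hi' => not_not.1 fun ne => hi'
      (mem_Ico.2 ⟨(mem_Ico.1 hi).1, (smallStat_ne_zero_iff pos).1 ne⟩)).symm
  rw [tail_eq]
  refine (mul_sum_le_sum_range_of_few smallStat_anti smallStat_eq_zero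
    (mul_self_le_capacity ht pos coarse large) (fun i hi => ?_) ?_).trans (sum_smallStat_le ht)
  · have := (mem_Ico.1 hi).1
    omega
  · rw [Nat.card_Ico]
    omega

theorem mul_tailLoad_capacity_le : 64 * S.N * tailLoad (S.smallStat n) n S.capacity ≤
    64 * S.N * tailLoad (S.smallStat n) n S.k + prefixLoad S.R n := by
  have few_big := card_heavyJobs_add_card_lightJobs_le ht pos coarse
  have capacity_eq : S.capacity = S.k - max #S.heavyJobs #S.lightJobs := rfl
  have between := mul_sum_le_sum_range_of_few (A := Ico S.capacity S.k) (smallStat_anti (S := S))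
    (smallStat_eq_zero (n := n)) (mul_self_le_capacity ht pos coarse large)
    (fun i hi => (mem_Ico.1 hi).1) (by rw [Nat.card_Ico]; omega)
  have := Nat.mul_le_mul_left (64 * S.N)
    (tailLoad_le_sum_Ico_add_tailLoad (S.smallStat n) n S.capacity S.k)
  have := sum_smallStat_le ht
  rw [mul_add] at *
  omega

theorem loads_le_of_unbalanced (hn : n ≤ 2 * S.k) {X : Finset ℕ} {c : ℕ}
    (hX : IsSplit (range n) S.R S.k c X)
    (unbalanced : ∑ i ∈ range (S.lead n), gain (64 * S.N) S.capacity n (S.smallStat n) i <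
      64 * S.N * (S.heavyLoad - S.lightLoad)) :
    64 * S.N * sumBelow (S.RightAt n) S.R n ≤ 64 * S.N * c + 3 * prefixLoad S.R n ∧
      64 * S.N * sumBelow (fun j => ¬S.RightAt n j) S.R n ≤
        64 * S.N * c + 3 * prefixLoad S.R n := by
  have split := unbalanced_split (a := #S.heavyJobs) (b := #S.lightJobs) smallStat_anti
    smallStat_eq_zero unbalanced
  have left := Nat.mul_le_mul_left (64 * S.N) split.1
  have right := Nat.mul_le_mul_left (64 * S.N) split.2
  have lower_bound := heavyLoad_add_tailLoad_le ht hn hX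
  have total_le := prefixLoad_mono (R := S.R) ht
  have overflow := mul_tailLoad_two_mul_capacity_le ht pos coarse large hn
  have tail := mul_tailLoad_capacity_le ht pos coarse large
  rw [load_rightAt ht, load_not_rightAt ht]
  change 64 * S.N * (S.heavyLoad + sumBelow (fun i => ¬S.RightRank n i) (S.smallStat n) n) ≤ _
    at left
  change 64 * S.N * (S.lightLoad + sumBelow (S.RightRank n) (S.smallStat n) n) ≤ _ at right
  simp only [mul_add] at *
  omega

variable (small : ∀ j < n, ¬S.IsBig j → S.Δ * S.R j ≤ prefixLoad S.R n)

include small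

theorem loads_le_of_balanced (hN : 0 < S.N) (hn : n ≤ 2 * S.k) {X : Finset ℕ} {c : ℕ}
    (hX : IsSplit (range n) S.R S.k c X)
    (balanced : 64 * S.N * (S.heavyLoad - S.lightLoad) ≤
      ∑ i ∈ range (S.lead n), gain (64 * S.N) S.capacity n (S.smallStat n) i) :
    64 * S.N * sumBelow (S.RightAt n) S.R n ≤ 64 * S.N * c + 3 * prefixLoad S.R n ∧
      64 * S.N * sumBelow (fun j => ¬S.RightAt n j) S.R n ≤
        64 * S.N * c + 3 * prefixLoad S.R n := by
  have card_eq := card_bigJobs_add_card_smallJobs ht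
  have light_le := (lightLoad_le (S := S) (by omega)).trans
    (Nat.add_le_add_left (prefixLoad_mono ht) _)
  have close := balanced_split (a := #S.heavyJobs) (b := #S.lightJobs) smallStat_anti
    smallStat_eq_zero light_le (mul_smallStat_zero_le small coarse hN)
    (mul_tailLoad_two_mul_capacity_le ht pos coarse large hn) (sum_smallStat_le ht) balanced
  have total := congrArg (64 * S.N * ·) (sumBelow_add_not (S.RightAt n) S.R n)
  have total_le : prefixLoad S.R n ≤ 2 * c := by
    have := sum_sdiff (f := S.R) hX.subset
    have := hX.load_le
    have := hX.load_sdiff_le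
    rw [prefixLoad]
    omega
  have scaled_total_le := Nat.mul_le_mul_left (64 * S.N) total_le
  change |((64 * S.N : ℕ) * (S.lightLoad + sumBelow (S.RightRank n) (S.smallStat n) n) : ℤ) -
    (64 * S.N : ℕ) * (S.heavyLoad + sumBelow (fun i => ¬S.RightRank n i) (S.smallStat n) n)| ≤ _
    at close
  rw [← Nat.cast_add, ← Nat.cast_add, ← load_rightAt ht, ← load_not_rightAt ht, abs_le] at close
  simp only [mul_add, ← prefixLoad.eq_1] at total
  rw [show 64 * S.N * (2 * c) = 2 * (64 * S.N * c) by ring] at scaled_total_le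
  constructor <;> zify at * <;> linarith

theorem loads_le_of_coarse (hN : 0 < S.N) (hn : n ≤ 2 * S.k) {X : Finset ℕ} {c : ℕ}
    (hX : IsSplit (range n) S.R S.k c X) :
    64 * S.N * sumBelow (S.RightAt n) S.R n ≤ 64 * S.N * c + 3 * prefixLoad S.R n ∧
      64 * S.N * sumBelow (fun j => ¬S.RightAt n j) S.R n ≤
        64 * S.N * c + 3 * prefixLoad S.R n :=
  (le_or_gt _ _).elim (loads_le_of_balanced ht pos coarse large small hN hn hX)
    (loads_le_of_unbalanced ht pos coarse large hn hX)

end Coarse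

end Phase

section CurrentPhase

variable {N k n Δ : ℕ} {R : ℕ → ℕ}

theorem lt_epoch_iff {i : ℕ} : i < epoch Δ R n ↔ i < n ∧ ∃ u < n, i ≤ u ∧ Renews Δ R u :=
  lt_countBelow_iff fun _ _ hij ⟨u, hu, le_u, renews⟩ => ⟨u, hu, hij.trans le_u, renews⟩

theorem epoch_le : epoch Δ R n ≤ n := countBelow_le _ _

theorem mul_le_prefixLoad_of_not_isBig {j : ℕ} (hj : j < n)
    (not_big : ¬(currentPhase N k R n).IsBig j) : granularity N k * R j ≤ prefixLoad R n := by
  by_cases early : j < epoch (granularity N k) R n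
  · have too_small := not_le.1 fun h => not_big ⟨early, h⟩
    exact too_small.le.trans (prefixLoad_mono epoch_le)
  · have no_renewal : ¬Renews (granularity N k) R j := fun renews =>
      early (lt_epoch_iff.2 ⟨hj, j, hj, le_rfl, renews⟩)
    exact (not_le.1 no_renewal).le.trans (prefixLoad_mono hj)

theorem currentPhase_loads_le (hN : 0 < N) (hn : n ≤ 2 * k) (pos : ∀ j < n, 0 < R j)
    {X : Finset ℕ} {c : ℕ} (hX : IsSplit (range n) R k c X) :
    4 * N * sumBelow ((currentPhase N k R n).RightAt n) R n ≤ 4 * N * c + prefixLoad R n ∧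
      4 * N * sumBelow (fun j => ¬(currentPhase N k R n).RightAt n j) R n ≤
        4 * N * c + prefixLoad R n := by
  suffices h : 64 * N * sumBelow ((currentPhase N k R n).RightAt n) R n ≤
      64 * N * c + 3 * prefixLoad R n ∧
      64 * N * sumBelow (fun j => ¬(currentPhase N k R n).RightAt n j) R n ≤
        64 * N * c + 3 * prefixLoad R n by
    constructor <;> nlinarith only [h.1, h.2]
  by_cases few_jobs : k ≤ 8192 * (N * N)
  · have fine : 64 * N * n ≤ granularity N k :=
      calc 64 * N * n ≤ 64 * N * (2 * (8192 * (N * N))) :=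
            Nat.mul_le_mul_left _ (hn.trans (Nat.mul_le_mul_left _ few_jobs))
        _ = granularity N k := by
            rw [granularity, if_pos few_jobs]
            ring
    exact Phase.loads_le_of_fine (S := currentPhase N k R n) epoch_le
      (fun j => mul_le_prefixLoad_of_not_isBig) hn fine hX
  · exact Phase.loads_le_of_coarse (S := currentPhase N k R n) epoch_le pos (if_neg few_jobs)
      (not_le.1 few_jobs).le (fun j => mul_le_prefixLoad_of_not_isBig) hN hn hX

end CurrentPhase

/-! ### Migration -/

theorem sumBelow_le_prefixLoad (P : ℕ → Prop) (R : ℕ → ℕ) (n : ℕ) :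
    sumBelow P R n ≤ prefixLoad R n := by
  classical
  rw [sumBelow_eq_sum]
  exact sum_le_sum_of_subset (filter_subset _ _)

theorem granularity_le {N k : ℕ} (hN : 0 < N) : granularity N k ≤ 1048576 * (N * N * N) := by
  rw [granularity]
  split_ifs
  · exact le_rfl
  · gcongr
    · norm_num
    · exact Nat.le_mul_of_pos_left N (by positivity)

theorem epoch_succ {Δ n : ℕ} {R : ℕ → ℕ} (no_renewal : ¬Renews Δ R n) :
    epoch Δ R (n + 1) = epoch Δ R n := by
  refine eq_of_forall_lt_iff fun i => ?_
  rw [lt_epoch_iff, lt_epoch_iff]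
  constructor
  · rintro ⟨-, u, hu, le_u, renews⟩
    have ne : u ≠ n := fun h => no_renewal (h ▸ renews)
    exact ⟨by omega, u, by omega, le_u, renews⟩
  · rintro ⟨hi, u, hu, h⟩
    exact ⟨by omega, u, by omega, h⟩

theorem Phase.sumBelow_rightAt_ne_le {S : Phase} {n G : ℕ} (hN : 0 < S.N) (hG : 0 < G)
    (ht : S.t ≤ n) (gap : ∀ i ≤ n, ∀ j ≤ n, S.R i < S.R j → S.R j ≤ G * (S.R j - S.R i)) :
    sumBelow (fun j => ¬(S.RightAt n j ↔ S.RightAt (n + 1) j)) S.R n ≤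
      576 * (S.N * G) * S.R n := by
  have small : ¬S.IsBig n := fun big => ht.not_gt big.1
  set B := (range n).sup S.R
  let middleQuota (v : ℕ) : ℕ := quota S.capacity (S.lead n) #S.heavyJobs #S.lightJobs (n + 1)
    (S.smallStat (n + 1)) v
  have rank_shift :
      ∑ v ∈ Icc 1 B, v * Nat.dist (S.rightQuota n v) (middleQuota v) ≤ G * S.R n :=
    sum_mul_dist_orderStat_insert_le _ small hG gap B
  have lead_shift : ∑ v ∈ Icc 1 B, v * Nat.dist (middleQuota v) (S.rightQuota (n + 1) v) ≤
      8 * G * (64 * S.N) * S.R n := by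
    refine le_of_mul_le_mul_left ?_ (by positivity : 0 < 64 * S.N)
    calc _ ≤ 2 * G * ((64 * S.N + 1) * (64 * S.N + 1) * S.R n) :=
          (isInsertion_orderStat S.R small).mul_sum_mul_dist_quota_cutoff_le hG
            (fun i l => orderStat_gap hG fun i hi j hj =>
              gap i (Nat.lt_succ_iff.1 hi) j (Nat.lt_succ_iff.1 hj)) B
      _ ≤ 2 * G * ((2 * (64 * S.N)) * (2 * (64 * S.N)) * S.R n) := by gcongr <;> omega
      _ = _ := by ring
  calc _ = sumBelow (fun j => ¬S.IsBig j ∧ ¬(Chosen (fun i => ¬S.IsBig i) S.R (S.rightQuota n) j ↔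
          Chosen (fun i => ¬S.IsBig i) S.R (S.rightQuota (n + 1)) j)) S.R n :=
        sumBelow_congr (fun j _ => by by_cases h : S.IsBig j <;> simp [RightAt, h]) fun _ _ => rfl
    _ ≤ ∑ v ∈ Icc 1 B, v * Nat.dist (S.rightQuota n v) (S.rightQuota (n + 1) v) :=
        sum_chosen_ne_le _ _ fun j hj => le_sup (f := S.R) (mem_range.2 hj)
    _ ≤ ∑ v ∈ Icc 1 B, (v * Nat.dist (S.rightQuota n v) (middleQuota v) +
          v * Nat.dist (middleQuota v) (S.rightQuota (n + 1) v)) :=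
        sum_le_sum fun v _ => by
          rw [← mul_add]
          exact Nat.mul_le_mul_left v (Nat.dist.triangle_inequality _ _ _)
    _ ≤ G * S.R n + 8 * G * (64 * S.N) * S.R n := by
        rw [sum_add_distrib]
        exact Nat.add_le_add rank_shift lead_shift
    _ ≤ 64 * S.N * (G * S.R n) + 8 * G * (64 * S.N) * S.R n :=
        Nat.add_le_add_right (Nat.le_mul_of_pos_left _ (by positivity)) _
    _ = _ := by ring

theorem sumBelow_currentPhase_rightAt_ne_le {N k n : ℕ} {R : ℕ → ℕ} (hN : 0 < N)
    (gap : ∀ i ≤ n, ∀ j ≤ n, R i < R j → R j ≤ (16 * N + 1) * (R j - R i)) :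
    sumBelow (fun j => ¬((currentPhase N k R n).RightAt n j ↔
      (currentPhase N k R (n + 1)).RightAt (n + 1) j)) R n ≤ 1048576 * (N * N * N) * R n := by
  by_cases renews : Renews (granularity N k) R n
  · calc _ ≤ prefixLoad R n := sumBelow_le_prefixLoad _ _ _
      _ ≤ prefixLoad R (n + 1) := prefixLoad_mono n.le_succ
      _ ≤ granularity N k * R n := renews
      _ ≤ _ := Nat.mul_le_mul_right _ (granularity_le hN)
  · have same_phase : currentPhase N k R (n + 1) = currentPhase N k R n := by
      rw [currentPhase, currentPhase, epoch_succ renews]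
    rw [same_phase]
    refine (Phase.sumBelow_rightAt_ne_le (S := currentPhase N k R n) hN (Nat.succ_pos (16 * N))
      epoch_le gap).trans (Nat.mul_le_mul_right _ ?_)
    change 576 * (N * (16 * N + 1)) ≤ 1048576 * (N * N * N)
    nlinarith only [Nat.mul_le_mul_left (N * N) hN, Nat.mul_le_mul_left N hN]

/-! ### Scaling -/

section Scaling

variable {n c : ℕ} {R R' : ℕ → ℕ}

theorem prefixLoad_scale {m : ℕ} (hm : m ≤ n) (h : ∀ j < n, R' j = c * R j) :
    prefixLoad R' m = c * prefixLoad R m := by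
  rw [prefixLoad, prefixLoad, mul_sum]
  exact sum_congr rfl fun j hj => h j ((mem_range.1 hj).trans_le hm)

theorem epoch_scale {Δ : ℕ} (hc : 0 < c) (h : ∀ j < n, R' j = c * R j) :
    epoch Δ R' n = epoch Δ R n :=
  countBelow_congr fun _ _ => exists_congr fun u => and_congr_right fun hu =>
    and_congr_right fun _ => by
      rw [Renews, Renews, prefixLoad_scale hu h, h u hu, mul_left_comm]
      exact Nat.mul_le_mul_left_iff hc

theorem orderStat_scale {J : ℕ → Prop} (hc : 0 < c) (h : ∀ j < n, R' j = c * R j) (i : ℕ) :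
    orderStat J R' n i = c * orderStat J R n i := by
  classical
  have countGe_scale (j : ℕ) (hj : j < n) : countGe J R' n (R' j) = countGe J R n (R j) :=
    countBelow_congr fun l hl => by rw [h j hj, h l hl, Nat.mul_le_mul_left_iff hc]
  rw [orderStat, orderStat, apply_sup_eq_sup_comp (c * ·)
    (fun _ _ => (Nat.mul_max_mul_left _ _ _).symm) (mul_zero c)]
  refine sup_congr rfl fun j hj => ?_
  rw [mem_range] at hj
  rw [countGe_scale j hj, h j hj, Function.comp_apply]
  split_ifs
  · rfl
  · exact (mul_zero c).symm

theorem cutoff_scale {Λ κ D : ℕ} (s : ℕ → ℕ) (hc : 0 < c) :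
    cutoff Λ κ n (c * D) (fun i => c * s i) = cutoff Λ κ n D s := by
  have gain_scale (i : ℕ) : gain Λ κ n (fun i => c * s i) i = c * gain Λ κ n s i := by
    rw [gain, gain, ← Nat.mul_sub, mul_left_comm, mul_left_comm (Λ + 1), Nat.mul_min_mul_left]
  simp only [cutoff, gain_scale, ← mul_sum, mul_left_comm Λ c, Nat.mul_lt_mul_left hc]

end Scaling

namespace Phase

/-- The phase `S'` differs from `S` only in that the sizes of the jobs below `n` are multiplied by
`c`, and the sizes of later jobs are arbitrary. -/
structure IsScaling (S S' : Phase) (n c : ℕ) : Prop where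
  N : S'.N = S.N
  k : S'.k = S.k
  Δ : S'.Δ = S.Δ
  t : S'.t = S.t
  t_le : S.t ≤ n
  pos : 0 < c
  R : ∀ j < n, S'.R j = c * S.R j

namespace IsScaling

variable {S S' : Phase} {n c : ℕ} (h : S.IsScaling S' n c)

include h

theorem prefixLoad_t : prefixLoad S'.R S'.t = c * prefixLoad S.R S.t := by
  rw [h.t, prefixLoad_scale h.t_le h.R]

theorem isBig : S'.IsBig = S.IsBig := by
  refine funext fun j => propext ?_
  rw [IsBig, IsBig, h.prefixLoad_t, h.t, h.Δ]
  refine and_congr_right fun hj => ?_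
  rw [h.R j (hj.trans_le h.t_le), mul_left_comm]
  exact Nat.mul_le_mul_left_iff h.pos

theorem bigJobs (m : ℕ) : S'.bigJobs m = S.bigJobs m := by
  ext j
  rw [mem_bigJobs, mem_bigJobs, h.isBig]

theorem R_eq_of_mem {j : ℕ} (hj : j ∈ S.bigJobs S.t) : S'.R j = c * S.R j :=
  h.R j ((mem_bigJobs.1 hj).1.trans_le h.t_le)

theorem resolution : S'.resolution = S.resolution := by
  rw [Phase.resolution, Phase.resolution, h.N, h.t]

theorem weight {j : ℕ} (hj : j < n) : S'.weight j = S.weight j := by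
  rw [Phase.weight, Phase.weight, h.resolution, h.prefixLoad_t, h.R j hj, mul_assoc,
    Nat.mul_div_mul_left _ _ h.pos]

theorem code {j : ℕ} (hj : j < n) : S'.code j = S.code j := by
  rw [Phase.code, Phase.code, h.weight hj, h.t]

theorem genFun {m : ℕ} (hm : m ≤ n) : S'.genFun m = S.genFun m := by
  rw [Phase.genFun, Phase.genFun, h.isBig, h.t]
  exact prod_congr rfl fun j hj => by rw [h.code ((mem_range.1 hj).trans_le hm)]

theorem reach {m v : ℕ} (hm : m ≤ n) : S'.Reach m v ↔ S.Reach m v := by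
  rw [Reach, Reach, h.genFun hm, h.t]

theorem bestCode : S'.bestCode = S.bestCode := by
  have sum_weight : ∑ j ∈ S.bigJobs S.t, S'.weight j = ∑ j ∈ S.bigJobs S.t, S.weight j :=
    sum_congr rfl fun j hj => h.weight ((mem_bigJobs.1 hj).1.trans_le h.t_le)
  have codeBound : S'.codeBound = S.codeBound := by
    rw [Phase.codeBound, Phase.codeBound, h.resolution, h.t]
  have goodCode (v : ℕ) : S'.GoodCode v ↔ S.GoodCode v := by
    rw [GoodCode, GoodCode, h.t, h.k, h.bigJobs, h.reach h.t_le, sum_weight]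
  rw [Phase.bestCode, Phase.bestCode, codeBound]
  simp only [goodCode]

theorem residual (hn : 0 < n) (i : ℕ) : S'.residual i = S.residual i := by
  induction i with
  | zero => exact h.bestCode
  | succ i ih =>
    have lt : S.t - 1 - i < n := by have := h.t_le; omega
    rw [Phase.residual, Phase.residual, ih, h.t, h.code lt, propext (h.reach lt.le)]

theorem isHeavy (hn : 0 < n) : S'.IsHeavy = S.IsHeavy := by
  refine funext fun j => propext ?_
  rw [IsHeavy, IsHeavy, h.isBig, h.t, h.residual hn]
  exact and_congr_right fun big => not_congr (h.reach (big.1.le.trans h.t_le))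

theorem heavyJobs (hn : 0 < n) : S'.heavyJobs = S.heavyJobs := by
  ext j
  rw [mem_heavyJobs, mem_heavyJobs, h.t, h.isHeavy hn]

theorem lightJobs (hn : 0 < n) : S'.lightJobs = S.lightJobs := by
  rw [lightJobs_eq_sdiff, lightJobs_eq_sdiff, h.t, h.bigJobs, h.heavyJobs hn]

theorem heavyLoad (hn : 0 < n) : S'.heavyLoad = c * S.heavyLoad := by
  rw [Phase.heavyLoad, Phase.heavyLoad, h.heavyJobs hn, mul_sum]
  exact sum_congr rfl fun j hj => h.R_eq_of_mem (heavyJobs_subset hj)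

theorem lightLoad (hn : 0 < n) : S'.lightLoad = c * S.lightLoad := by
  rw [Phase.lightLoad, Phase.lightLoad, h.lightJobs hn, mul_sum]
  refine sum_congr rfl fun j hj => h.R_eq_of_mem ?_
  rw [lightJobs_eq_sdiff] at hj
  exact sdiff_subset hj

theorem capacity (hn : 0 < n) : S'.capacity = S.capacity := by
  rw [Phase.capacity, Phase.capacity, h.k, h.heavyJobs hn, h.lightJobs hn]

theorem smallStat : S'.smallStat n = fun i => c * S.smallStat n i := by
  funext i
  rw [Phase.smallStat, Phase.smallStat, h.isBig, orderStat_scale h.pos h.R]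

theorem lead (hn : 0 < n) : S'.lead n = S.lead n := by
  rw [Phase.lead, Phase.lead, h.N, h.capacity hn, h.heavyLoad hn, h.lightLoad hn, ← Nat.mul_sub,
    h.smallStat, cutoff_scale _ h.pos]

theorem rightQuota (hn : 0 < n) (v : ℕ) : S'.rightQuota n (c * v) = S.rightQuota n v := by
  rw [Phase.rightQuota, Phase.rightQuota, h.capacity hn, h.lead hn, h.heavyJobs hn,
    h.lightJobs hn, h.smallStat]
  exact countBelow_congr fun i _ => by rw [Nat.mul_right_inj h.pos.ne']

theorem rightAt {j : ℕ} (hj : j < n) : S'.RightAt n j ↔ S.RightAt n j := by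
  have hn : 0 < n := Nat.zero_lt_of_lt hj
  have rank : countBelow (fun i => ¬S.IsBig i ∧ S'.R i = S'.R j) j =
      countBelow (fun i => ¬S.IsBig i ∧ S.R i = S.R j) j := countBelow_congr fun i hi => by
    rw [h.R i (hi.trans hj), h.R j hj, Nat.mul_right_inj h.pos.ne']
  rw [RightAt, RightAt, Chosen, Chosen, h.isBig, h.isHeavy hn, rank, h.R j hj, h.rightQuota hn]

end IsScaling

end Phase

theorem currentPhase_rightAt_scale {N k n c : ℕ} {R R' : ℕ → ℕ} (hc : 0 < c)
    (h : ∀ j < n, R' j = c * R j) {j : ℕ} (hj : j < n) :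
    (currentPhase N k R' n).RightAt n j ↔ (currentPhase N k R n).RightAt n j :=
  Phase.IsScaling.rightAt (S' := currentPhase N k R' n) (S := currentPhase N k R n)
    ⟨rfl, rfl, rfl, epoch_scale hc h, epoch_le, hc, h⟩ hj

/-! ### Rounding -/

section Rounding

variable {I : Input} {j : ℕ}

theorem two_pow_size_le {x : ℕ} (hx : 0 < x) : 2 ^ Nat.size x ≤ 2 * x := by
  have size_pos : 0 < Nat.size x := Nat.size_pos.2 hx
  rw [← Nat.sub_one_add_one size_pos.ne', pow_succ']
  exact Nat.mul_le_mul_left 2 (Nat.lt_size.1 (Nat.sub_one_lt size_pos.ne'))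

theorem mantissa_le (hden : 0 < I.den j) : mantissa I j ≤ 16 * I.N := by
  refine Nat.div_le_of_le_mul ?_
  calc 8 * I.N * I.num j * 2 ^ Nat.size (I.den j)
      ≤ 8 * I.N * 2 ^ Nat.size (I.num j) * (2 * I.den j) := by
        gcongr
        · exact (Nat.lt_size_self _).le
        · exact two_pow_size_le hden
    _ = _ := by ring

theorem le_mantissa (hnum : 0 < I.num j) (hden : 0 < I.den j) : 4 * I.N ≤ mantissa I j := by
  rw [mantissa, Nat.le_div_iff_mul_le (by positivity)]
  calc 4 * I.N * (I.den j * 2 ^ Nat.size (I.num j))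
      ≤ 4 * I.N * (2 ^ Nat.size (I.den j) * (2 * I.num j)) := by
        gcongr
        · exact (Nat.lt_size_self _).le
        · exact two_pow_size_le hnum
    _ = _ := by ring

theorem rounded_pos (hN : 0 < I.N) (hnum : 0 < I.num j) (hden : 0 < I.den j) :
    0 < rounded I j :=
  Nat.mul_pos ((Nat.mul_pos four_pos hN).trans_le (le_mantissa hnum hden)) (Nat.two_pow_pos _)

/-- Both sizes are multiples of `2 ^ e` for the smaller exponent `e`, and hence so is their
difference. -/
theorem rounded_gap {i : ℕ} (hden_i : 0 < I.den i) (hden_j : 0 < I.den j)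
    (hlt : rounded I i < rounded I j) :
    rounded I j ≤ (16 * I.N + 1) * (rounded I j - rounded I i) := by
  have le_two_pow {l : ℕ} (hden : 0 < I.den l) : rounded I l ≤ 16 * I.N * 2 ^ exponent I l :=
    Nat.mul_le_mul_right _ (mantissa_le hden)
  have two_pow_dvd {e l : ℕ} (he : e ≤ exponent I l) : 2 ^ e ∣ rounded I l :=
    (pow_dvd_pow 2 he).mul_left _
  have two_pow_le {e : ℕ} (hi : e ≤ exponent I i) (hj : e ≤ exponent I j) :
      2 ^ e ≤ rounded I j - rounded I i :=
    Nat.le_of_dvd (Nat.sub_pos_of_lt hlt) (Nat.dvd_sub (two_pow_dvd hj) (two_pow_dvd hi))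
  rw [add_mul, one_mul]
  rcases le_total (exponent I i) (exponent I j) with he | he
  · have bound_i := (le_two_pow hden_i).trans (Nat.mul_le_mul_left _ (two_pow_le le_rfl he))
    omega
  · have bound_j := (le_two_pow hden_j).trans (Nat.mul_le_mul_left _ (two_pow_le he le_rfl))
    omega

/-- The factor by which rounding scales all sizes up, apart from the rounding errors. -/
def scale (I : Input) : ℕ := 8 * I.N * 2 ^ ∑ i ∈ range I.n, Nat.size (I.den i)

theorem size_den_le (hj : j < I.n) : Nat.size (I.den j) ≤ ∑ i ∈ range I.n, Nat.size (I.den i) :=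
  single_le_sum (f := fun i => Nat.size (I.den i)) (fun _ _ => Nat.zero_le _) (mem_range.2 hj)

theorem scale_eq (hj : j < I.n) : scale I = 8 * I.N * 2 ^ Nat.size (I.den j) *
    2 ^ (∑ i ∈ range I.n, Nat.size (I.den i) - Nat.size (I.den j)) := by
  rw [scale, mul_assoc (8 * I.N), ← pow_add, Nat.add_sub_cancel' (size_den_le hj)]

theorem rounded_mul_den_le (hj : j < I.n) : rounded I j * I.den j ≤ scale I * I.num j := by
  rw [rounded, scale_eq hj, exponent, pow_add]
  set E := 2 ^ (∑ i ∈ range I.n, Nat.size (I.den i) - Nat.size (I.den j))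
  calc mantissa I j * (2 ^ Nat.size (I.num j) * E) * I.den j
      = mantissa I j * (I.den j * 2 ^ Nat.size (I.num j)) * E := by ring
    _ ≤ 8 * I.N * I.num j * 2 ^ Nat.size (I.den j) * E :=
        Nat.mul_le_mul_right _ (Nat.div_mul_le_self _ _)
    _ = _ := by ring

theorem scale_mul_num_le (hj : j < I.n) (hnum : 0 < I.num j) (hden : 0 < I.den j) :
    4 * I.N * (scale I * I.num j) ≤ (4 * I.N + 1) * (rounded I j * I.den j) := by
  rw [rounded, scale_eq hj, exponent, pow_add]
  set E := 2 ^ (∑ i ∈ range I.n, Nat.size (I.den i) - Nat.size (I.den j))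
  have lt_succ_mantissa : 8 * I.N * I.num j * 2 ^ Nat.size (I.den j) ≤
      (mantissa I j + 1) * (I.den j * 2 ^ Nat.size (I.num j)) := by
    rw [mul_comm (mantissa I j + 1)]
    exact (Nat.lt_mul_div_succ _ (by positivity)).le
  have relative_error : 4 * I.N * (mantissa I j + 1) ≤ (4 * I.N + 1) * mantissa I j := by
    rw [mul_add, add_mul, mul_one, one_mul]
    exact Nat.add_le_add_left (le_mantissa hnum hden) _
  calc 4 * I.N * (8 * I.N * 2 ^ Nat.size (I.den j) * E * I.num j)
      = 4 * I.N * (8 * I.N * I.num j * 2 ^ Nat.size (I.den j)) * E := by ring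
    _ ≤ 4 * I.N * ((mantissa I j + 1) * (I.den j * 2 ^ Nat.size (I.num j))) * E := by gcongr
    _ = 4 * I.N * (mantissa I j + 1) * (I.den j * 2 ^ Nat.size (I.num j)) * E := by ring
    _ ≤ (4 * I.N + 1) * mantissa I j * (I.den j * 2 ^ Nat.size (I.num j)) * E := by gcongr
    _ = _ := by ring

end Rounding

/-! ### The online algorithm -/

section FinSums

variable {n : ℕ} {P : ℕ → Prop}

theorem sum_filter_eq_sumBelow {Q : Fin n → Prop} [DecidablePred Q] (h : ∀ j : Fin n, Q j ↔ P j)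
    (f : ℕ → ℕ) : ∑ j with Q j, f j = sumBelow P f n := by
  classical
  rw [sumBelow_eq_sum, sum_filter, sum_filter, sum_range]
  exact sum_congr rfl fun j _ => by simp only [h]

theorem card_filter_eq_countBelow {Q : Fin n → Prop} [DecidablePred Q]
    (h : ∀ j : Fin n, Q j ↔ P j) : #{j | Q j} = countBelow P n := by
  rw [card_eq_sum_ones, ← sumBelow_one, ← sum_filter_eq_sumBelow h]

end FinSums

section Schedules

variable {n k : ℕ}

theorem fin_two_eq_zero_iff (i : Fin 2) : i = 0 ↔ ¬i = 1 := by
  revert i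
  decide

theorem feasible_of_countBelow {σ : Fin n → Fin 2} {P : ℕ → Prop} (h : ∀ j, σ j = 1 ↔ P j)
    (count_le : countBelow P n ≤ k) (count_not_le : countBelow (fun j => ¬P j) n ≤ k) :
    Feasible k σ := by
  refine Fin.forall_fin_two.2 ⟨?_, ?_⟩
  · rwa [card_filter_eq_countBelow (P := fun j => ¬P j) fun j =>
      (fin_two_eq_zero_iff _).trans (not_congr (h j))]
  · rwa [card_filter_eq_countBelow h]

theorem range_sdiff_map_filter (τ : Fin n → Fin 2) :
    range n \ map Fin.valEmbedding {j | τ j = 1} = map Fin.valEmbedding {j | τ j = 0} := by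
  rw [← Nat.Iio_eq_range, ← Fin.map_valEmbedding_univ, ← Finset.map_sdiff, ← filter_not]
  simp only [fin_two_eq_zero_iff]

theorem Feasible.isSplit {τ : Fin n → Fin 2} (hτ : Feasible k τ) {R : ℕ → ℕ} {c : ℕ}
    (hc : ∀ i, ∑ j with τ j = i, R j ≤ c) :
    IsSplit (range n) R k c (map Fin.valEmbedding {j | τ j = 1}) where
  subset j hj := by
    obtain ⟨i, -, rfl⟩ := mem_map.1 hj
    exact mem_range.2 i.2
  card_le := by rw [card_map]; exact hτ 1
  card_sdiff_le := by rw [range_sdiff_map_filter, card_map]; exact hτ 0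
  load_le := by rw [sum_map]; exact hc 1
  load_sdiff_le := by rw [range_sdiff_map_filter, sum_map]; exact hc 0

theorem IsSplit.prefixLoad_le {R : ℕ → ℕ} {c : ℕ} {X : Finset ℕ} (h : IsSplit (range n) R k c X) :
    prefixLoad R n ≤ 2 * c := by
  rw [prefixLoad, ← sum_sdiff h.subset, two_mul]
  exact Nat.add_le_add h.load_sdiff_le h.load_le

theorem load_le_makespan {m : ℕ} (p : Fin n → ℚ) (σ : Fin n → Fin m) (i : Fin m) :
    load p σ i ≤ makespan p σ :=
  le_ciSup (f := load p σ) (Set.finite_range _).bddAbove i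

theorem makespan_le_mul_optCost {m : ℕ} {p : Fin n → ℚ} {σ : Fin n → Fin m} {α : ℝ} (hα : 0 < α)
    (hσ : Feasible k σ) (h : ∀ τ : Fin n → Fin m, Feasible k τ → makespan p σ ≤ α * makespan p τ) :
    makespan p σ ≤ α * optCost m k p := by
  rw [← div_le_iff₀' hα]
  refine le_csInf ⟨_, σ, hσ, rfl⟩ ?_
  rintro _ ⟨τ, hτ, rfl⟩
  exact (div_le_iff₀' hα).2 (h τ hτ)

theorem load_nonneg {m : ℕ} {p : Fin n → ℚ} (hp : ∀ j, 0 < p j) (σ : Fin n → Fin m) (i : Fin m) :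
    0 ≤ load p σ i :=
  sum_nonneg fun j _ => by exact_mod_cast (hp j).le

theorem sum_load {m : ℕ} (p : Fin n → ℚ) (σ : Fin n → Fin m) :
    ∑ i, load p σ i = ∑ j, (p j : ℝ) :=
  sum_fiberwise univ σ fun j => (p j : ℝ)

theorem makespan_le_card_mul_makespan {m : ℕ} [NeZero m] {p : Fin n → ℚ} (hp : ∀ j, 0 < p j)
    (σ τ : Fin n → Fin m) : makespan p σ ≤ m * makespan p τ := by
  refine ciSup_le fun i => ?_
  calc load p σ i ≤ ∑ l, load p σ l :=
        single_le_sum (fun l _ => load_nonneg hp σ l) (mem_univ i)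
    _ = ∑ l, load p τ l := by rw [sum_load, sum_load]
    _ ≤ ∑ _l : Fin m, makespan p τ := sum_le_sum fun l _ => load_le_makespan p τ l
    _ = m * makespan p τ := by rw [sum_const, card_univ, Fintype.card_fin, nsmul_eq_mul]

end Schedules

/-- The input that the initial memory `inputMem N k p` holds. -/
def inputOf {n : ℕ} (N k : ℕ) (p : Fin n → ℚ) : Input where
  N := N
  k := k
  n := n
  num := (inputMem N k p).arr 0
  den := (inputMem N k p).arr 1

section InputOf

variable {n N k : ℕ} {p : Fin n → ℚ}

theorem inputOf_num (j : Fin n) : (inputOf N k p).num j = (p j).num.natAbs := dif_pos j.2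

theorem inputOf_den (j : Fin n) : (inputOf N k p).den j = (p j).den := dif_pos j.2

theorem storedIn_inputMem : (inputOf N k p).StoredIn (inputMem N k p) :=
  ⟨rfl, rfl, rfl, fun _ => rfl, fun _ => rfl⟩

theorem size_num_add_size_den_le (j : ℕ) :
    Nat.size ((inputOf N k p).num j) + Nat.size ((inputOf N k p).den j) ≤ encLength k p := by
  by_cases hj : j < n
  · lift j to Fin n using hj
    rw [inputOf_num, inputOf_den]
    exact (single_le_sum (f := fun j => Nat.size (p j).num.natAbs + Nat.size (p j).den)
      (fun _ _ => Nat.zero_le _) (mem_univ j)).trans (Nat.le_add_left _ _)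
  · simp [inputOf, inputMem, hj]

theorem le_encLength : n ≤ encLength k p :=
  calc n = ∑ _j : Fin n, 1 := by rw [← card_eq_sum_ones, card_univ, Fintype.card_fin]
    _ ≤ ∑ j, (Nat.size (p j).num.natAbs + Nat.size (p j).den) := sum_le_sum fun j _ =>
        Nat.le_add_left_of_le (Nat.size_pos.2 (p j).den_pos)
    _ ≤ encLength k p := Nat.le_add_left _ _

theorem bounded_inputOf : (inputOf N k p).Bounded [] (N + encLength k p) where
  N_le := Nat.le_add_right _ _
  n_le := Nat.le_add_left_of_le le_encLength
  size_k_le := Nat.le_add_left_of_le (Nat.le_add_right _ _)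
  size_num_le j := Nat.le_add_left_of_le ((Nat.le_add_right _ _).trans (size_num_add_size_den_le j))
  size_den_le j := Nat.le_add_left_of_le ((Nat.le_add_left _ _).trans (size_num_add_size_den_le j))
  env_le _ hx := absurd hx List.not_mem_nil

theorem inputOf_num_pos (hp : ∀ j, 0 < p j) {j : ℕ} (hj : j < n) : 0 < (inputOf N k p).num j := by
  lift j to Fin n using hj
  rw [inputOf_num, Int.natAbs_pos]
  exact (Rat.num_pos.2 (hp j)).ne'

theorem inputOf_den_pos {j : ℕ} (hj : j < n) : 0 < (inputOf N k p).den j := by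
  lift j to Fin n using hj
  rw [inputOf_den]
  exact (p j).den_pos

theorem rounded_inputOf_pos (hN : 0 < N) (hp : ∀ j, 0 < p j) {j : ℕ} (hj : j < n) :
    0 < rounded (inputOf N k p) j :=
  rounded_pos hN (inputOf_num_pos hp hj) (inputOf_den_pos hj)

theorem mul_inputOf_den (hp : ∀ j, 0 < p j) (j : Fin n) :
    (p j : ℝ) * (inputOf N k p).den j = (inputOf N k p).num j := by
  rw [inputOf_num, inputOf_den]
  have mul_den : p j * (p j).den = ((p j).num.natAbs : ℚ) := by
    rw [Rat.mul_den_eq_num, Nat.cast_natAbs, abs_of_pos (Rat.num_pos.2 (hp j))]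
  exact_mod_cast mul_den

theorem rounded_le_scale_mul (hp : ∀ j, 0 < p j) (j : Fin n) :
    (rounded (inputOf N k p) j : ℝ) ≤ scale (inputOf N k p) * p j := by
  have den_pos : (0 : ℝ) < (inputOf N k p).den j := by exact_mod_cast inputOf_den_pos j.2
  refine le_of_mul_le_mul_right ?_ den_pos
  rw [mul_assoc, mul_inputOf_den hp]
  exact_mod_cast rounded_mul_den_le (I := inputOf N k p) j.2

theorem scale_mul_le_rounded (hp : ∀ j, 0 < p j) (j : Fin n) :
    4 * N * (scale (inputOf N k p) * p j) ≤ (4 * N + 1) * (rounded (inputOf N k p) j : ℝ) := by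
  have den_pos : (0 : ℝ) < (inputOf N k p).den j := by exact_mod_cast inputOf_den_pos j.2
  refine le_of_mul_le_mul_right ?_ den_pos
  rw [mul_assoc, mul_assoc (scale _ : ℝ), mul_inputOf_den hp, mul_assoc (4 * N + 1 : ℝ)]
  exact_mod_cast scale_mul_num_le (I := inputOf N k p) j.2 (inputOf_num_pos hp j.2)
    (inputOf_den_pos j.2)

theorem sum_rounded_le {ι : Type*} (hp : ∀ j, 0 < p j) (s : Finset ι) (f : ι → Fin n) :
    ((∑ l ∈ s, rounded (inputOf N k p) (f l) : ℕ) : ℝ) ≤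
      scale (inputOf N k p) * ∑ l ∈ s, (p (f l) : ℝ) := by
  rw [mul_sum, Nat.cast_sum]
  exact sum_le_sum fun l _ => rounded_le_scale_mul hp (f l)

theorem scale_mul_sum_le {ι : Type*} (hp : ∀ j, 0 < p j) (s : Finset ι) (f : ι → Fin n) :
    4 * N * (scale (inputOf N k p) * ∑ l ∈ s, (p (f l) : ℝ)) ≤
      (4 * N + 1) * ((∑ l ∈ s, rounded (inputOf N k p) (f l) : ℕ) : ℝ) := by
  simp only [mul_sum, Nat.cast_sum]
  exact sum_le_sum fun l _ => scale_mul_le_rounded hp (f l)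

theorem scale_inputOf_pos (hN : 0 < N) : (0 : ℝ) < scale (inputOf N k p) := by
  have : 0 < (inputOf N k p).N := hN
  have scale_pos : 0 < scale (inputOf N k p) := by
    rw [scale]
    positivity
  exact_mod_cast scale_pos

end InputOf

theorem machine_lt_two (I : Input) (j : ℕ) : machine I j < 2 := by
  rw [machine]
  split_ifs <;> omega

/-- The online algorithm with accuracy `N`, which holds the schedules that the program computes. -/
noncomputable def schedule (N k : ℕ) : OnlineAlg 2 :=
  fun _ p j => ⟨machine (inputOf N k p) j, machine_lt_two _ _⟩

section Schedule

variable {n N k : ℕ}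

theorem schedule_eq_one_iff_of_le (hN : N ≤ 1) (p : Fin n → ℚ) (j : Fin n) :
    schedule N k n p j = 1 ↔ k ≤ j := by
  rw [Fin.ext_iff]
  change (if N ≤ 1 then if k ≤ j then 1 else 0 else _) = 1 ↔ _
  rw [if_pos hN]
  split_ifs with h <;> simp only [h]

theorem schedule_eq_one_iff (hN : 1 < N) (p : Fin n → ℚ) (j : Fin n) :
    schedule N k n p j = 1 ↔ (currentPhase N k (rounded (inputOf N k p)) n).RightAt n j := by
  classical
  rw [Fin.ext_iff]
  change (if N ≤ 1 then _ else if (currentPhase N k (rounded (inputOf N k p)) n).RightAt n j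
    then 1 else 0) = 1 ↔ _
  rw [if_neg (not_le.2 hN)]
  split_ifs with h <;> simp only [h]

theorem schedule_eq_zero_iff (hN : 1 < N) (p : Fin n → ℚ) (j : Fin n) :
    schedule N k n p j = 0 ↔ ¬(currentPhase N k (rounded (inputOf N k p)) n).RightAt n j := by
  rw [fin_two_eq_zero_iff, schedule_eq_one_iff hN]

theorem feasible_schedule {p : Fin n → ℚ} (hp : ValidInput 2 k p) :
    Feasible k (schedule N k n p) := by
  rcases Nat.lt_or_ge 1 N with hN | hN
  · obtain ⟨count_le, count_not_le⟩ :=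
      Phase.feasible_rightAt (S := currentPhase N k (rounded (inputOf N k p)) n) epoch_le hp.2
        fun j hj => rounded_inputOf_pos (by omega) hp.1 hj
    exact feasible_of_countBelow (schedule_eq_one_iff hN p) count_le count_not_le
  · have hn : n ≤ 2 * k := hp.2
    refine feasible_of_countBelow (schedule_eq_one_iff_of_le hN p) ?_ ?_
    · calc countBelow (fun j => k ≤ j) n ≤ #(Ico k n) := by
            rw [countBelow_eq_card]
            exact card_le_card fun j hj => by simp_all
        _ ≤ k := by rw [Nat.card_Ico]; omega
    · calc countBelow (fun j => ¬k ≤ j) n ≤ #(range k) := by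
            rw [countBelow_eq_card]
            exact card_le_card fun j hj => by simp_all
        _ = k := card_range k

theorem sum_rounded_schedule_le (hN : 1 < N) {p : Fin n → ℚ} (hp : ValidInput 2 k p) {c : ℕ}
    {X : Finset ℕ} (hX : IsSplit (range n) (rounded (inputOf N k p)) k c X) (i : Fin 2) :
    4 * N * ∑ j with schedule N k n p j = i, rounded (inputOf N k p) j ≤ (4 * N + 2) * c := by
  obtain ⟨right_le, left_le⟩ := currentPhase_loads_le (zero_lt_one.trans hN) hp.2
    (fun j => rounded_inputOf_pos (zero_lt_one.trans hN) hp.1) hX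
  rw [add_mul]
  refine le_trans ?_ (Nat.add_le_add_left hX.prefixLoad_le _)
  revert i
  refine Fin.forall_fin_two.2 ⟨?_, ?_⟩
  · exact (congrArg (4 * N * ·)
      (sum_filter_eq_sumBelow (schedule_eq_zero_iff hN p) _)).trans_le left_le
  · exact (congrArg (4 * N * ·)
      (sum_filter_eq_sumBelow (schedule_eq_one_iff hN p) _)).trans_le right_le

theorem makespan_schedule_le (hN : 1 < N) {ε : ℝ} (hε : 1 ≤ ε * N) {p : Fin n → ℚ}
    (hp : ValidInput 2 k p) {τ : Fin n → Fin 2} (hτ : Feasible k τ) :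
    makespan p (schedule N k n p) ≤ (1 + ε) * makespan p τ := by
  set R := rounded (inputOf N k p)
  set q : ℝ := ((scale (inputOf N k p) : ℕ) : ℝ)
  have q_pos : 0 < q := scale_inputOf_pos (by omega)
  have N_ge : (1 : ℝ) ≤ N := by exact_mod_cast hN.le
  have makespan_nonneg : 0 ≤ makespan p τ := (load_nonneg hp.1 τ 0).trans (load_le_makespan p τ 0)
  obtain ⟨i₀, -, c_eq⟩ := exists_mem_eq_sup univ univ_nonempty
    fun i => ∑ j with τ j = i, R j
  set c := univ.sup fun i => ∑ j with τ j = i, R j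
  have c_le : (c : ℝ) ≤ q * makespan p τ := by
    rw [c_eq]
    refine (sum_rounded_le hp.1 _ id).trans ?_
    gcongr
    exact load_le_makespan p τ i₀
  have split := hτ.isSplit fun i => le_sup (f := fun i => ∑ j with τ j = i, R j) (mem_univ i)
  refine ciSup_le fun i => ?_
  set W := ∑ j with schedule N k n p j = i, R j
  have W_le : 4 * N * (W : ℝ) ≤ (4 * N + 2) * c := by
    exact_mod_cast sum_rounded_schedule_le hN hp split i
  refine le_of_mul_le_mul_left ?_ (by positivity : 0 < 4 * N * (4 * N) * q)
  calc 4 * N * (4 * N) * q * load p (schedule N k n p) i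
      = 4 * N * (4 * N * (q * load p (schedule N k n p) i)) := by ring
    _ ≤ 4 * N * ((4 * N + 1) * W) :=
        mul_le_mul_of_nonneg_left (scale_mul_sum_le hp.1 _ id) (by positivity)
    _ = (4 * N + 1) * (4 * N * W) := by ring
    _ ≤ (4 * N + 1) * ((4 * N + 2) * (q * makespan p τ)) := by
        refine mul_le_mul_of_nonneg_left (W_le.trans ?_) (by positivity)
        gcongr
    _ = (4 * N + 1) * (4 * N + 2) * (q * makespan p τ) := by ring
    _ ≤ 16 * N * (N + ε * N) * (q * makespan p τ) := by
        refine mul_le_mul_of_nonneg_right ?_ (by positivity)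
        nlinarith only [N_ge, hε]
    _ = _ := by ring

theorem makespan_schedule_le_mul_optCost {ε : ℝ} (hε : 0 < ε) (hN : 1 ≤ ε * N) {p : Fin n → ℚ}
    (hp : ValidInput 2 k p) : makespan p (schedule N k n p) ≤ (1 + ε) * optCost 2 k p := by
  refine makespan_le_mul_optCost (by positivity) (feasible_schedule hp) fun τ hτ => ?_
  rcases Nat.lt_or_ge 1 N with h | h
  · exact makespan_schedule_le h hN hp hτ
  · have one_le : 1 ≤ ε := hN.trans (mul_le_of_le_one_right hε.le (by exact_mod_cast h))
    refine (makespan_le_card_mul_makespan hp.1 _ τ).trans ?_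
    gcongr
    · exact (load_nonneg hp.1 τ 0).trans (load_le_makespan p τ 0)
    · push_cast
      linarith

theorem rounded_castSucc (p : Fin (n + 1) → ℚ) {j : ℕ} (hj : j < n) :
    rounded (inputOf N k p) j = 2 ^ Nat.size (p (Fin.last n)).den *
      rounded (inputOf N k fun l => p l.castSucc) j := by
  set I := inputOf N k p
  set I' := inputOf N k fun l => p l.castSucc
  have num_eq : I.num j = I'.num j :=
    (inputOf_num (p := p) (Fin.castSucc ⟨j, hj⟩)).trans
      (inputOf_num (p := fun l => p l.castSucc) ⟨j, hj⟩).symm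
  have den_eq (i : ℕ) (hi : i < n) : I.den i = I'.den i :=
    (inputOf_den (p := p) (Fin.castSucc ⟨i, hi⟩)).trans
      (inputOf_den (p := fun l => p l.castSucc) ⟨i, hi⟩).symm
  have mantissa_eq : mantissa I j = mantissa I' j := by
    rw [mantissa, mantissa, num_eq, den_eq j hj]
    rfl
  have exponent_eq : exponent I j = Nat.size (p (Fin.last n)).den + exponent I' j := by
    have size_le : Nat.size (I'.den j) ≤ ∑ i ∈ range n, Nat.size (I'.den i) :=
      size_den_le (I := I') hj
    have sum_eq : ∑ i ∈ range (n + 1), Nat.size (I.den i) =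
        ∑ i ∈ range n, Nat.size (I'.den i) + Nat.size (p (Fin.last n)).den := by
      rw [sum_range_succ, sum_congr rfl fun i hi => by rw [den_eq i (mem_range.1 hi)]]
      exact congrArg (_ + Nat.size ·) (inputOf_den (p := p) (Fin.last n))
    rw [exponent, exponent, num_eq, den_eq j hj]
    change _ + (∑ i ∈ range (n + 1), Nat.size (I.den i) - _) =
      _ + (_ + (∑ i ∈ range n, Nat.size (I'.den i) - _))
    omega
  rw [rounded, rounded, mantissa_eq, exponent_eq, pow_add, mul_left_comm]

theorem schedule_ne_iff (hN : 1 < N) (p : Fin (n + 1) → ℚ) (j : Fin n) :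
    schedule N k n (fun l => p l.castSucc) j ≠ schedule N k (n + 1) p j.castSucc ↔
      ¬((currentPhase N k (rounded (inputOf N k p)) n).RightAt n j ↔
        (currentPhase N k (rounded (inputOf N k p)) (n + 1)).RightAt (n + 1) j) := by
  rw [ne_eq, Fin.eq_iff_eq_zero_iff, schedule_eq_zero_iff hN, schedule_eq_zero_iff hN,
    ← currentPhase_rightAt_scale (Nat.two_pow_pos _) (fun _ => rounded_castSucc p) j.2,
    not_iff_not, Fin.val_castSucc]
  exact not_iff_not

theorem migration_schedule_le (hN : 1 < N) {p : Fin (n + 1) → ℚ} (hp : ∀ j, 0 < p j) :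
    migration (schedule N k) p ≤ 2097152 * N ^ 3 * (p (Fin.last n) : ℝ) := by
  set R := rounded (inputOf N k p)
  set q : ℝ := ((scale (inputOf N k p) : ℕ) : ℝ)
  set W := ∑ j : Fin n with schedule N k n (fun l => p l.castSucc) j ≠
    schedule N k (n + 1) p j.castSucc, R j
  have q_pos : 0 < q := scale_inputOf_pos (by omega)
  have N_ge : (1 : ℝ) ≤ N := by exact_mod_cast hN.le
  have : (0 : ℝ) < p (Fin.last n) := by exact_mod_cast hp _
  have W_le_nat : W ≤ 1048576 * (N * N * N) * R n := by
    classical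
    exact (sum_filter_eq_sumBelow (schedule_ne_iff hN p) R).trans_le
      (sumBelow_currentPhase_rightAt_ne_le (by omega) fun i hi j hj =>
        rounded_gap (inputOf_den_pos (by omega)) (inputOf_den_pos (by omega)))
  have W_le : (W : ℝ) ≤ 1048576 * (N * N * N) * (q * p (Fin.last n)) :=
    calc (W : ℝ) ≤ 1048576 * (N * N * N) * R n := by exact_mod_cast W_le_nat
      _ ≤ _ := by gcongr; exact rounded_le_scale_mul hp (Fin.last n)
  refine le_of_mul_le_mul_left ?_ (by positivity : 0 < 4 * N * q)
  calc 4 * N * q * migration (schedule N k) p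
      = 4 * N * (q * migration (schedule N k) p) := by ring
    _ ≤ (4 * N + 1) * (W : ℝ) := scale_mul_sum_le hp _ Fin.castSucc
    _ ≤ 8 * N * (1048576 * (N * N * N) * (q * p (Fin.last n))) := by
        gcongr
        linarith
    _ = _ := by ring

theorem migration_schedule_eq_zero (hN : N ≤ 1) (p : Fin (n + 1) → ℚ) :
    migration (schedule N k) p = 0 := by
  refine sum_eq_zero fun j hj => absurd ?_ (mem_filter.1 hj).2
  rw [Fin.eq_iff_eq_zero_iff, fin_two_eq_zero_iff, fin_two_eq_zero_iff,
    schedule_eq_one_iff_of_le hN, schedule_eq_one_iff_of_le hN, Fin.val_castSucc]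

/-- No job migrates if `ε ≥ 1`, and otherwise larger exponents only weaken the bound. -/
theorem migration_schedule_ceil_le {ε : ℝ} (hε : 0 < ε) {d : ℕ} (hd : 3 ≤ d) {p : Fin (n + 1) → ℚ}
    (hp : ∀ j, 0 < p j) :
    migration (schedule ⌈1 / ε⌉₊ k) p ≤ 16777216 / ε ^ d * (p (Fin.last n) : ℝ) := by
  have last_pos : (0 : ℝ) < p (Fin.last n) := by exact_mod_cast hp _
  rcases Nat.lt_or_ge 1 ⌈1 / ε⌉₊ with hN | hN
  · have one_lt : 1 < 1 / ε := by rwa [Nat.lt_ceil, Nat.cast_one] at hN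
    have ceil_le : (⌈1 / ε⌉₊ : ℝ) ≤ 2 * (1 / ε) := by
      linarith [Nat.ceil_lt_add_one (zero_le_one.trans one_lt.le)]
    refine (migration_schedule_le hN hp).trans ?_
    gcongr
    calc 2097152 * (⌈1 / ε⌉₊ : ℝ) ^ 3 ≤ 2097152 * (2 * (1 / ε)) ^ 3 := by gcongr
      _ = 16777216 * (1 / ε) ^ 3 := by ring
      _ ≤ 16777216 * (1 / ε) ^ d := by gcongr; exact one_lt.le
      _ = 16777216 / ε ^ d := by rw [one_div, inv_pow, div_eq_mul_inv]
  · rw [migration_schedule_eq_zero hN]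
    positivity

theorem isRobustApprox_schedule {ε : ℝ} (hε : 0 < ε) {d : ℕ} (hd : 3 ≤ d) :
    IsRobustApprox 2 k (1 + ε) (16777216 / ε ^ d) (schedule ⌈1 / ε⌉₊ k) where
  feasible _ _ := feasible_schedule
  approx _ _ := makespan_schedule_le_mul_optCost hε ((div_le_iff₀' hε).1 (Nat.le_ceil _))
  migrate _ _ hp := migration_schedule_ceil_le hε hd hp.1

end Schedule

/-! ### Separating the parameters of a polynomial bound -/

section Eval

variable {x y : ℝ}

theorem aeval_le_aeval (T : ℕ[X]) (hx : 0 ≤ x) (hxy : x ≤ y) : aeval x T ≤ aeval y T := by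
  simp only [aeval_eq_sum_range]
  gcongr

theorem aeval_nonneg (T : ℕ[X]) (hx : 0 ≤ x) : 0 ≤ aeval x T := by
  rw [aeval_eq_sum_range]
  positivity

/-- The coefficients satisfy `c ≤ c * c`. -/
theorem aeval_mul_le (T : ℕ[X]) (hx : 0 ≤ x) (hy : 0 ≤ y) :
    aeval (x * y) T ≤ aeval x T * aeval y T := by
  induction T using Polynomial.induction_on' with
  | add S T hS hT =>
    simp only [map_add]
    nlinarith only [hS, hT, mul_nonneg (aeval_nonneg S hx) (aeval_nonneg T hy),
      mul_nonneg (aeval_nonneg T hx) (aeval_nonneg S hy)]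
  | monomial i c =>
    have le_mul_self : (c : ℝ) ≤ c * c := by exact_mod_cast Nat.le_mul_self c
    simp only [aeval_monomial, eq_natCast]
    calc (c : ℝ) * (x * y) ^ i ≤ c * c * (x * y) ^ i := by gcongr
      _ = c * x ^ i * (c * y ^ i) := by ring

theorem exists_eval_add_le_mul (T : ℕ[X]) :
    ∃ P Q : ℝ[X], ∀ (x : ℝ) (N L : ℕ), 0 ≤ x → N ≤ x + 1 →
      ((T.eval (N + L) : ℕ) : ℝ) ≤ P.eval x * Q.eval (L : ℝ) := by
  refine ⟨(T.map (algebraMap ℕ ℝ)).comp (X + 2), (T.map (algebraMap ℕ ℝ)).comp (X + 1),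
    fun x N L hx hN => ?_⟩
  have : (0 : ℝ) ≤ L := L.cast_nonneg
  have separate : (N + L : ℝ) ≤ (x + 2) * (L + 1) := by nlinarith
  calc ((T.eval (N + L) : ℕ) : ℝ) = aeval (N + L : ℝ) T := by
        exact_mod_cast (aeval_algebraMap_apply_eq_algebraMap_eval (A := ℝ) (N + L) T).symm
    _ ≤ aeval ((x + 2) * (L + 1)) T := aeval_le_aeval T (by positivity) separate
    _ ≤ aeval (x + 2) T * aeval (L + 1 : ℝ) T := aeval_mul_le T (by positivity) (by positivity)
    _ = _ := by
        simp only [eval_comp, eval_add, eval_X, eval_ofNat, eval_one, eval_map_algebraMap]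

end Eval

theorem exists_prog_outputsInTime :
    ∃ (prog : Prog) (P Q : ℝ[X]), ∀ (x : ℝ), 0 ≤ x → ∀ (k n : ℕ) (p : Fin n → ℚ),
      OutputsInTime prog ⌈x⌉₊ k p (schedule ⌈x⌉₊ k n p)
        (P.eval x * Q.eval (encLength k p : ℝ)) := by
  obtain ⟨prog, T, hprog⟩ := polyTime_machine.exists_output_program
  obtain ⟨P, Q, hPQ⟩ := exists_eval_add_le_mul T
  refine ⟨prog, P, Q, fun x hx k n p => ?_⟩
  obtain ⟨t, M, exec, time_le, output⟩ := hprog _ _ _ storedIn_inputMem bounded_inputOf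
  refine ⟨t, M, exec, ?_, fun j => output j j.2⟩
  exact le_trans (by exact_mod_cast time_le) (hPQ x _ _ hx (Nat.ceil_lt_add_one hx).le)

end CCS

theorem mainTheorem6_general :
    ∃ (prog : CCS.Prog) (C : ℝ) (P Q : Polynomial ℝ),
      ∀ (ε : ℝ) (k : ℕ), 0 < ε →
        ∃ A : CCS.OnlineAlg 2,
          (∀ d : ℕ, 3 ≤ d → CCS.IsRobustApprox 2 k (1 + ε) (C / ε ^ d) A) ∧
          ∀ (n : ℕ) (p : Fin n → ℚ),
            CCS.OutputsInTime prog ⌈1 / ε⌉₊ k p (A n p)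
              (P.eval (1 / ε) * Q.eval (CCS.encLength k p : ℝ)) := by
  obtain ⟨prog, P, Q, run⟩ := CCS.exists_prog_outputsInTime
  exact ⟨prog, 16777216, P, Q, fun ε k hε => ⟨CCS.schedule ⌈1 / ε⌉₊ k,
    fun d hd => CCS.isRobustApprox_schedule hε hd,
    run (1 / ε) (by positivity) k⟩⟩

/-- On two machines there is a robust FPTAS with migration factor `O(1/ε⁵)` for `k > 1/ε²`: one
program, given `⌈1/ε⌉`, `k` and the jobs released so far, computes the current schedule of a robust
`(1+ε)`-approximation algorithm, in time bounded by a polynomial in `1/ε` times a polynomial in the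
binary encoding length of the input. -/
theorem mainTheorem6 :
    ∃ (prog : CCS.Prog) (C : ℝ) (P Q : Polynomial ℝ),
      ∀ (ε : ℝ) (k : ℕ), 0 < ε → 1 / ε ^ 2 < (k : ℝ) →
        ∃ A : CCS.OnlineAlg 2,
          CCS.IsRobustApprox 2 k (1 + ε) (C / ε ^ 5) A ∧
          ∀ (n : ℕ) (p : Fin n → ℚ), CCS.ValidInput 2 k p →
            CCS.OutputsInTime prog ⌈1 / ε⌉₊ k p (A n p)
              (P.eval (1 / ε) * Q.eval (CCS.encLength k p : ℝ)) := by
  obtain ⟨prog, C, P, Q, general⟩ := mainTheorem6_general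
  exact ⟨prog, C, P, Q, fun ε k hε _ =>
    (general ε k hε).imp fun _ hA => ⟨hA.1 5 (by norm_num), fun n p _ => hA.2 n p⟩⟩
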